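/- Let $D$ be the planar rectangular diagram of an oriented link given by a grid diagram of size $n\ge 2$: an $n\times n$ grid with exactly one $O$ and one $X$ (in different squares) in each row and each column; the $O$ and the $X$ (the punctures) of each row are joined by a horizontal segment oriented from $O$ to $X$, those of each column by a vertical segment oriented from $X$ to $O$, and vertical segments pass over horizontal ones. For each vertical segment draw a narrow figure-eight, as short as possible, which winds clockwise around the upper and counterclockwise around the lower end of the segment, with a single transversal self-intersection, placed anywhere on the segment away from the horizontal segments; distinct figure-eights are disjoint, and each meets transversally the horizontal segments that cross its vertical segment (twice each) or end at one of its two punctures (once each), and no others. Let $\mathcal G$ be the set of $n$-tuples of intersection points of figure-eights and horizontal segments such that each figure-eight and each horizontal segment contains exactly one of the points (Bigelow's generators), and let $\mathbf x\in\mathcal G$ be formed by the points nearest to the $X$'s. For $g\in\mathcal G$ let $\overline P(g)$ be the number of points of $g$ on upward oriented parts of the figure-eights, and $T(g)$ the number of pairs $(a,b)$ of points of $g$ with $b$ strictly above and strictly to the right of $a$. Let $Q$ be the function on $\mathcal G$ with $Q(\mathbf x)=0$ such that $Q(g)-Q(h)$ is the sum, over all punctures, of the winding number of the closed curves that go from $g$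 to $h$ along the horizontal segments and back from $h$ to $g$ along the figure-eights. Let $w(D)$ be the writhe of $D$, and $\mathrm{rot}(D)$ the number of counterclockwise minus the number of clockwise Seifert circles of $D$. Put $$J(g)=2\bigl(T(g)-Q(g)\bigr)-2T(\mathbf x)+\mathrm{rot}(D)+w(D),\qquad P(g)=\overline P(g)-\overline P(\mathbf x)-\mathrm{rot}(D)-w(D).$$ Let $(C^{*,*},d)$ be the Khovanov complex of $D$ over $\mathbb Z$, generated by the enhanced Kauffman states of $D$, with homological grading $i$ and quantum grading $j$ (so $d$ raises $i$ by $1$, preserves $j$, and $d^2=0$), and let $\mathrm{Kh}^{i,j}$ be its homology. Let $B$ be the free abelian group generated by $\mathcal G$. Theorem. There is an endomorphism $\delta$ of $B$ with $\delta^2=0$ which preserves the grading $J$ and raises the grading $P$ by $1$, such that the homology of $(B,\delta)$ is Khovanov homology: for all $p,q\in\mathbb Z$, the homology of $(B,\delta)$ in degree $P=p$, $J=q$ is isomorphic to $\mathrm{Kh}^{p+q,\,q}$. Moreover $\delta$ can be chosen so that, with $i=P+J$ and $j=J$, the complex $(B,\delta)$ is homotopy equivalent to $(C,d)$ by chain maps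 that preserve both gradings and chain homotopies that lower $i$ by $1$ and preserve $j$. -/

import Mathlib

noncomputable section

/-! ### Bigraded free abelian groups, differentials and homology -/

/-- The bidegree `(p, q)` part of the free abelian group on a set `S` whose elements carry
two integer gradings `a` and `b`. -/
def gradedPiece {S : Type*} (a b : S → ℤ) (p q : ℤ) : Submodule ℤ (S →₀ ℤ) :=
  Finsupp.supported ℤ ℤ {s | a s = p ∧ b s = q}

/-- `f` is homogeneous of bidegree `(m, k)`. -/
def HasBidegree {S S' : Type*} (a b : S → ℤ) (a' b' : S' → ℤ)
    (f : (S →₀ ℤ) →ₗ[ℤ] (S' →₀ ℤ)) (m k : ℤ) : Prop :=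
  ∀ p q : ℤ, ∀ u ∈ gradedPiece a b p q, f u ∈ gradedPiece a' b' (p + m) (q + k)

/-- `d` is a differential which raises the grading `a` by one and preserves the grading `b`. -/
structure IsBigradedDifferential {S : Type*} (a b : S → ℤ)
    (d : (S →₀ ℤ) →ₗ[ℤ] (S →₀ ℤ)) : Prop where
  bidegree : HasBidegree a b a b d 1 0
  sq_zero : d ∘ₗ d = 0

/-- Cycles of bidegree `(p, q)`. -/
def cycles {S : Type*} (a b : S → ℤ) (d : (S →₀ ℤ) →ₗ[ℤ] (S →₀ ℤ)) (p q : ℤ) :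
    Submodule ℤ (S →₀ ℤ) :=
  gradedPiece a b p q ⊓ LinearMap.ker d

/-- Boundaries of bidegree `(p, q)`, for a differential of bidegree `(1, 0)`. -/
def boundaries {S : Type*} (a b : S → ℤ) (d : (S →₀ ℤ) →ₗ[ℤ] (S →₀ ℤ)) (p q : ℤ) :
    Submodule ℤ (S →₀ ℤ) :=
  (gradedPiece a b (p - 1) q).map d

/-- Homology in bidegree `(p, q)`: cycles modulo boundaries. -/
abbrev BigradedHomology {S : Type*} (a b : S → ℤ) (d : (S →₀ ℤ) →ₗ[ℤ] (S →₀ ℤ)) (p q : ℤ) :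
    Type _ :=
  cycles a b d p q ⧸ (boundaries a b d p q).submoduleOf (cycles a b d p q)

/-- Chain homotopy equivalence of bigraded complexes, with chain maps of bidegree `(0, 0)`
and homotopies of bidegree `(-1, 0)`. -/
def BigradedHomotopyEquivalent {S S' : Type*} (a b : S → ℤ) (d : (S →₀ ℤ) →ₗ[ℤ] (S →₀ ℤ))
    (a' b' : S' → ℤ) (d' : (S' →₀ ℤ) →ₗ[ℤ] (S' →₀ ℤ)) : Prop :=
  ∃ (f : (S →₀ ℤ) →ₗ[ℤ] (S' →₀ ℤ)) (g : (S' →₀ ℤ) →ₗ[ℤ] (S →₀ ℤ))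
    (h : (S →₀ ℤ) →ₗ[ℤ] (S →₀ ℤ)) (h' : (S' →₀ ℤ) →ₗ[ℤ] (S' →₀ ℤ)),
    HasBidegree a b a' b' f 0 0 ∧ HasBidegree a' b' a b g 0 0 ∧
    HasBidegree a b a b h (-1) 0 ∧ HasBidegree a' b' a' b' h' (-1) 0 ∧
    f ∘ₗ d = d' ∘ₗ f ∧ g ∘ₗ d' = d ∘ₗ g ∧
    g ∘ₗ f - LinearMap.id = h ∘ₗ d + d ∘ₗ h ∧
    f ∘ₗ g - LinearMap.id = h' ∘ₗ d' + d' ∘ₗ h'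

/-! ### Grid diagrams and planar rectangular diagrams -/

/-- A grid diagram of size `n`: the column `c` has its `O` in the row `O c` and its `X` in the
row `X c`. Columns are numbered from left to right and rows from bottom to top. -/
structure GridDiagram (n : ℕ) where
  O : Equiv.Perm (Fin n)
  X : Equiv.Perm (Fin n)
  disjoint : ∀ c, O c ≠ X c

namespace GridDiagram

variable {n : ℕ} (D : GridDiagram n)

/-- The row of the lower end of the vertical segment in column `c`. -/
def bot (c : Fin n) : Fin n := min (D.O c) (D.X c)

/-- The row of the upper end of the vertical segment in column `c`. -/
def top (c : Fin n) : Fin n := max (D.O c) (D.X c)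

/-- The column of the left end of the horizontal segment in row `r`. -/
def left (r : Fin n) : Fin n := min (D.O.symm r) (D.X.symm r)

/-- The column of the right end of the horizontal segment in row `r`. -/
def right (r : Fin n) : Fin n := max (D.O.symm r) (D.X.symm r)

/-- The vertical segment of column `c`, oriented from `X` to `O`, points upward. -/
def goesUp (c : Fin n) : Bool := decide (D.X c < D.O c)

/-- The horizontal segment of row `r`, oriented from `O` to `X`, points rightward. -/
def goesRight (r : Fin n) : Bool := decide (D.O.symm r < D.X.symm r)

/-- The vertical segment of column `c` and the horizontal segment of row `r` cross. The vertical
segment is always the upper strand. -/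
def IsCrossing (c r : Fin n) : Prop :=
  (D.bot c < r ∧ r < D.top c) ∧ (D.left r < c ∧ c < D.right r)

instance (c r : Fin n) : Decidable (D.IsCrossing c r) := by
  unfold IsCrossing; infer_instance

/-- The crossings of the planar rectangular diagram. -/
abbrev Crossing : Type := {k : Fin n × Fin n // D.IsCrossing k.1 k.2}

/-- A crossing is positive if turning the direction of the upper (vertical) strand
counterclockwise by a right angle gives the direction of the lower (horizontal) strand:
(up, left) or (down, right). -/
def isPositive (k : D.Crossing) : Bool := D.goesUp k.1.1 != D.goesRight k.1.2

/-- The number of positive crossings. -/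
def nPos : ℤ := ∑ k : D.Crossing, if D.isPositive k then 1 else 0

/-- The number of negative crossings. -/
def nNeg : ℤ := ∑ k : D.Crossing, if D.isPositive k then 0 else 1

/-- The writhe. -/
def writhe : ℤ := ∑ k : D.Crossing, if D.isPositive k then 1 else -1

/-! ### Resolutions and their circles -/

end GridDiagram

/-- Elementary edges of the `n × n` lattice: `h c r` joins `(c, r)` to `(c + 1, r)`, and
`v c r` joins `(c, r)` to `(c, r + 1)`. -/
inductive LatticeEdge (n : ℕ) where
  | h (c r : Fin n) : LatticeEdge n
  | v (c r : Fin n) : LatticeEdge n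
deriving DecidableEq, Fintype

/-- The four directions around a lattice point. -/
inductive Direction where
  | N | E | S | W

/-- The edge `e` leaves the lattice point `(c, r)` in the given direction. -/
def LatticeEdge.LeavesIn {n : ℕ} (c r : Fin n) : LatticeEdge n → Direction → Prop
  | .h a b, .E => a = c ∧ b = r
  | .h a b, .W => (a : ℕ) + 1 = c ∧ b = r
  | .v a b, .N => a = c ∧ b = r
  | .v a b, .S => a = c ∧ (b : ℕ) + 1 = r
  | _, _ => False

/-- The pairs of directions joined by the two resolutions of a crossing whose upper strand is
vertical. The `0`-resolution (`false`) merges the two regions swept by the upper strand when it is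
turned counterclockwise, namely NW and SE, so its arcs are N–E and S–W; the arcs of the
`1`-resolution (`true`) are N–W and S–E. -/
def ResolutionArc : Bool → Direction → Direction → Prop
  | false, .N, .E => True
  | false, .S, .W => True
  | true, .N, .W => True
  | true, .S, .E => True
  | _, _, _ => False

namespace GridDiagram

variable {n : ℕ} (D : GridDiagram n)

/-- The lattice edge is part of the planar rectangular diagram. -/
def HasEdge : LatticeEdge n → Prop
  | .h c r => D.left r ≤ c ∧ c < D.right r
  | .v c r => D.bot c ≤ r ∧ r < D.top c

/-- The elementary edges of the planar rectangular diagram. -/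
abbrev Edge : Type := {e : LatticeEdge n // D.HasEdge e}

/-- A resolution of the diagram: a choice of `0`- or `1`-resolution at every crossing. -/
abbrev Resolution : Type := D.Crossing → Bool

/-- Two edges of the diagram are adjacent in the resolution `v`: they share a lattice point which
is not a crossing, or they are the two ends of an arc of the resolution of a crossing. -/
def Adjacent (v : D.Resolution) (e e' : D.Edge) : Prop :=
  ∃ (c r : Fin n) (a a' : Direction),
    e.1.LeavesIn c r a ∧ e'.1.LeavesIn c r a' ∧
      ∀ hk : D.IsCrossing c r, ResolutionArc (v ⟨(c, r), hk⟩) a a'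

/-- The circles of a resolution: the classes of edges under the equivalence relation generated by
adjacency. -/
abbrev Circle (v : D.Resolution) : Type := Quot (D.Adjacent v)

/-- The circle through an edge. -/
abbrev circleOf (v : D.Resolution) (e : D.Edge) : D.Circle v := Quot.mk _ e

instance : Finite D.Edge := Subtype.finite

instance (v : D.Resolution) : Fintype (D.Circle v) := Fintype.ofFinite _

/-! ### Seifert circles and the rotation number -/

/-- The oriented resolution: at a positive crossing it is the `0`-resolution, at a negative
crossing it is the `1`-resolution. -/
def seifert : D.Resolution := fun k => !(D.isPositive k)

/-- The contribution `- y dx` of an oriented edge of the diagram to the area integral. -/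
def areaTerm : LatticeEdge n → ℤ
  | .h _ r => if D.goesRight r then -(r : ℤ) else (r : ℤ)
  | .v _ _ => 0

open Classical in
/-- The signed area `∮ - y dx` enclosed by a Seifert circle with its orientation. It is positive
if the circle is oriented counterclockwise and negative otherwise. -/
def signedArea (C : D.Circle D.seifert) : ℤ :=
  ∑ᶠ e : D.Edge, if D.circleOf D.seifert e = C then D.areaTerm e.1 else 0

/-- The rotation number: each Seifert circle contributes `+1` if it is oriented counterclockwise
and `-1` if it is oriented clockwise. -/
def rot : ℤ := ∑ C : D.Circle D.seifert, ((SignType.sign (D.signedArea C) : SignType) : ℤ)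

/-! ### The Khovanov complex -/

/-- Enhanced states: a resolution with a label `1` (`true`) or `x` (`false`) on every circle. -/
abbrev EnhancedState : Type := (v : D.Resolution) × (D.Circle v → Bool)

/-- The label of the circle through an edge. -/
def label (s : D.EnhancedState) (e : D.Edge) : Bool := s.2 (D.circleOf s.1 e)

/-- The number of `1`-resolutions. -/
def height (v : D.Resolution) : ℤ := ∑ k : D.Crossing, if v k then 1 else 0

/-- The homological grading. -/
def khI (s : D.EnhancedState) : ℤ := D.height s.1 - D.nNeg

/-- The quantum grading, where `1` has degree `1` and `x` has degree `-1`. -/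
def khJ (s : D.EnhancedState) : ℤ :=
  (∑ C : D.Circle s.1, if s.2 C then 1 else -1) + D.height s.1 + D.nPos - 2 * D.nNeg

/-- The edge of the diagram above a crossing. -/
def edgeN (k : D.Crossing) : D.Edge :=
  ⟨.v k.1.1 k.1.2, k.2.1.1.le, k.2.1.2⟩

/-- The edge of the diagram below a crossing. -/
def edgeS (k : D.Crossing) : D.Edge :=
  ⟨.v k.1.1 ⟨(k.1.2 : ℕ) - 1, by have := k.1.2.isLt; omega⟩, by
    have h1 := k.2.1.1
    have h2 := k.2.1.2
    simp only [HasEdge, Fin.le_def, Fin.lt_def] at h1 h2 ⊢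
    omega⟩

/-- The multiplication `m : V ⊗ V → V`, `1⊗1 ↦ 1`, `1⊗x ↦ x`, `x⊗1 ↦ x`, `x⊗x ↦ 0`:
`c` occurs in `m (a ⊗ b)`. -/
def MulRule (a b c : Bool) : Prop := (a || b) = true ∧ c = (a && b)

/-- The comultiplication `Δ : V → V ⊗ V`, `1 ↦ 1⊗x + x⊗1`, `x ↦ x⊗x`: `b ⊗ c` occurs in `Δ a`. -/
def ComulRule (a b c : Bool) : Prop := (a = true ∧ b ≠ c) ∨ (a = false ∧ b = false ∧ c = false)

open Classical in
/-- `t` occurs in the image of `s` under the edge map of the cube of resolutions which replaces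
the `0`-resolution of the crossing `k` by the `1`-resolution. The circles away from `k` keep their
labels; two circles which meet at `k` are merged, a circle which meets `k` twice is split. -/
def KhStep (k : D.Crossing) (s t : D.EnhancedState) : Prop :=
  s.1 k = false ∧ t.1 = Function.update s.1 k true ∧
  (∀ e : D.Edge, D.circleOf s.1 e ≠ D.circleOf s.1 (D.edgeN k) →
    D.circleOf s.1 e ≠ D.circleOf s.1 (D.edgeS k) → D.label t e = D.label s e) ∧
  if D.circleOf s.1 (D.edgeN k) = D.circleOf s.1 (D.edgeS k) then
    ComulRule (D.label s (D.edgeN k)) (D.label t (D.edgeN k)) (D.label t (D.edgeS k))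
  else
    MulRule (D.label s (D.edgeN k)) (D.label s (D.edgeS k)) (D.label t (D.edgeN k))

/-- The sign of an edge of the cube: `-1` to the number of `1`-resolutions at crossings which
precede `k` in the lexicographic order. -/
def khSign (v : D.Resolution) (k : D.Crossing) : ℤ :=
  ∏ l : D.Crossing,
    if (l.1.1 < k.1.1 ∨ (l.1.1 = k.1.1 ∧ l.1.2 < k.1.2)) ∧ v l = true then -1 else 1

open Classical in
/-- The coefficient of `t` in the Khovanov differential of `s`. -/
def khCoeff (s t : D.EnhancedState) : ℤ :=
  ∑ k : D.Crossing, if D.KhStep k s t then D.khSign s.1 k else 0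

/-- The Khovanov differential on the free abelian group generated by enhanced states. -/
def khD : (D.EnhancedState →₀ ℤ) →ₗ[ℤ] (D.EnhancedState →₀ ℤ) :=
  Finsupp.linearCombination ℤ fun s => Finsupp.equivFunOnFinite.symm (D.khCoeff s)

/-- The Khovanov homology of the diagram in bidegree `(i, j)`. -/
abbrev Kh (i j : ℤ) : Type := BigradedHomology D.khI D.khJ D.khD i j

/-! ### Figure-eights and Bigelow generators

The lattice point `(c, r)` is drawn at `(4 c, 4 r)`. The figure-eight of column `c` has two
vertical strands at abscissas `4 c - 1` and `4 c + 1`, which go from height `4 bot - 1` to height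
`4 top + 1`, and which exchange sides at the self-intersection. -/

/-- A choice of the heights of the self-intersections of the figure-eights: in column `c` the
self-intersection is at height `4 (level c) + 2`, between the rows `level c` and `level c + 1`. -/
structure FigureEights where
  level : Fin n → Fin n
  bot_le : ∀ c, D.bot c ≤ level c
  lt_top : ∀ c, level c < D.top c

/-- The abscissa of the right (`true`) or left (`false`) strand in column `c`. -/
def strandX (c : Fin n) (side : Bool) : ℤ := 4 * (c : ℤ) + if side then 1 else -1

/-- The right or left strand in column `c` meets the horizontal segment of row `r`. Thus there are
two such points at a crossing and one at a puncture. -/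
def Meets (c r : Fin n) (side : Bool) : Prop :=
  (D.bot c ≤ r ∧ r ≤ D.top c) ∧
    (4 * (D.left r : ℤ) ≤ strandX c side ∧ strandX c side ≤ 4 * (D.right r : ℤ))

/-- A Bigelow generator: one intersection point on each figure-eight, in such a way that each
horizontal segment contains exactly one of these points. The point in column `c` is on the
horizontal segment of row `row c`, on the right strand if `side c` is `true`, and on the left
strand otherwise. -/
@[ext]
structure Generator where
  row : Equiv.Perm (Fin n)
  side : Fin n → Bool
  meets : ∀ c, D.Meets c (row c) (side c)

/-- The generator `𝐱`, made of the points nearest to the `X`'s. -/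
def genX : D.Generator where
  row := D.X
  side := fun c => decide (c < D.O.symm (D.X c))
  meets := by
    intro c
    have hne : D.O.symm (D.X c) ≠ c := by
      intro h
      apply D.disjoint c
      rw [Equiv.symm_apply_eq] at h
      exact h.symm
    have hne' : ((D.O.symm (D.X c) : Fin n) : ℕ) ≠ (c : ℕ) := fun h => hne (Fin.ext h)
    refine ⟨⟨min_le_right _ _, le_max_right _ _⟩, ?_⟩
    simp only [left, right, strandX, Equiv.symm_apply_apply, Fin.coe_min, Fin.coe_max,
      decide_eq_true_eq, Fin.lt_def]
    split_ifs <;> omega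

variable {D}

/-- The intersection point of a generator in column `c`, as a point of the plane. -/
def Generator.point (g : D.Generator) (c : Fin n) : ℤ × ℤ :=
  (strandX c (g.side c), 4 * (g.row c : ℤ))

/-- The grading `T`: the number of pairs of points of the generator, the second of which lies
strictly above and strictly to the right of the first. -/
def Generator.T (g : D.Generator) : ℤ :=
  ∑ c : Fin n, ∑ c' : Fin n,
    if (g.point c).1 < (g.point c').1 ∧ (g.point c).2 < (g.point c').2 then 1 else 0

end GridDiagram

/-! ### Winding numbers of closed polygons -/

/-- The contribution of the oriented segment from `a` to `b` to winding numbers around `p`: the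
signed crossing number with the horizontal ray from `p` to the right, pushed slightly upward. The
winding number of a closed polygon around a point `p` which is not on the polygon is the sum of
the contributions of its sides. -/
def windSegment (p a b : ℤ × ℤ) : ℤ :=
  let area := (b.1 - a.1) * (p.2 - a.2) - (b.2 - a.2) * (p.1 - a.1)
  if a.2 ≤ p.2 ∧ p.2 < b.2 ∧ 0 < area then 1
  else if b.2 ≤ p.2 ∧ p.2 < a.2 ∧ area < 0 then -1
  else 0

/-- The contribution of a polygonal path, given by the list of its vertices. -/
def windPath (p : ℤ × ℤ) : List (ℤ × ℤ) → ℤ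
  | a :: b :: l => windSegment p a b + windPath p (b :: l)
  | _ => 0

namespace GridDiagram

namespace FigureEights

variable {n : ℕ} {D : GridDiagram n} (F : D.FigureEights)

/-- The figure-eight of column `c` as a closed polygon. It goes up on the left of the upper part,
clockwise around the upper puncture, down on the right, through the self-intersection, down on the
left of the lower part, counterclockwise around the lower puncture, up on the right, and through
the self-intersection back to its first vertex. -/
def curve (c : Fin n) : List (ℤ × ℤ) :=
  let x : ℤ := 4 * (c : ℤ)
  let t : ℤ := 4 * (D.top c : ℤ)
  let b : ℤ := 4 * (D.bot c : ℤ)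
  let m : ℤ := 4 * (F.level c : ℤ)
  [(x - 1, m + 3), (x - 1, t + 1), (x + 1, t + 1), (x + 1, m + 3),
   (x - 1, m + 1), (x - 1, b - 1), (x + 1, b - 1), (x + 1, m + 1), (x - 1, m + 3)]

/-- The number of vertices of `curve c` which precede the point of `g` in column `c`. -/
def position (g : D.Generator) (c : Fin n) : ℕ :=
  match decide (F.level c < g.row c), g.side c with
  | true, false => 1
  | true, true => 3
  | false, false => 5
  | false, true => 7

/-- The path along the figure-eight of column `c` from the point of `g` to the last vertex. -/
def tail (g : D.Generator) (c : Fin n) : List (ℤ × ℤ) :=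
  g.point c :: (F.curve c).drop (F.position g c)

/-- A path along the figure-eight of column `c` from the point of `h` to the point of `g`. -/
def pathBetween (h g : D.Generator) (c : Fin n) : List (ℤ × ℤ) :=
  F.tail h c ++ (F.tail g c).reverse

/-- The total winding number around `p` of the loop which goes from `g` to `h` along the
horizontal segments and back from `h` to `g` along the figure-eights. -/
def windingNumber (g h : D.Generator) (p : ℤ × ℤ) : ℤ :=
  (∑ r : Fin n, windPath p [g.point (g.row.symm r), h.point (h.row.symm r)]) +
    ∑ c : Fin n, windPath p (F.pathBetween h g c)

/-- The relative grading `Q(g) - Q(h)`: the sum of the winding numbers around all punctures. -/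
def relQ (g h : D.Generator) : ℤ :=
  (∑ c : Fin n, F.windingNumber g h (4 * (c : ℤ), 4 * (D.X c : ℤ))) +
    ∑ c : Fin n, F.windingNumber g h (4 * (c : ℤ), 4 * (D.O c : ℤ))

/-- The grading `Q`, normalized by `Q(𝐱) = 0`. -/
def Q (g : D.Generator) : ℤ := F.relQ g D.genX

/-- The point of `g` in column `c` sits on an upward part of the figure-eight: on the left strand
above the self-intersection or on the right strand below it. -/
def isUpward (g : D.Generator) (c : Fin n) : Bool :=
  decide (F.level c < g.row c) != g.side c

/-- The grading `P̄`: the number of points on upward parts of the figure-eights. -/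
def barP (g : D.Generator) : ℤ := ∑ c : Fin n, if F.isUpward g c then 1 else 0

/-- The Jones grading. -/
def J (g : D.Generator) : ℤ :=
  2 * (g.T - F.Q g) - 2 * D.genX.T + D.rot + D.writhe

/-- The homological grading. -/
def P (g : D.Generator) : ℤ := F.barP g - F.barP D.genX - D.rot - D.writhe

end FigureEights

end GridDiagram

end

/-! # Bigelow generators and Khovanov homology

The differential `δ` is obtained from the Khovanov complex by cancelling enhanced states in pairs:
`exists_gaussian_elimination` reduces a complex to the generators which are left over by a
matching that is triangular for some function on the generators. What has to be found is a
matching whose unmatched states are the Bigelow generators.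

An enhanced state orients the circles of its resolution, clockwise if the label is `1` and
counterclockwise if the label is `x`. All resolutions of the diagram are compatible with one
checkerboard orientation of its edges, so that `next v` is a permutation of the edges whose cycles
are the circles of `v`, and the orientation of a state becomes a function `orient s` with values
`±1` on the edges. A crossing is a source of the state if both vertical edges are oriented away
from it. Both resolutions of a source are compatible with the orientation, and the two states
which differ in this resolution only are joined by an edge of the cube of resolutions
(`khStep_of_orient_eq`). The matching changes the resolution at one chosen source. It is triangular
by `energy_le_of_khStep`: the sum of the signed areas of the oriented circles does not decrease
under the Khovanov differential, and it is preserved only if the orientation is preserved. This is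
a triangle inequality, as the areas add up when circles are merged or split, and the labels decide
the signs.

In a state without sources each vertical segment is oriented towards a single point, where the
flow turns, and each horizontal segment away from a single point. These points coincide, and they
form a Bigelow generator; at the crossings among them either resolution is possible, which
corresponds to the two strands of the figure-eight. At all other crossings the flow determines the
resolution. Thus the states without sources correspond to the Bigelow generators
(`range_genState`).

The circles of a resolution are closed lattice curves which may touch themselves. Two facts from
plane topology are needed about them. The winding number of a circle takes only the values `0` and
`±1` with a fixed sign, hence the sign of its area tells how it is oriented; and by Hopf's
Umlaufsatz (`LatticeCurve.sum_turn`) the turning number is this sign (`circleSum_turnAfter`).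
Hence the number of circles of each orientation is a sum over edges. This controls how the number
of circles changes at a crossing, which gives the bidegree of the Khovanov differential; its square
vanishes because the edge maps commute with the multiplications by `x` (`ext_of_commute_mulX`).

It remains to compare the gradings (`bidegree_genState`). The turning number of the oriented
circles is the number of quarter turns divided by four, and in a state without sources the quarter
turns in each column are counted by the direction of the figure-eight at the point of the
generator; this gives `P̄`. For `T`, both `T` and the height of the resolution contain the sum over
the crossings of the products of the signs of the flow, by which they differ from sums of terms
which depend on one point of the generator only. In each column the winding numbers that define
`Q` balance these terms (`exists_column_identity`), so that `2 (T - Q) + P̄` minus the height is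
constant. The constants are determined at `𝐱`: its resolution is the oriented one, and its circles
are the Seifert circles with the reversed orientation, so the labels add up to the rotation number.
-/

noncomputable section

/-! ### Bigraded linear algebra and Gaussian elimination -/

section Bigraded

variable {S S' S'' : Type*} {a b : S → ℤ} {a' b' : S' → ℤ} {a'' b'' : S'' → ℤ}

lemma hasBidegree_iff {f : (S →₀ ℤ) →ₗ[ℤ] (S' →₀ ℤ)} {m k : ℤ} :
    HasBidegree a b a' b' f m k ↔
      ∀ s t, f (Finsupp.single s 1) t ≠ 0 → a' t = a s + m ∧ b' t = b s + k := by
  constructor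
  · intro h s t hst
    have h1 := h (a s) (b s) (Finsupp.single s 1)
      (Finsupp.single_mem_supported ℤ (1 : ℤ) (by simp))
    exact (Finsupp.mem_supported ℤ _).1 h1 (Finsupp.mem_support_iff.2 hst)
  · intro h p q u hu
    refine (Finsupp.mem_supported ℤ _).2 fun t ht => ?_
    have hu' := (Finsupp.mem_supported ℤ _).1 hu
    have hsum : f u = u.sum fun s x => x • f (Finsupp.single s 1) := by
      conv_lhs => rw [← Finsupp.sum_single u]
      rw [map_finsuppSum]
      refine Finsupp.sum_congr fun s _ => ?_
      rw [← map_smul]; simp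
    have ht' := Finsupp.mem_support_iff.1 ht
    rw [hsum, Finsupp.sum, Finsupp.finsetSum_apply] at ht'
    obtain ⟨s, hs, hne⟩ := Finset.exists_ne_zero_of_sum_ne_zero ht'
    have h1 := hu' hs
    have h2 := h s t (by intro h0; apply hne; simp [h0])
    simp only [Set.mem_ofPred_eq] at h1 ⊢
    rw [← h1.1, ← h1.2]; exact h2

lemma HasBidegree.comp {f : (S →₀ ℤ) →ₗ[ℤ] (S' →₀ ℤ)} {g : (S' →₀ ℤ) →ₗ[ℤ] (S'' →₀ ℤ)}
    {m k m' k' M K : ℤ} (hg : HasBidegree a' b' a'' b'' g m' k')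
    (hf : HasBidegree a b a' b' f m k) (hM : m + m' = M) (hK : k + k' = K) :
    HasBidegree a b a'' b'' (g ∘ₗ f) M K := by
  intro p q u hu
  have := hg _ _ _ (hf _ _ _ hu)
  rwa [add_assoc, hM, add_assoc, hK] at this

lemma HasBidegree.sub {f g : (S →₀ ℤ) →ₗ[ℤ] (S' →₀ ℤ)} {m k : ℤ}
    (hf : HasBidegree a b a' b' f m k) (hg : HasBidegree a b a' b' g m k) :
    HasBidegree a b a' b' (f - g) m k :=
  fun p q u hu => Submodule.sub_mem _ (hf p q u hu) (hg p q u hu)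

lemma HasBidegree.id : HasBidegree a b a b LinearMap.id 0 0 := by
  intro p q u hu; simpa using hu

lemma hasBidegree_lmapDomain {G : Type*} (r : G → S) :
    HasBidegree (a ∘ r) (b ∘ r) a b (Finsupp.lmapDomain ℤ ℤ r) 0 0 := by
  rw [hasBidegree_iff]
  intro s t h
  simp only [Finsupp.lmapDomain_apply, Finsupp.mapDomain_single] at h
  obtain rfl := Finsupp.single_apply_ne_zero.1 h |>.1
  simp

lemma lcomapDomain_single_of_notMem {G : Type*} {r : G → S} (hr : Function.Injective r) {s : S}
    (hs : s ∉ Set.range r) :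
    Finsupp.lcomapDomain (M := ℤ) (R := ℤ) r hr (Finsupp.single s 1) = 0 := by
  ext g
  simp only [Finsupp.lcomapDomain_apply, Finsupp.comapDomain_apply, Finsupp.coe_zero,
    Pi.zero_apply]
  rw [Finsupp.single_eq_of_ne]
  rintro rfl
  exact hs ⟨g, rfl⟩

lemma lcomapDomain_single {G : Type*} {r : G → S} (hr : Function.Injective r) (g : G) :
    Finsupp.lcomapDomain (M := ℤ) (R := ℤ) r hr (Finsupp.single (r g) 1)
      = Finsupp.single g 1 := by
  classical
  ext g'
  simp [Finsupp.lcomapDomain_apply, Finsupp.single_apply]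

lemma hasBidegree_lcomapDomain {G : Type*} {r : G → S} (hr : Function.Injective r) :
    HasBidegree a b (a ∘ r) (b ∘ r) (Finsupp.lcomapDomain (M := ℤ) (R := ℤ) r hr) 0 0 := by
  rw [hasBidegree_iff]
  intro s t h
  simp only [Finsupp.lcomapDomain_apply, Finsupp.comapDomain_apply] at h
  obtain rfl := Finsupp.single_apply_ne_zero.1 h |>.1
  simp

/-- The inverse of a homogeneous isomorphism is homogeneous. -/
lemma HasBidegree.of_inverse {A : (S →₀ ℤ) →ₗ[ℤ] (S' →₀ ℤ)} {B : (S' →₀ ℤ) →ₗ[ℤ] (S →₀ ℤ)}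
    {m k : ℤ} (hA : HasBidegree a b a' b' A m k) (hBA : B ∘ₗ A = LinearMap.id)
    (hAB : A ∘ₗ B = LinearMap.id) : HasBidegree a' b' a b B (-m) (-k) := by
  classical
  rw [hasBidegree_iff]
  intro t s hst
  by_contra hcon
  set x := B (Finsupp.single t 1) with hx
  have hAx : A x = Finsupp.single t 1 := by rw [hx]; exact LinearMap.congr_fun hAB _
  -- the expected bidegree
  let p : S → Prop := fun s => a s = a' t - m ∧ b s = b' t - k
  have hsplit := Finsupp.filter_add_filter_not x p
  -- the component of `x` outside the expected bidegree is killed by `A`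
  have h1 : A (x.filter fun s => ¬ p s) = 0 := by
    have key : ∀ u : S' , (A (x.filter fun s => ¬ p s)) u ≠ 0 → ¬ (a' u = a' t ∧ b' u = b' t) := by
      intro u hu
      have hsum : A (x.filter fun s => ¬ p s) =
          (x.filter fun s => ¬ p s).sum fun s c => c • A (Finsupp.single s 1) := by
        conv_lhs => rw [← Finsupp.sum_single (x.filter fun s => ¬ p s)]
        rw [map_finsuppSum]
        refine Finsupp.sum_congr fun s _ => ?_
        rw [← map_smul]; simp
      rw [hsum, Finsupp.sum, Finsupp.finsetSum_apply] at hu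
      obtain ⟨s', hs', hne⟩ := Finset.exists_ne_zero_of_sum_ne_zero hu
      have h2 := hasBidegree_iff.1 hA s' u (by intro h0; apply hne; simp [h0])
      have h3 : ¬ p s' := by
        have := Finsupp.support_filter (fun s => ¬ p s) x ▸ hs'
        exact (Finset.mem_filter.1 this).2
      rintro ⟨h4, h5⟩
      exact h3 ⟨by omega, by omega⟩
    have key2 : ∀ u : S', (A (x.filter p)) u ≠ 0 → (a' u = a' t ∧ b' u = b' t) := by
      intro u hu
      have hmem : x.filter p ∈ gradedPiece a b (a' t - m) (b' t - k) := by
        refine (Finsupp.mem_supported ℤ _).2 fun s hs => ?_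
        have := Finsupp.support_filter p x ▸ (Finset.mem_coe.1 hs)
        exact (Finset.mem_filter.1 this).2
      have := (Finsupp.mem_supported ℤ _).1 (hA _ _ _ hmem) (Finsupp.mem_support_iff.2 hu)
      simpa using this
    ext u
    simp only [Finsupp.coe_zero, Pi.zero_apply]
    by_contra hu
    have h2 := key u hu
    have h3 : (A (x.filter p)) u + (A (x.filter fun s => ¬ p s)) u
        = (Finsupp.single t (1 : ℤ) : S' →₀ ℤ) u := by
      rw [← hAx, ← Finsupp.add_apply, ← map_add, hsplit]
    have h4 : (A (x.filter p)) u = 0 := by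
      by_contra h5; exact h2 (key2 u h5)
    rw [h4, Finsupp.single_eq_of_ne, zero_add] at h3
    · exact hu h3
    · rintro rfl; exact h2 ⟨rfl, rfl⟩
  have h2 : (x.filter fun s => ¬ p s) = 0 := by
    have := LinearMap.congr_fun hBA (x.filter fun s => ¬ p s)
    rw [LinearMap.comp_apply, h1, map_zero] at this
    exact this.symm
  have h3 := DFunLike.congr_fun h2 s
  have hp : ¬ p s := fun h => hcon ⟨by linarith [h.1], by linarith [h.2]⟩
  rw [Finsupp.filter_apply_pos (fun s => ¬ p s) x hp] at h3
  exact hst h3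

/-- An endomorphism of a free abelian group whose matrix is triangular for the partial order
given by `φ`, with units on the diagonal, is bijective. -/
lemma bijective_of_triangular {L : Type*} [Finite L] (A : (L →₀ ℤ) →ₗ[ℤ] (L →₀ ℤ)) (φ : L → ℤ)
    (hdiag : ∀ s, IsUnit (A (Finsupp.single s 1) s))
    (hoff : ∀ s t, A (Finsupp.single s 1) t ≠ 0 → t = s ∨ φ s < φ t) :
    Function.Bijective A := by
  classical
  have hsurj : Function.Surjective A := by
    rw [← LinearMap.range_eq_top, eq_top_iff]
    have hwf : WellFounded (fun s t : L => φ t < φ s) :=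
      @Finite.wellFounded_of_trans_of_irrefl L _ (fun s t : L => φ t < φ s)
        ⟨fun _ _ _ h1 h2 => lt_trans h2 h1⟩ ⟨fun _ => lt_irrefl _⟩
    have key : ∀ s : L, Finsupp.single s (1 : ℤ) ∈ LinearMap.range A := by
      intro s
      induction s using hwf.induction with
      | _ s ih =>
        set y := A (Finsupp.single s 1) with hy
        have hy' : y ∈ LinearMap.range A := ⟨_, rfl⟩
        -- the other entries of the column of `s` are reached by induction on decreasing `φ`
        have herase : y.erase s ∈ LinearMap.range A := by
          rw [← Finsupp.sum_single (y.erase s)]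
          refine Submodule.sum_mem _ fun t ht => ?_
          rw [Finsupp.support_erase, Finset.mem_erase, Finsupp.mem_support_iff] at ht
          have h1 := ih t ((hoff s t ht.2).resolve_left ht.1)
          have := Submodule.smul_mem _ ((y.erase s) t) h1
          simpa using this
        obtain ⟨u, hu⟩ := hdiag s
        have h2 : Finsupp.single s (1 : ℤ) = (↑(u⁻¹) : ℤ) • (y - y.erase s) := by
          have h3 : y - y.erase s = Finsupp.single s (y s) := by
            rw [sub_eq_iff_eq_add]; exact (Finsupp.single_add_erase s y).symm
          rw [h3, Finsupp.smul_single, ← hu]; simp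
        rw [h2]
        exact Submodule.smul_mem _ _ (Submodule.sub_mem _ hy' herase)
    intro x _
    rw [← Finsupp.sum_single x]
    refine Submodule.sum_mem _ fun t _ => ?_
    have := Submodule.smul_mem _ (x t) (key t)
    simpa using this
  exact ⟨OrzechProperty.injective_of_surjective_endomorphism A hsurj, hsurj⟩

/-- Gaussian elimination. If the differential matches, up to a triangular change of basis, the
generators in `Lo` with those in `Up`, then the complex is homotopy equivalent to one generated
by the remaining generators. -/
theorem exists_gaussian_elimination [Finite S] {d : (S →₀ ℤ) →ₗ[ℤ] (S →₀ ℤ)}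
    (hd : IsBigradedDifferential a b d) (Lo Up : Set S) (hdisj : ∀ s ∈ Lo, s ∉ Up)
    (m : Lo ≃ Up) (φ : S → ℤ)
    (hdiag : ∀ s : Lo, IsUnit (d (Finsupp.single s.1 1) (m s).1))
    (hoff : ∀ s t : Lo, d (Finsupp.single s.1 1) (m t).1 ≠ 0 → t = s ∨ φ s < φ t)
    {G : Type*} (r : G → S) (hr : Function.Injective r)
    (hrange : ∀ s, s ∈ Set.range r ↔ s ∉ Lo ∧ s ∉ Up) :
    ∃ δ : (G →₀ ℤ) →ₗ[ℤ] (G →₀ ℤ), IsBigradedDifferential (a ∘ r) (b ∘ r) δ ∧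
      BigradedHomotopyEquivalent (a ∘ r) (b ∘ r) δ a b d := by
  classical
  let i₁ : (Lo →₀ ℤ) →ₗ[ℤ] (S →₀ ℤ) := Finsupp.lmapDomain ℤ ℤ Subtype.val
  let i₃ : (G →₀ ℤ) →ₗ[ℤ] (S →₀ ℤ) := Finsupp.lmapDomain ℤ ℤ r
  let p₁ : (S →₀ ℤ) →ₗ[ℤ] (Lo →₀ ℤ) := Finsupp.lcomapDomain Subtype.val Subtype.val_injective
  let p₂ : (S →₀ ℤ) →ₗ[ℤ] (Up →₀ ℤ) := Finsupp.lcomapDomain Subtype.val Subtype.val_injective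
  let i₂ : (Up →₀ ℤ) →ₗ[ℤ] (S →₀ ℤ) := Finsupp.lmapDomain ℤ ℤ Subtype.val
  let p₃ : (S →₀ ℤ) →ₗ[ℤ] (G →₀ ℤ) := Finsupp.lcomapDomain r hr
  -- the matrix entry of `d` from `Lo` to `Up`, which is to be cancelled
  let A : (Lo →₀ ℤ) →ₗ[ℤ] (Up →₀ ℤ) := p₂ ∘ₗ d ∘ₗ i₁
  let M : (Up →₀ ℤ) ≃ₗ[ℤ] (Lo →₀ ℤ) := Finsupp.domLCongr m.symm
  have hA : Function.Bijective A := by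
    have h1 : ∀ s t : Lo, (M.toLinearMap ∘ₗ A) (Finsupp.single s 1) t
        = d (Finsupp.single s.1 1) (m t).1 := by
      intro s t
      simp [M, A, p₂, i₁, Finsupp.lcomapDomain_apply, Finsupp.domLCongr_apply]
    have h2 : Function.Bijective (M.toLinearMap ∘ₗ A) := by
      refine bijective_of_triangular _ (fun s => φ s) ?_ ?_
      · intro s; rw [h1]; exact hdiag s
      · intro s t h; rw [h1] at h; exact hoff s t h
    have : (A : (Lo →₀ ℤ) → (Up →₀ ℤ)) = M.symm ∘ (M.toLinearMap ∘ₗ A) := by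
      ext x; simp
    rw [this]; exact M.symm.bijective.comp h2
  let Ae : (Lo →₀ ℤ) ≃ₗ[ℤ] (Up →₀ ℤ) := LinearEquiv.ofBijective A hA
  let B : (Up →₀ ℤ) →ₗ[ℤ] (Lo →₀ ℤ) := Ae.symm.toLinearMap
  have hBA : B ∘ₗ A = LinearMap.id := by
    ext1 x; exact LinearMap.ext fun y => Ae.symm_apply_apply _
  have hAB : A ∘ₗ B = LinearMap.id := LinearMap.ext fun x => Ae.apply_symm_apply x
  have hAdeg : HasBidegree (a ∘ Subtype.val) (b ∘ Subtype.val) (a ∘ Subtype.val)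
      (b ∘ Subtype.val) A 1 0 :=
    (hasBidegree_lcomapDomain _).comp
      (hd.bidegree.comp (hasBidegree_lmapDomain _) (zero_add 1) (zero_add 0)) (by simp) (by simp)
  have hBdeg := hAdeg.of_inverse hBA hAB
  -- `H` satisfies `H d H = H` and `H ^ 2 = 0`, so that `1 - d H - H d` is a projection which is
  -- homotopic to the identity; its image is isomorphic to the group generated by the remaining generators
  let H : (S →₀ ℤ) →ₗ[ℤ] (S →₀ ℤ) := i₁ ∘ₗ B ∘ₗ p₂
  have hHdeg : HasBidegree a b a b H (-1) 0 := by
    refine (hasBidegree_lmapDomain _).comp (m := -1) (k := 0)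
      (hBdeg.comp (hasBidegree_lcomapDomain _) (zero_add _) ?_) (by simp) (by simp)
    simp
  have hp₂i₁ : p₂ ∘ₗ i₁ = 0 := by
    refine Finsupp.lhom_ext' fun s => LinearMap.ext_ring ?_
    simp only [i₁, p₂, LinearMap.comp_apply, Finsupp.lsingle_apply, Finsupp.lmapDomain_apply,
      Finsupp.mapDomain_single, LinearMap.zero_apply]
    exact lcomapDomain_single_of_notMem _ (by simpa using hdisj s.1 s.2)
  have hp₃i₁ : p₃ ∘ₗ i₁ = 0 := by
    refine Finsupp.lhom_ext' fun s => LinearMap.ext_ring ?_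
    simp only [i₁, p₃, LinearMap.comp_apply, Finsupp.lsingle_apply, Finsupp.lmapDomain_apply,
      Finsupp.mapDomain_single, LinearMap.zero_apply]
    exact lcomapDomain_single_of_notMem _ fun h => ((hrange _).1 h).1 s.2
  have hp₂i₃ : p₂ ∘ₗ i₃ = 0 := by
    refine Finsupp.lhom_ext' fun s => LinearMap.ext_ring ?_
    simp only [i₃, p₂, LinearMap.comp_apply, Finsupp.lsingle_apply, Finsupp.lmapDomain_apply,
      Finsupp.mapDomain_single, LinearMap.zero_apply]
    exact lcomapDomain_single_of_notMem _ (by simpa using ((hrange (r s)).1 ⟨s, rfl⟩).2)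
  have hp₃i₃ : p₃ ∘ₗ i₃ = LinearMap.id := by
    refine Finsupp.lhom_ext' fun s => LinearMap.ext_ring ?_
    simp only [i₃, p₃, LinearMap.comp_apply, Finsupp.lsingle_apply, Finsupp.lmapDomain_apply,
      Finsupp.mapDomain_single, LinearMap.id_apply]
    exact lcomapDomain_single _ _
  have hsum : i₁ ∘ₗ p₁ + i₂ ∘ₗ p₂ + i₃ ∘ₗ p₃ = LinearMap.id := by
    refine Finsupp.lhom_ext' fun s => LinearMap.ext_ring ?_
    simp only [LinearMap.comp_apply, LinearMap.add_apply, Finsupp.lsingle_apply,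
      LinearMap.id_apply]
    by_cases h1 : s ∈ Lo
    · have e1 : p₁ (Finsupp.single s 1) = Finsupp.single ⟨s, h1⟩ 1 :=
        lcomapDomain_single Subtype.val_injective (⟨s, h1⟩ : Lo)
      have e2 : p₂ (Finsupp.single s 1) = 0 :=
        lcomapDomain_single_of_notMem _ (by simpa using hdisj s h1)
      have e3 : p₃ (Finsupp.single s 1) = 0 :=
        lcomapDomain_single_of_notMem _ fun h => ((hrange _).1 h).1 h1
      rw [e1, e2, e3]; simp [i₁]
    · have e1 : p₁ (Finsupp.single s 1) = 0 :=
        lcomapDomain_single_of_notMem _ (by simpa using h1)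
      by_cases h2 : s ∈ Up
      · have e2 : p₂ (Finsupp.single s 1) = Finsupp.single ⟨s, h2⟩ 1 :=
          lcomapDomain_single Subtype.val_injective (⟨s, h2⟩ : Up)
        have e3 : p₃ (Finsupp.single s 1) = 0 :=
          lcomapDomain_single_of_notMem _ fun h => ((hrange _).1 h).2 h2
        rw [e1, e2, e3]; simp [i₂]
      · have e2 : p₂ (Finsupp.single s 1) = 0 :=
          lcomapDomain_single_of_notMem _ (by simpa using h2)
        obtain ⟨g, rfl⟩ := (hrange s).2 ⟨h1, h2⟩
        have e3 : p₃ (Finsupp.single (r g) 1) = Finsupp.single g 1 := lcomapDomain_single _ _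
        rw [e1, e2, e3]; simp [i₃]
  have dd : ∀ x, d (d x) = 0 := fun x => LinearMap.congr_fun hd.sq_zero x
  have BA : ∀ x, B (p₂ (d (i₁ x))) = x := fun x => LinearMap.congr_fun hBA x
  have AB : ∀ x, p₂ (d (i₁ (B x))) = x := fun x => LinearMap.congr_fun hAB x
  have z21 : ∀ x, p₂ (i₁ x) = 0 := fun x => LinearMap.congr_fun hp₂i₁ x
  have z31 : ∀ x, p₃ (i₁ x) = 0 := fun x => LinearMap.congr_fun hp₃i₁ x
  have z23 : ∀ x, p₂ (i₃ x) = 0 := fun x => LinearMap.congr_fun hp₂i₃ x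
  have z33 : ∀ x, p₃ (i₃ x) = x := fun x => LinearMap.congr_fun hp₃i₃ x
  have tot : ∀ x, i₁ (p₁ x) + i₂ (p₂ x) + i₃ (p₃ x) = x := fun x => LinearMap.congr_fun hsum x
  have Hx : ∀ x, H x = i₁ (B (p₂ x)) := fun _ => rfl
  let f : (S →₀ ℤ) →ₗ[ℤ] (G →₀ ℤ) := p₃ ∘ₗ (LinearMap.id - d ∘ₗ H)
  let g : (G →₀ ℤ) →ₗ[ℤ] (S →₀ ℤ) := (LinearMap.id - H ∘ₗ d) ∘ₗ i₃
  have fx : ∀ x, f x = p₃ (x - d (H x)) := fun _ => rfl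
  have gx : ∀ x, g x = i₃ x - H (d (i₃ x)) := fun _ => rfl
  have HdH : ∀ x, H (d (H x)) = H x := fun x => by simp only [Hx, AB]
  have HH : ∀ x, H (H x) = 0 := fun x => by simp only [Hx, z21, map_zero]
  have fg : ∀ x, f (g x) = x := by
    intro x
    rw [fx, gx]
    have h1 : H (i₃ x) = 0 := by simp only [Hx, z23, map_zero]
    have h2 : ∀ y, p₃ (H y) = 0 := fun y => by simp only [Hx, z31]
    simp only [map_sub, h1, h2, HH, z33, map_zero, sub_zero]
  have gf : ∀ x, g (f x) = x - H (d x) - d (H x) := by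
    intro x
    -- on the kernel of `p₂` the map `1 - H d` depends only on the remaining generators
    have key : ∀ y, p₂ y = 0 → i₃ (p₃ y) - H (d (i₃ (p₃ y))) = y - H (d y) := by
      intro y hy
      have h1 : i₃ (p₃ y) = y - i₁ (p₁ y) := by
        have := tot y
        rw [hy, map_zero, add_zero] at this
        exact eq_sub_of_add_eq' this
      rw [h1]
      have h2 : H (d (i₁ (p₁ y))) = i₁ (p₁ y) := by simp only [Hx, BA]
      simp only [map_sub, h2]; abel
    rw [gx, fx, key _ (by simp only [map_sub, Hx, AB, sub_self])]
    simp only [map_sub, dd, sub_zero]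
    abel
  have hfdeg : HasBidegree a b (a ∘ r) (b ∘ r) f 0 0 :=
    (hasBidegree_lcomapDomain hr).comp
      (HasBidegree.id.sub (hd.bidegree.comp hHdeg (by simp) (by simp))) (by simp) (by simp)
  have hgdeg : HasBidegree (a ∘ r) (b ∘ r) a b g 0 0 :=
    (HasBidegree.id.sub (hHdeg.comp hd.bidegree (by simp) (by simp))).comp
      (hasBidegree_lmapDomain r) (by simp) (by simp)
  let δ : (G →₀ ℤ) →ₗ[ℤ] (G →₀ ℤ) := f ∘ₗ d ∘ₗ g
  have fp : ∀ x, f (x - H (d x) - d (H x)) = f x := fun x => by rw [← gf, fg]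
  have pg : ∀ x, g x - H (d (g x)) - d (H (g x)) = g x := fun x => by rw [← gf, fg]
  have hfd : ∀ x, f (d x) = δ (f x) := by
    intro x
    change f (d x) = f (d (g (f x)))
    rw [gf]
    have := fp (d x)
    simp only [dd, map_zero, sub_zero, map_sub] at this ⊢
    rw [this]
  have hgd : ∀ x, d (g x) = g (δ x) := by
    intro x
    change d (g x) = g (f (d (g x)))
    rw [gf]
    have := congrArg d (pg x)
    simp only [dd, map_zero, sub_zero, map_sub] at this ⊢
    exact this.symm
  refine ⟨δ, ⟨?_, ?_⟩, g, f, 0, -H, hgdeg, hfdeg, ?_, ?_, ?_, ?_, ?_, ?_⟩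
  · exact hfdeg.comp (m := 1) (k := 0) (hd.bidegree.comp hgdeg (by simp) (by simp))
      (by simp) (by simp)
  · refine LinearMap.ext fun x => ?_
    change f (d (g (δ x))) = 0
    rw [← hgd, dd, map_zero]
  · intro p q u _; simp
  · intro p q u hu
    rw [LinearMap.neg_apply]; exact Submodule.neg_mem _ (hHdeg p q u hu)
  · exact LinearMap.ext fun x => (hgd x).symm
  · exact LinearMap.ext fun x => hfd x
  · refine LinearMap.ext fun x => ?_
    simp [fg]
  · refine LinearMap.ext fun x => ?_
    simp only [LinearMap.sub_apply, LinearMap.comp_apply, gf, LinearMap.id_apply,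
      LinearMap.add_apply, LinearMap.neg_apply, map_neg]
    abel

/-- A bigraded homotopy equivalence induces isomorphisms in homology. -/
theorem BigradedHomotopyEquivalent.homology {d : (S →₀ ℤ) →ₗ[ℤ] (S →₀ ℤ)}
    {d' : (S' →₀ ℤ) →ₗ[ℤ] (S' →₀ ℤ)} (h : BigradedHomotopyEquivalent a b d a' b' d') (p q : ℤ) :
    Nonempty (BigradedHomology a b d p q ≃ₗ[ℤ] BigradedHomology a' b' d' p q) := by
  obtain ⟨f, g, k, k', hf, hg, hk, hk', hfd, hgd, hgf, hfg⟩ := h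
  have fd : ∀ x, f (d x) = d' (f x) := fun x => LinearMap.congr_fun hfd x
  have gd : ∀ x, g (d' x) = d (g x) := fun x => LinearMap.congr_fun hgd x
  have gf : ∀ x, g (f x) - x = k (d x) + d (k x) := fun x => LinearMap.congr_fun hgf x
  have fg : ∀ x, f (g x) - x = k' (d' x) + d' (k' x) := fun x => LinearMap.congr_fun hfg x
  have hmap : ∀ x ∈ cycles a b d p q, f x ∈ cycles a' b' d' p q := by
    rintro x ⟨h1, h2⟩
    refine ⟨by simpa using hf _ _ _ h1, ?_⟩
    rw [SetLike.mem_coe, LinearMap.mem_ker] at h2 ⊢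
    rw [← fd, h2, map_zero]
  have hmap' : ∀ x ∈ cycles a' b' d' p q, g x ∈ cycles a b d p q := by
    rintro x ⟨h1, h2⟩
    refine ⟨by simpa using hg _ _ _ h1, ?_⟩
    rw [SetLike.mem_coe, LinearMap.mem_ker] at h2 ⊢
    rw [← gd, h2, map_zero]
  let F : cycles a b d p q →ₗ[ℤ] cycles a' b' d' p q := f.restrict hmap
  let Φ := (Submodule.mkQ ((boundaries a' b' d' p q).submoduleOf (cycles a' b' d' p q))) ∘ₗ F
  have hsurj : Function.Surjective Φ := by
    intro z
    obtain ⟨⟨y, hy⟩, rfl⟩ := Submodule.mkQ_surjective _ z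
    refine ⟨⟨g y, hmap' y hy⟩, ?_⟩
    change Submodule.Quotient.mk _ = Submodule.Quotient.mk _
    rw [Submodule.Quotient.eq]
    change f (g y) - y ∈ boundaries a' b' d' p q
    have hy2 : d' y = 0 := hy.2
    rw [fg, hy2, map_zero, zero_add]
    exact ⟨k' y, by simpa [sub_eq_add_neg] using hk' _ _ _ hy.1, rfl⟩
  have hker : LinearMap.ker Φ = (boundaries a b d p q).submoduleOf (cycles a b d p q) := by
    ext ⟨x, hx⟩
    rw [LinearMap.mem_ker]
    change Submodule.Quotient.mk _ = 0 ↔ x ∈ boundaries a b d p q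
    rw [Submodule.Quotient.mk_eq_zero]
    change f x ∈ boundaries a' b' d' p q ↔ _
    have hx2 : d x = 0 := hx.2
    constructor
    · rintro ⟨w, hw, hwx⟩
      have h1 := gf x
      rw [hx2, map_zero, zero_add, ← hwx, gd] at h1
      refine ⟨g w - k x, Submodule.sub_mem _ (by simpa using hg _ _ _ hw)
        (by simpa [sub_eq_add_neg] using hk _ _ _ hx.1), ?_⟩
      rw [map_sub, ← h1]; abel
    · rintro ⟨w, hw, rfl⟩
      exact ⟨f w, by simpa using hf _ _ _ hw, (fd w).symm⟩
  exact ⟨(Submodule.quotEquivOfEq _ _ hker.symm).trans (Φ.quotKerEquivOfSurjective hsurj)⟩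

/-- Replacing the first grading by its sum with the second one only renumbers the homology. -/
lemma bigradedHomology_add_grading (d : (S →₀ ℤ) →ₗ[ℤ] (S →₀ ℤ)) (p q : ℤ) :
    Nonempty (BigradedHomology a b d p q ≃ₗ[ℤ]
      BigradedHomology (fun s => a s + b s) b d (p + q) q) := by
  have h1 : ∀ p, gradedPiece a b p q = gradedPiece (fun s => a s + b s) b (p + q) q := by
    intro p
    unfold gradedPiece
    congr 1
    ext s
    simp only [Set.mem_ofPred_eq]
    constructor <;> rintro ⟨h, h'⟩ <;> constructor <;> omega
  have hc : cycles a b d p q = cycles (fun s => a s + b s) b d (p + q) q := by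
    unfold cycles; rw [h1]
  have hb : boundaries a b d p q = boundaries (fun s => a s + b s) b d (p + q) q := by
    unfold boundaries; rw [h1, sub_add_eq_add_sub]
  have key : ∀ Z Z' B B' : Submodule ℤ (S →₀ ℤ), Z = Z' → B = B' →
      Nonempty ((Z ⧸ B.submoduleOf Z) ≃ₗ[ℤ] (Z' ⧸ B'.submoduleOf Z')) := by
    rintro Z _ B _ rfl rfl
    exact ⟨LinearEquiv.refl _ _⟩
  exact key _ _ _ _ hc hb

end Bigraded

/-! ### Composing a permutation with a transposition -/

section PermSwap

variable {α : Type*} {σ : Equiv.Perm α} {i j : α}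

lemma mul_swap_apply_of_ne [DecidableEq α] {x : α} (h1 : x ≠ i) (h2 : x ≠ j) :
    (σ * Equiv.swap i j) x = σ x := by
  rw [Equiv.Perm.mul_apply, Equiv.swap_apply_of_ne_of_ne h1 h2]

lemma pow_mul_swap_of_not_sameCycle [DecidableEq α] {e : α} (hi : ¬ σ.SameCycle i e) (hj : ¬ σ.SameCycle j e)
    (n : ℕ) : ((σ * Equiv.swap i j) ^ n) e = (σ ^ n) e := by
  induction n with
  | zero => rfl
  | succ n ih =>
    rw [pow_succ', Equiv.Perm.mul_apply, ih, pow_succ' σ, Equiv.Perm.mul_apply]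
    apply mul_swap_apply_of_ne
    · rintro h; exact hi (h ▸ (Equiv.Perm.sameCycle_pow_left.2 (Equiv.Perm.SameCycle.refl σ e)))
    · rintro h; exact hj (h ▸ (Equiv.Perm.sameCycle_pow_left.2 (Equiv.Perm.SameCycle.refl σ e)))

lemma sameCycle_iff_exists_nat_pow [Finite α] {σ : Equiv.Perm α} {x y : α} :
    σ.SameCycle x y ↔ ∃ n : ℕ, (σ ^ n) x = y :=
  ⟨fun h => h.exists_nat_pow_eq, fun ⟨n, h⟩ => ⟨n, by simpa using h⟩⟩

/-- Cycles through neither `i` nor `j` are unchanged. -/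
lemma sameCycle_mul_swap_of_not [Finite α] [DecidableEq α] {e : α} (hi : ¬ σ.SameCycle i e) (hj : ¬ σ.SameCycle j e)
    (e' : α) : (σ * Equiv.swap i j).SameCycle e e' ↔ σ.SameCycle e e' := by
  rw [sameCycle_iff_exists_nat_pow, sameCycle_iff_exists_nat_pow]
  simp only [pow_mul_swap_of_not_sameCycle hi hj]

/-- Two different cycles are merged. -/
lemma sameCycle_mul_swap_of_not_sameCycle [Finite α] [DecidableEq α] (h : ¬ σ.SameCycle i j) :
    (σ * Equiv.swap i j).SameCycle i j := by
  have key : ∀ n : ℕ, (σ * Equiv.swap i j).SameCycle i ((σ ^ (n + 1)) j) := by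
    intro n
    induction n with
    | zero =>
      have : (σ * Equiv.swap i j) i = σ j := by simp
      rw [zero_add, pow_one, ← this]
      exact Equiv.Perm.sameCycle_apply_right.2 (Equiv.Perm.SameCycle.refl _ _)
    | succ n ih =>
      rw [pow_succ', Equiv.Perm.mul_apply]
      set x := (σ ^ (n + 1)) j with hx
      have hxi : x ≠ i := by
        intro hxi
        exact h (Equiv.Perm.SameCycle.symm (sameCycle_iff_exists_nat_pow.2 ⟨n + 1, hxi⟩))
      by_cases hxj : x = j
      · rw [hxj]
        have : (σ * Equiv.swap i j) i = σ j := by simp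
        rw [← this]
        exact Equiv.Perm.sameCycle_apply_right.2 (Equiv.Perm.SameCycle.refl _ _)
      · rw [← mul_swap_apply_of_ne (σ := σ) hxi hxj]
        exact Equiv.Perm.sameCycle_apply_right.2 ih
  obtain ⟨n, hn⟩ := sameCycle_iff_exists_nat_pow.1
    (Equiv.Perm.sameCycle_apply_left.2 (Equiv.Perm.SameCycle.refl σ j))
  have := key n
  rwa [pow_succ, Equiv.Perm.mul_apply, hn] at this

/-- A cycle through both `i` and `j` is split. -/
lemma not_sameCycle_mul_swap [Finite α] [DecidableEq α] (hij : i ≠ j) (h : σ.SameCycle i j) :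
    ¬ (σ * Equiv.swap i j).SameCycle i j := by
  classical
  have hex := sameCycle_iff_exists_nat_pow.1 h
  set m := Nat.find hex with hm
  have hmj : (σ ^ m) i = j := Nat.find_spec hex
  have hmin : ∀ k < m, (σ ^ k) i ≠ j := fun k hk => Nat.find_min hex hk
  have hm0 : m ≠ 0 := by
    intro h0; rw [h0] at hmj; exact hij hmj
  have hret : ∀ k, 1 ≤ k → k ≤ m → (σ ^ k) i ≠ i := by
    intro k hk hkm hki
    have : (σ ^ (m - k)) i = j := by
      rw [← hmj]
      conv_rhs => rw [show m = (m - k) + k by omega, pow_add, Equiv.Perm.mul_apply, hki]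
    exact hmin (m - k) (by omega) this
  have key : ∀ n : ℕ, ∃ k, 1 ≤ k ∧ k ≤ m ∧ ((σ * Equiv.swap i j) ^ n) j = (σ ^ k) i := by
    intro n
    induction n with
    | zero => exact ⟨m, by omega, le_rfl, hmj.symm⟩
    | succ n ih =>
      obtain ⟨k, hk1, hkm, hk⟩ := ih
      rw [pow_succ', Equiv.Perm.mul_apply, hk]
      by_cases hkm' : k = m
      · refine ⟨1, le_rfl, by omega, ?_⟩
        rw [hkm', hmj]; simp
      · refine ⟨k + 1, by omega, by omega, ?_⟩
        rw [mul_swap_apply_of_ne (hret k hk1 hkm) (hmin k (by omega)), pow_succ',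
          Equiv.Perm.mul_apply]
  intro hs
  obtain ⟨n, hn⟩ := sameCycle_iff_exists_nat_pow.1 hs.symm
  obtain ⟨k, hk1, hkm, hk⟩ := key n
  exact hret k hk1 hkm (hk.symm.trans hn)

end PermSwap

/-! ### A discrete Umlaufsatz -/

instance : DecidableEq Direction := fun a b => by
  cases a <;> cases b <;> first | exact isTrue rfl | exact isFalse (by intro h; cases h)

instance : Fintype Direction := ⟨{.N, .E, .S, .W}, fun a => by cases a <;> decide⟩

namespace Direction

/-- The opposite direction. -/
def opp : Direction → Direction
  | N => S
  | E => W
  | S => N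
  | W => E

/-- The unit vector of a direction. -/
def vec : Direction → ℤ × ℤ
  | N => (0, 1)
  | E => (1, 0)
  | S => (0, -1)
  | W => (-1, 0)

/-- Signed passages of the heading through the directions strictly between `E` and `N`. -/
def turn (a b : Direction) : ℤ := (if a = E ∧ b = N then 1 else 0) - if a = N ∧ b = E then 1 else 0

end Direction

/-- The signed crossing number of a short step from `u` to `v` with the positive horizontal axis,
pushed slightly upward. -/
def axisCrossing (u v : ℤ × ℤ) : ℤ :=
  (if u.2 ≤ 0 ∧ 0 < v.2 ∧ 0 < u.1 then 1 else 0) - if v.2 ≤ 0 ∧ 0 < u.2 ∧ 0 < v.1 then 1 else 0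

lemma axisCrossing_of_pos {u v : ℤ × ℤ} (hu : 0 < u.2) (hv : 0 < v.2) : axisCrossing u v = 0 := by
  simp [axisCrossing, not_le.2 hu, not_le.2 hv]

lemma axisCrossing_of_nonpos {u v : ℤ × ℤ} (hu : u.2 ≤ 0) (hv : v.2 ≤ 0) :
    axisCrossing u v = 0 := by
  simp [axisCrossing, not_lt.2 hu, not_lt.2 hv]

lemma axisCrossing_of_left {u v : ℤ × ℤ} (hu : u.1 ≤ 0) (hv : v.1 ≤ 0) :
    axisCrossing u v = 0 := by
  simp [axisCrossing, not_lt.2 hu, not_lt.2 hv]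

lemma axisCrossing_of_right {u v : ℤ × ℤ} (hu : 0 < u.1) (hv : 0 < v.1) :
    axisCrossing u v = (if 0 < v.2 then 1 else 0) - if 0 < u.2 then 1 else 0 := by
  unfold axisCrossing
  split_ifs <;> omega

lemma vec_bounds (a : Direction) :
    -1 ≤ a.vec.1 ∧ a.vec.1 ≤ 1 ∧ -1 ≤ a.vec.2 ∧ a.vec.2 ≤ 1 := by
  cases a <;> decide

set_option synthInstance.maxHeartbeats 400000 in
set_option synthInstance.maxSize 1000 in
/-- The parallelogram spanned by the differences of two disjoint short segments of the curve does
not wind around the origin. -/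
lemma axisCrossing_square (a b c e : Direction) (hab : b ≠ a.opp) (hce : e ≠ c.opp) (Q : ℤ × ℤ)
    (h00 : 2 • Q - c.vec + a.vec ≠ 0) (h01 : 2 • Q + e.vec + a.vec ≠ 0)
    (h10 : 2 • Q - c.vec - b.vec ≠ 0) (h11 : 2 • Q + e.vec - b.vec ≠ 0)
    (h0 : Q = 0 → a ≠ b) :
    axisCrossing (2 • Q - c.vec + a.vec) (2 • Q + e.vec + a.vec)
      + axisCrossing (2 • Q + e.vec + a.vec) (2 • Q + e.vec - b.vec)
    = axisCrossing (2 • Q - c.vec + a.vec) (2 • Q - c.vec - b.vec)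
      + axisCrossing (2 • Q - c.vec - b.vec) (2 • Q + e.vec - b.vec) := by
  obtain ⟨X, Y⟩ := Q
  have ha := vec_bounds a
  have hb := vec_bounds b
  have hc := vec_bounds c
  have he := vec_bounds e
  by_cases hY : 2 ≤ Y
  · rw [axisCrossing_of_pos, axisCrossing_of_pos, axisCrossing_of_pos, axisCrossing_of_pos] <;>
      simp <;> omega
  by_cases hY' : Y ≤ -1
  · rw [axisCrossing_of_nonpos, axisCrossing_of_nonpos, axisCrossing_of_nonpos,
      axisCrossing_of_nonpos] <;> simp <;> omega
  by_cases hX : 2 ≤ X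
  · rw [axisCrossing_of_right, axisCrossing_of_right, axisCrossing_of_right,
      axisCrossing_of_right]
    · ring
    all_goals (simp; omega)
  by_cases hX' : X ≤ -1
  · rw [axisCrossing_of_left, axisCrossing_of_left, axisCrossing_of_left,
      axisCrossing_of_left] <;> simp <;> omega
  obtain rfl | rfl : X = 0 ∨ X = 1 := by omega
  all_goals obtain rfl | rfl : Y = 0 ∨ Y = 1 := by omega
  all_goals
    clear ha hb hc he hY hY' hX hX'
    revert hab h0
    revert c e
    cases a <;> cases b <;> decide +kernel

lemma axisCrossing_diagonal (a b c : Direction) (hab : b ≠ a.opp) (hbc : c ≠ b.opp) :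
    axisCrossing (a.vec + b.vec) (a.vec + b.vec + (b.vec + c.vec))
      + axisCrossing (a.vec + b.vec + (b.vec + c.vec)) (b.vec + c.vec)
    = (if b = .E ∧ c = .N then 1 else 0) - if a = .N ∧ b = .E then 1 else 0 := by
  revert a b c; decide

section Umlaufsatz

/-- A closed lattice curve without self-crossings, as a periodic sequence: the `i`-th edge has
midpoint `P i` (in coordinates doubled so that midpoints are integral) and heading `d i`, and ends
at the lattice point `q i`. The curve may touch itself at a lattice point where it turns. -/
structure LatticeCurve (N : ℕ) (P : ℕ → ℤ × ℤ) (q : ℕ → ℤ × ℤ) (d : ℕ → Direction) : Prop where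
  pos : 0 < N
  period : ∀ i, P (i + N) = P i
  period_dir : ∀ i, d (i + N) = d i
  head : ∀ i, P i + (d i).vec = 2 • q i
  next : ∀ i, P (i + 1) = 2 • q i + (d (i + 1)).vec
  no_backtrack : ∀ i, d (i + 1) ≠ (d i).opp
  injective : ∀ i j, i < N → j < N → P i = P j → i = j
  no_crossing : ∀ i j, i < N → j < N → i ≠ j → q i = q j → d i ≠ d (i + 1)

variable {N : ℕ} {P : ℕ → ℤ × ℤ} {q : ℕ → ℤ × ℤ} {d : ℕ → Direction}

namespace LatticeCurve

variable (h : LatticeCurve N P q d)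
include h

lemma step (i : ℕ) : P (i + 1) = P i + (d i).vec + (d (i + 1)).vec := by
  rw [h.next, h.head]

lemma three_le : 3 ≤ N := by
  have h0 := h.pos
  have hp := h.period 0
  have hd := h.period_dir 0
  have h1 := h.step 0
  have h2 := h.step 1
  have hb := h.no_backtrack 0
  by_contra hN
  obtain rfl | rfl : N = 1 ∨ N = 2 := by omega
  · simp only [zero_add] at *
    rw [hp, hd] at h1
    revert h1
    cases d 0 <;> simp [Direction.vec, Prod.ext_iff] <;> omega
  · simp only [zero_add, Nat.reduceAdd] at *
    rw [h1, hd] at h2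
    rw [h2] at hp
    revert hp hb
    cases d 0 <;> cases d 1 <;> simp [Direction.vec, Direction.opp, Prod.ext_iff, add_assoc]

lemma ne_of_lt_of_lt {i j : ℕ} (hij : i < j) (hj : j < i + N) (hjN : j ≤ N) : P j - P i ≠ 0 := by
  rw [sub_ne_zero]
  intro heq
  rcases Nat.lt_or_ge j N with hlt | hge
  · exact absurd (h.injective j i hlt (by omega) heq) (by omega)
  · obtain rfl : j = 0 + N := by omega
    rw [h.period] at heq
    exact absurd (h.injective 0 i h.pos (by omega) heq) (by omega)

lemma square {i j : ℕ} (hij : i + 1 < j) (hj : j < N) (hne : j + 1 < i + N) :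
    axisCrossing (P j - P i) (P (j + 1) - P i) + axisCrossing (P (j + 1) - P i)
      (P (j + 1) - P (i + 1)) =
    axisCrossing (P j - P i) (P j - P (i + 1)) + axisCrossing (P j - P (i + 1))
      (P (j + 1) - P (i + 1)) := by
  have e1 : P i = 2 • q i - (d i).vec := eq_sub_of_add_eq (h.head i)
  have e2 : P (i + 1) = 2 • q i + (d (i + 1)).vec := h.next i
  have e3 : P j = 2 • q j - (d j).vec := eq_sub_of_add_eq (h.head j)
  have e4 : P (j + 1) = 2 • q j + (d (j + 1)).vec := h.next j
  have n00 := h.ne_of_lt_of_lt (i := i) (j := j) (by omega) (by omega) (by omega)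
  have n01 := h.ne_of_lt_of_lt (i := i) (j := j + 1) (by omega) (by omega) (by omega)
  have n10 := h.ne_of_lt_of_lt (i := i + 1) (j := j) (by omega) (by omega) (by omega)
  have n11 := h.ne_of_lt_of_lt (i := i + 1) (j := j + 1) (by omega) (by omega) (by omega)
  have f00 : P j - P i = 2 • (q j - q i) - (d j).vec + (d i).vec := by
    rw [e1, e3, smul_sub]; abel
  have f01 : P (j + 1) - P i = 2 • (q j - q i) + (d (j + 1)).vec + (d i).vec := by
    rw [e1, e4, smul_sub]; abel
  have f10 : P j - P (i + 1) = 2 • (q j - q i) - (d j).vec - (d (i + 1)).vec := by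
    rw [e2, e3, smul_sub]; abel
  have f11 : P (j + 1) - P (i + 1) = 2 • (q j - q i) + (d (j + 1)).vec - (d (i + 1)).vec := by
    rw [e2, e4, smul_sub]; abel
  rw [f00] at n00; rw [f01] at n01; rw [f10] at n10; rw [f11] at n11
  rw [f00, f01, f10, f11]
  refine axisCrossing_square _ _ _ _ (h.no_backtrack i) (h.no_backtrack j) _ n00 n01 n10 n11 ?_
  intro hq
  exact h.no_crossing i j (by omega) hj (by omega) (sub_eq_zero.1 hq).symm

/-- Summing the squares of one row of the triangle of pairs. -/
lemma row {i : ℕ} (k : ℕ) (hk : i + 2 + k ≤ N) (hne : i + 2 + k < i + N) :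
    (∑ j ∈ Finset.range k, axisCrossing (P (i + 2 + j) - P i) (P (i + 2 + j + 1) - P i))
      + axisCrossing (P (i + 2 + k) - P i) (P (i + 2 + k) - P (i + 1)) =
    axisCrossing (P (i + 2) - P i) (P (i + 2) - P (i + 1)) +
      ∑ j ∈ Finset.range k,
        axisCrossing (P (i + 2 + j) - P (i + 1)) (P (i + 2 + j + 1) - P (i + 1)) := by
  induction k with
  | zero => simp
  | succ k ih =>
    have h1 := ih (by omega) (by omega)
    have h2 := h.square (i := i) (j := i + 2 + k) (by omega) (by omega) (by omega)
    rw [Finset.sum_range_succ, Finset.sum_range_succ, ← add_assoc (i + 2) k 1]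
    linarith

/-- The contribution of the diagonal of the triangle of pairs, away from its last step. -/
lemma diagonal (hlow : ∀ i, (P 0).2 ≤ (P i).2)
    (hright : ∀ i, (P i).2 = (P 0).2 → (P i).1 ≤ (P 0).1) :
    ∑ i ∈ Finset.range (N - 1), (axisCrossing (P (i + 1) - P i) (P (i + 2) - P i)
      + axisCrossing (P (i + 2) - P i) (P (i + 2) - P (i + 1))) =
    axisCrossing (P (N - 1) - P 0) (P (N - 1) - P 1)
      + axisCrossing (P (N - 1) - P 1) (P N - P 1) := by
  have hN := h.three_le
  have hPN : P N = P 0 := by simpa using h.period 0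
  -- `L i` is the contribution of the row of the secants which start at `P i`
  let L : ℕ → ℤ := fun i => ∑ j ∈ Finset.range (N - 1 - i),
    axisCrossing (P (i + 1 + j) - P i) (P (i + 1 + j + 1) - P i)
  -- the base point is lowest, so the secants towards it never point upward, and it is the rightmost
  -- lowest point, so the secants from it never pass through the positive horizontal axis
  have hcol : ∀ i, axisCrossing (P N - P i) (P N - P (i + 1)) = 0 := by
    intro i
    apply axisCrossing_of_nonpos
    · have := hlow i; simp [hPN]; omega
    · have := hlow (i + 1); simp [hPN]; omega
  have hrow0 : ∀ j, 1 ≤ j → j < N → axisCrossing (P j - P 0) (P (j + 1) - P 0) = 0 := by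
    intro j hj hjN
    have h1 := hlow j
    have h2 := hright j
    have h3 := hlow (j + 1)
    have h4 := hright (j + 1)
    have h5 : (P j - P 0).2 ≤ 0 → ¬ 0 < (P j - P 0).1 := by
      intro h6 h7; simp at h6 h7; have := h2 (by omega); omega
    have h8 : (P (j + 1) - P 0).2 ≤ 0 → ¬ 0 < (P (j + 1) - P 0).1 := by
      intro h6 h7; simp at h6 h7; have := h4 (by omega); omega
    unfold axisCrossing
    rw [if_neg (fun h6 => h5 h6.1 h6.2.2), if_neg (fun h6 => h8 h6.1 h6.2.2)]
    rfl
  have hstep : ∀ i, 1 ≤ i → i + 2 ≤ N →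
      axisCrossing (P (i + 1) - P i) (P (i + 2) - P i)
        + axisCrossing (P (i + 2) - P i) (P (i + 2) - P (i + 1)) = L i - L (i + 1) := by
    intro i hi hiN
    have h1 := h.row (i := i) (N - 2 - i) (by omega) (by omega)
    rw [show i + 2 + (N - 2 - i) = N by omega, hcol] at h1
    have hL : L i = axisCrossing (P (i + 1) - P i) (P (i + 2) - P i) +
        ∑ j ∈ Finset.range (N - 2 - i),
          axisCrossing (P (i + 2 + j) - P i) (P (i + 2 + j + 1) - P i) := by
      simp only [L]
      rw [show N - 1 - i = (N - 2 - i) + 1 by omega, Finset.sum_range_succ', add_comm]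
      congr 1
      refine Finset.sum_congr rfl fun j _ => ?_
      rw [show i + 1 + (j + 1) = i + 2 + j by omega]
    have hL' : L (i + 1) = ∑ j ∈ Finset.range (N - 2 - i),
        axisCrossing (P (i + 2 + j) - P (i + 1)) (P (i + 2 + j + 1) - P (i + 1)) := by
      simp only [L]
      rw [show N - 1 - (i + 1) = N - 2 - i by omega]
    rw [hL, hL']; linarith
  -- the first row stops one square earlier: its last square would have the degenerate secant `P N - P 0`
  have h0 : axisCrossing (P 1 - P 0) (P 2 - P 0) + axisCrossing (P 2 - P 0) (P 2 - P 1)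
      = axisCrossing (P (N - 1) - P 0) (P (N - 1) - P 1) - L 1
        + axisCrossing (P (N - 1) - P 1) (P N - P 1) := by
    have h1 := h.row (i := 0) (N - 3) (by omega) (by omega)
    rw [show 0 + 2 + (N - 3) = N - 1 by omega, Finset.sum_eq_zero, zero_add] at h1
    · have hL : L 1 = ∑ j ∈ Finset.range (N - 3),
          axisCrossing (P (2 + j) - P 1) (P (2 + j + 1) - P 1)
          + axisCrossing (P (N - 1) - P 1) (P N - P 1) := by
        simp only [L]
        rw [show N - 1 - 1 = (N - 3) + 1 by omega, Finset.sum_range_succ]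
        congr 3
        · rw [show 1 + 1 + (N - 3) = N - 1 by omega]
        · rw [show 1 + 1 + (N - 3) + 1 = N by omega]
      simp only [zero_add] at h1
      rw [hrow0 1 le_rfl (by omega), zero_add, hL]; linarith
    · intro j hj
      rw [Finset.mem_range] at hj
      exact hrow0 _ (by omega) (by omega)
  have htel : ∀ k, k + 2 ≤ N → ∑ i ∈ Finset.range (k + 1),
      (axisCrossing (P (i + 1) - P i) (P (i + 2) - P i)
      + axisCrossing (P (i + 2) - P i) (P (i + 2) - P (i + 1))) =
      axisCrossing (P (N - 1) - P 0) (P (N - 1) - P 1)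
        + axisCrossing (P (N - 1) - P 1) (P N - P 1) - L (k + 1) := by
    intro k
    induction k with
    | zero => intro _; simp only [zero_add, Finset.sum_range_one]; linarith [h0]
    | succ k ih =>
      intro hk
      rw [Finset.sum_range_succ, ih (by omega), hstep (k + 1) (by omega) (by omega)]
      ring
  have := htel (N - 2) (by omega)
  rw [show N - 2 + 1 = N - 1 by omega] at this
  rw [this]
  have hL : L (N - 1) = 0 := by simp [L]
  rw [hL, sub_zero]

/-- The Umlaufsatz for lattice curves: the total turning is `1` or `-1`, according to the heading
of the rightmost among the lowest edges. The proof is Hopf's: the secants `P j - P i` define a map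
from the triangle `i < j` to the punctured plane, and the turning number is computed by deforming
the diagonal of the triangle into its two other sides. -/
theorem sum_turn (hlow : ∀ i, (P 0).2 ≤ (P i).2)
    (hright : ∀ i, (P i).2 = (P 0).2 → (P i).1 ≤ (P 0).1) (h0 : d 0 = .E ∨ d 0 = .W) :
    ∑ i ∈ Finset.range N, (d i).turn (d (i + 1)) = (d 0).vec.1 := by
  have hN := h.three_le
  have hPN : P N = P 0 := by simpa using h.period 0
  have hdN : d N = d 0 := by simpa using h.period_dir 0
  have hdN' : d (N + 1) = d 1 := by simpa [add_comm] using h.period_dir 1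
  have hdiag : ∀ i, axisCrossing (P (i + 1) - P i) (P (i + 2) - P i)
      + axisCrossing (P (i + 2) - P i) (P (i + 2) - P (i + 1)) =
      (if d (i + 1) = .E ∧ d (i + 2) = .N then 1 else 0)
        - if d i = .N ∧ d (i + 1) = .E then 1 else 0 := by
    intro i
    rw [← axisCrossing_diagonal _ _ _ (h.no_backtrack i) (h.no_backtrack (i + 1))]
    have s1 := h.step i
    have s2 := h.step (i + 1)
    rw [show i + 1 + 1 = i + 2 from rfl] at s2
    have f1 : P (i + 1) - P i = (d i).vec + (d (i + 1)).vec := by rw [s1]; abel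
    have f2 : P (i + 2) - P i =
        (d i).vec + (d (i + 1)).vec + ((d (i + 1)).vec + (d (i + 2)).vec) := by
      rw [s2, s1]; abel
    have f3 : P (i + 2) - P (i + 1) = (d (i + 1)).vec + (d (i + 2)).vec := by rw [s2]; abel
    rw [f1, f2, f3]
  have hshift : ∑ i ∈ Finset.range N, (if d (i + 1) = .E ∧ d (i + 2) = .N then (1 : ℤ) else 0)
      = ∑ i ∈ Finset.range N, if d i = .E ∧ d (i + 1) = .N then (1 : ℤ) else 0 := by
    have h1 := Finset.sum_range_succ
      (fun i => if d i = .E ∧ d (i + 1) = .N then (1 : ℤ) else 0) N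
    rw [Finset.sum_range_succ'] at h1
    simp only [hdN, hdN', zero_add] at h1
    linarith
  have htotal : ∑ i ∈ Finset.range N, (d i).turn (d (i + 1)) =
      ∑ i ∈ Finset.range N, (axisCrossing (P (i + 1) - P i) (P (i + 2) - P i)
        + axisCrossing (P (i + 2) - P i) (P (i + 2) - P (i + 1))) := by
    simp only [hdiag, Direction.turn, Finset.sum_sub_distrib, hshift]
  have hsplit := Finset.sum_range_succ (fun i => axisCrossing (P (i + 1) - P i) (P (i + 2) - P i)
        + axisCrossing (P (i + 2) - P i) (P (i + 2) - P (i + 1))) (N - 1)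
  have hlast := hdiag (N - 1)
  rw [show N - 1 + 1 = N by omega] at hsplit hlast
  rw [htotal, hsplit, h.diagonal hlow hright, hlast,
    show N - 1 + 2 = N + 1 by omega, hdN, hdN', hPN]
  -- what is left depends only on the headings around the base point
  have s0 : P 1 = P 0 + (d 0).vec + (d 1).vec := h.step 0
  have sN := h.step (N - 1)
  rw [show N - 1 + 1 = N by omega, hPN, hdN] at sN
  have sN' : P (N - 1) = P 0 - (d (N - 1)).vec - (d 0).vec := by rw [sN]; abel
  have b0 : d 1 ≠ (d 0).opp := h.no_backtrack 0
  have bN := h.no_backtrack (N - 1)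
  rw [show N - 1 + 1 = N by omega, hdN] at bN
  have l1 := hlow 1
  have r1 := hright 1
  have lN := hlow (N - 1)
  have rN := hright (N - 1)
  have g1 : P (N - 1) - P 0 = - (d (N - 1)).vec - (d 0).vec := by rw [sN']; abel
  have g2 : P (N - 1) - P 1 = - (d (N - 1)).vec - (d 0).vec - (d 0).vec - (d 1).vec := by
    rw [sN', s0]; abel
  have g3 : P 0 - P 1 = - (d 0).vec - (d 1).vec := by rw [s0]; abel
  rw [g1, g2, g3]
  rw [s0] at l1 r1
  rw [sN'] at lN rN
  clear g1 g2 g3 s0 sN sN' htotal hsplit hshift hdiag hlast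
  simp only [Prod.snd_add, Prod.fst_add, Prod.snd_sub, Prod.fst_sub] at l1 r1 lN rN
  clear hdN hdN' hPN
  generalize d 0 = x at *
  generalize d 1 = y at *
  generalize d (N - 1) = z at *
  generalize (P 0).1 = X at *
  generalize (P 0).2 = Y at *
  have l1' : 0 ≤ x.vec.2 + y.vec.2 := by omega
  have r1' : x.vec.2 + y.vec.2 = 0 → x.vec.1 + y.vec.1 ≤ 0 := fun h => by have := r1 (by omega); omega
  have lN' : 0 ≤ - z.vec.2 - x.vec.2 := by omega
  have rN' : - z.vec.2 - x.vec.2 = 0 → - z.vec.1 - x.vec.1 ≤ 0 := fun h => by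
    have := rN (by omega); omega
  clear l1 r1 lN rN
  revert h0 b0 bN l1' r1' lN' rN'
  cases x <;> cases y <;> cases z <;> decide

end LatticeCurve

end Umlaufsatz

/-! ### Edges, vertices and arcs of a resolution -/

namespace Direction

/-- The sign of a direction: `1` for north and east, `-1` for south and west. -/
def sgn : Direction → ℤ
  | N => 1
  | E => 1
  | S => -1
  | W => -1

lemma opp_opp (a : Direction) : a.opp.opp = a := by cases a <;> rfl

lemma vec_opp (a : Direction) : a.opp.vec = - a.vec := by cases a <;> rfl

end Direction

namespace LatticeEdge

variable {n : ℕ}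

/-- The midpoint of an edge, in coordinates doubled so that it is integral. -/
def mid : LatticeEdge n → ℤ × ℤ
  | h c r => (2 * (c : ℤ) + 1, 2 * (r : ℤ))
  | v c r => (2 * (c : ℤ), 2 * (r : ℤ) + 1)

lemma mid_injective : Function.Injective (mid : LatticeEdge n → ℤ × ℤ) := by
  rintro (⟨c, r⟩ | ⟨c, r⟩) (⟨c', r'⟩ | ⟨c', r'⟩) h <;> simp only [mid, Prod.mk.injEq] at h
  · obtain rfl : c = c' := Fin.ext (by omega)
    obtain rfl : r = r' := Fin.ext (by omega)
    rfl
  · omega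
  · omega
  · obtain rfl : c = c' := Fin.ext (by omega)
    obtain rfl : r = r' := Fin.ext (by omega)
    rfl

lemma LeavesIn.mid {c r : Fin n} {e : LatticeEdge n} {a : Direction} (h : e.LeavesIn c r a) :
    e.mid = 2 • ((c : ℤ), (r : ℤ)) + a.vec := by
  cases e <;> cases a <;> simp only [LeavesIn] at h
  all_goals
    obtain ⟨h1, h2⟩ := h
    first | subst h1 | skip
    first | subst h2 | skip
    simp [LatticeEdge.mid, Direction.vec]
  all_goals omega

lemma LeavesIn.unique {c r : Fin n} {e e' : LatticeEdge n} {a : Direction}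
    (h : e.LeavesIn c r a) (h' : e'.LeavesIn c r a) : e = e' :=
  mid_injective (h.mid.trans h'.mid.symm)

lemma LeavesIn.vertex_unique {c r c' r' : Fin n} {e : LatticeEdge n} {a a' : Direction}
    (h : e.LeavesIn c r a) (h' : e.LeavesIn c' r' a') (ha : a.sgn = a'.sgn) :
    c = c' ∧ r = r' ∧ a = a' := by
  cases e <;> cases a <;> cases a' <;> simp only [LeavesIn] at h h' <;>
    first | (exact absurd ha (by decide)) | skip
  all_goals
    refine ⟨Fin.ext ?_, Fin.ext ?_, rfl⟩
    all_goals
      have h1 := h.1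
      have h2 := h.2
      have h3 := h'.1
      have h4 := h'.2
      simp only [Fin.ext_iff] at h1 h2 h3 h4
      omega

lemma LeavesIn.direction_unique {c r : Fin n} {e : LatticeEdge n} {a a' : Direction}
    (h : e.LeavesIn c r a) (h' : e.LeavesIn c r a') : a = a' := by
  cases e <;> cases a <;> cases a' <;> simp only [LeavesIn] at h h' ⊢ <;>
  · have h1 := h.1
    have h2 := h.2
    have h3 := h'.1
    have h4 := h'.2
    simp only [Fin.ext_iff] at h1 h2 h3 h4
    omega

end LatticeEdge

namespace GridDiagram

variable {n : ℕ} (D : GridDiagram n)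

/-- An edge of the diagram leaves the lattice point `(c, r)` in the given direction. -/
def Has (c r : Fin n) : Direction → Prop
  | .N => D.bot c ≤ r ∧ r < D.top c
  | .S => D.bot c < r ∧ r ≤ D.top c
  | .E => D.left r ≤ c ∧ c < D.right r
  | .W => D.left r < c ∧ c ≤ D.right r

variable {D}

lemma has_of_leavesIn {c r : Fin n} {a : Direction} (e : D.Edge) (h : e.1.LeavesIn c r a) :
    D.Has c r a := by
  obtain ⟨e, he⟩ := e
  cases e <;> cases a <;> simp only [LatticeEdge.LeavesIn] at h
  all_goals
    obtain ⟨h1, h2⟩ := h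
    first | subst h1 | skip
    first | subst h2 | skip
    simp only [HasEdge, Has, Fin.le_def, Fin.lt_def] at he ⊢
    omega

lemma exists_edge {c r : Fin n} {a : Direction} (h : D.Has c r a) :
    ∃ e : D.Edge, e.1.LeavesIn c r a := by
  have hc := c.isLt
  have hr := r.isLt
  cases a <;> simp only [Has, Fin.le_def, Fin.lt_def] at h
  · exact ⟨⟨.v c r, h⟩, rfl, rfl⟩
  · exact ⟨⟨.h c r, h⟩, rfl, rfl⟩
  · refine ⟨⟨.v c ⟨r - 1, by omega⟩, ?_⟩, rfl, ?_⟩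
    · simp only [HasEdge, Fin.le_def, Fin.lt_def]; omega
    · simp only; omega
  · refine ⟨⟨.h ⟨c - 1, by omega⟩ r, ?_⟩, ?_, rfl⟩
    · simp only [HasEdge, Fin.le_def, Fin.lt_def]; omega
    · simp only; omega

/-- Every edge has an end from which it leaves in a direction of given sign. -/
lemma exists_end (e : D.Edge) {s : ℤ} (hs : s = 1 ∨ s = -1) :
    ∃ c r a, e.1.LeavesIn c r a ∧ a.sgn = s := by
  obtain ⟨e, he⟩ := e
  rcases hs with rfl | rfl
  · cases e with
    | h c r => exact ⟨c, r, .E, ⟨rfl, rfl⟩, rfl⟩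
    | v c r => exact ⟨c, r, .N, ⟨rfl, rfl⟩, rfl⟩
  · cases e with
    | h c r =>
      have := (D.right r).isLt
      simp only [HasEdge, Fin.le_def, Fin.lt_def] at he
      exact ⟨⟨c + 1, by omega⟩, r, .W, ⟨rfl, rfl⟩, rfl⟩
    | v c r =>
      have := (D.top c).isLt
      simp only [HasEdge, Fin.le_def, Fin.lt_def] at he
      exact ⟨c, ⟨r + 1, by omega⟩, .S, ⟨rfl, rfl⟩, rfl⟩

lemma bot_lt_top (c : Fin n) : D.bot c < D.top c := by
  have := D.disjoint c
  simp only [bot, top]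
  exact min_lt_max.2 this

lemma symm_O_ne_symm_X (r : Fin n) : D.O.symm r ≠ D.X.symm r := by
  intro h
  apply D.disjoint (D.O.symm r)
  rw [Equiv.apply_symm_apply, h, Equiv.apply_symm_apply]

lemma left_lt_right (r : Fin n) : D.left r < D.right r :=
  min_lt_max.2 (symm_O_ne_symm_X r)

lemma isPuncture_iff (c r : Fin n) :
    (r = D.bot c ∨ r = D.top c) ↔ (c = D.left r ∨ c = D.right r) := by
  have h1 : (r = D.bot c ∨ r = D.top c) ↔ (r = D.O c ∨ r = D.X c) := by
    simp only [bot, top]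
    rcases le_total (D.O c) (D.X c) with h | h
    · rw [min_eq_left h, max_eq_right h]
    · rw [min_eq_right h, max_eq_left h]; exact or_comm
  have h2 : (c = D.left r ∨ c = D.right r) ↔ (c = D.O.symm r ∨ c = D.X.symm r) := by
    simp only [left, right]
    rcases le_total (D.O.symm r) (D.X.symm r) with h | h
    · rw [min_eq_left h, max_eq_right h]
    · rw [min_eq_right h, max_eq_left h]; exact or_comm
  rw [h1, h2, Equiv.eq_symm_apply, Equiv.eq_symm_apply, eq_comm (a := r), eq_comm (a := r)]

lemma isCrossing_iff (c r : Fin n) :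
    D.IsCrossing c r ↔ D.Has c r .N ∧ D.Has c r .S ∧ D.Has c r .E ∧ D.Has c r .W := by
  simp only [IsCrossing, Has, Fin.le_def, Fin.lt_def]
  omega

/-- The number of edges of the diagram at a lattice point is `0`, `2` or `4`; it is `4` exactly
at the crossings. -/
lemma vertex_cases (c r : Fin n) :
    (D.IsCrossing c r ∧ D.Has c r .N ∧ D.Has c r .S ∧ D.Has c r .E ∧ D.Has c r .W) ∨
    (¬ D.IsCrossing c r ∧
      ((D.Has c r .N ∧ D.Has c r .S ∧ ¬ D.Has c r .E ∧ ¬ D.Has c r .W) ∨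
       (¬ D.Has c r .N ∧ ¬ D.Has c r .S ∧ D.Has c r .E ∧ D.Has c r .W) ∨
       (D.Has c r .N ∧ ¬ D.Has c r .S ∧ D.Has c r .E ∧ ¬ D.Has c r .W) ∨
       (D.Has c r .N ∧ ¬ D.Has c r .S ∧ ¬ D.Has c r .E ∧ D.Has c r .W) ∨
       (¬ D.Has c r .N ∧ D.Has c r .S ∧ D.Has c r .E ∧ ¬ D.Has c r .W) ∨
       (¬ D.Has c r .N ∧ D.Has c r .S ∧ ¬ D.Has c r .E ∧ D.Has c r .W) ∨
       (¬ D.Has c r .N ∧ ¬ D.Has c r .S ∧ ¬ D.Has c r .E ∧ ¬ D.Has c r .W))) := by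
  have h2 := bot_lt_top (D := D) c
  have h3 := left_lt_right (D := D) r
  have hV : (D.Has c r .N ↔ ¬ D.Has c r .S) ↔ (r = D.bot c ∨ r = D.top c) := by
    simp only [Has, Fin.le_def, Fin.lt_def, Fin.ext_iff] at *
    omega
  have hH : (D.Has c r .E ↔ ¬ D.Has c r .W) ↔ (c = D.left r ∨ c = D.right r) := by
    simp only [Has, Fin.le_def, Fin.lt_def, Fin.ext_iff] at *
    omega
  rw [isPuncture_iff, ← hH] at hV
  rw [isCrossing_iff]
  by_cases hN : D.Has c r .N <;> by_cases hS : D.Has c r .S <;> by_cases hE : D.Has c r .E <;>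
    by_cases hW : D.Has c r .W <;> simp [hN, hS, hE, hW] at hV ⊢

/-- The resolution `v` joins the edges leaving `(c, r)` in the directions `a` and `a'`. -/
def Arc (v : D.Resolution) (c r : Fin n) (a a' : Direction) : Prop :=
  D.Has c r a ∧ D.Has c r a' ∧ a ≠ a' ∧
    ∀ hk : D.IsCrossing c r, ResolutionArc (v ⟨(c, r), hk⟩) a a' ∨
      ResolutionArc (v ⟨(c, r), hk⟩) a' a

lemma Arc.symm {v : D.Resolution} {c r : Fin n} {a a' : Direction} (h : Arc v c r a a') :
    Arc v c r a' a :=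
  ⟨h.2.1, h.1, h.2.2.1.symm, fun hk => (h.2.2.2 hk).symm⟩

lemma exists_arc (v : D.Resolution) {c r : Fin n} {a : Direction} (h : D.Has c r a) :
    ∃ a', Arc v c r a a' := by
  rcases vertex_cases (D := D) c r with ⟨hk, h1, h2, h3, h4⟩ | ⟨hk, h'⟩
  · cases hv : v ⟨(c, r), hk⟩ <;> cases a
    · exact ⟨.E, h1, h3, by decide, fun _ => by rw [hv]; exact Or.inl trivial⟩
    · exact ⟨.N, h3, h1, by decide, fun _ => by rw [hv]; exact Or.inr trivial⟩
    · exact ⟨.W, h2, h4, by decide, fun _ => by rw [hv]; exact Or.inl trivial⟩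
    · exact ⟨.S, h4, h2, by decide, fun _ => by rw [hv]; exact Or.inr trivial⟩
    · exact ⟨.W, h1, h4, by decide, fun _ => by rw [hv]; exact Or.inl trivial⟩
    · exact ⟨.S, h3, h2, by decide, fun _ => by rw [hv]; exact Or.inr trivial⟩
    · exact ⟨.E, h2, h3, by decide, fun _ => by rw [hv]; exact Or.inl trivial⟩
    · exact ⟨.N, h4, h1, by decide, fun _ => by rw [hv]; exact Or.inr trivial⟩
  · have key : ∃ a', D.Has c r a' ∧ a ≠ a' := by
      rcases h' with h' | h' | h' | h' | h' | h' | h' <;> obtain ⟨h1, h2, h3, h4⟩ := h' <;>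
        cases a <;> first
          | contradiction
          | exact ⟨.N, by assumption, by decide⟩
          | exact ⟨.E, by assumption, by decide⟩
          | exact ⟨.S, by assumption, by decide⟩
          | exact ⟨.W, by assumption, by decide⟩
    obtain ⟨a', h1, h2⟩ := key
    exact ⟨a', h, h1, h2, fun hk' => absurd hk' hk⟩

lemma Arc.unique {v : D.Resolution} {c r : Fin n} {a a' a'' : Direction} (h : Arc v c r a a')
    (h' : Arc v c r a a'') : a' = a'' := by
  obtain ⟨g1, g2, g3, g4⟩ := h
  obtain ⟨g1', g2', g3', g4'⟩ := h'
  rcases vertex_cases (D := D) c r with ⟨hk, h1, h2, h3, h4⟩ | ⟨hk, h'⟩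
  · have g5 := g4 hk
    have g6 := g4' hk
    revert g5 g6
    cases v ⟨(c, r), hk⟩ <;> cases a <;> cases a' <;> cases a'' <;> simp [ResolutionArc]
  · rcases h' with h' | h' | h' | h' | h' | h' | h' <;> obtain ⟨h1, h2, h3, h4⟩ := h' <;>
        cases a <;> first
          | contradiction
          | (cases a' <;> cases a'' <;> first | rfl | contradiction)

/-- An arc of a resolution never passes straight through a crossing. -/
lemma Arc.ne_opp {v : D.Resolution} {c r : Fin n} {a a' : Direction} (h : Arc v c r a a')
    (hk : D.IsCrossing c r) : a' ≠ a.opp := by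
  have := h.2.2.2 hk
  revert this
  cases v ⟨(c, r), hk⟩ <;> cases a <;> cases a' <;> simp [ResolutionArc, Direction.opp]

/-! ### The checkerboard orientation -/

variable (D)

open Classical in
/-- The sign `-1` if an edge of the diagram leaves `(c, r)` in the direction `a`, `1` otherwise. -/
def hasSign (c r : Fin n) (a : Direction) : ℤ := if D.Has c r a then -1 else 1

/-- The colour `±1` of the region to the northwest of `(c, r)`: it changes at every vertical edge
to the left. -/
def colorNW (c r : Fin n) : ℤ := ∏ c' ∈ Finset.Iio c, D.hasSign c' r .N

/-- The checkerboard orientation of the edges of the diagram, as a boundary of the regions of one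
colour: `1` if an edge is oriented upward or to the right. -/
def checkerSign : LatticeEdge n → ℤ
  | .v c r => - D.colorNW c r
  | .h c r => - (D.colorNW c r * D.hasSign c r .N)

variable {D}

lemma hasSign_sq (c r : Fin n) (a : Direction) : D.hasSign c r a * D.hasSign c r a = 1 := by
  unfold hasSign; split_ifs <;> rfl

lemma colorNW_sq (c r : Fin n) : D.colorNW c r * D.colorNW c r = 1 := by
  unfold colorNW
  rw [← Finset.prod_mul_distrib]
  exact Finset.prod_eq_one fun c' _ => hasSign_sq c' r .N

lemma checkerSign_sq (e : LatticeEdge n) : D.checkerSign e * D.checkerSign e = 1 := by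
  cases e with
  | h c r =>
    have h1 := colorNW_sq (D := D) c r
    have h2 := hasSign_sq (D := D) c r .N
    simp only [checkerSign]
    linear_combination D.hasSign c r .N * D.hasSign c r .N * h1 + h2
  | v c r =>
    have h1 := colorNW_sq (D := D) c r
    simp only [checkerSign]
    linear_combination h1

lemma checkerSign_eq_or (e : LatticeEdge n) : D.checkerSign e = 1 ∨ D.checkerSign e = -1 := by
  have := checkerSign_sq (D := D) e
  exact mul_self_eq_one_iff.1 this

/-- The colours of two vertically adjacent regions differ exactly across a horizontal edge. -/
lemma prod_hasSign_S (c r : Fin n) :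
    ∏ c' ∈ Finset.Iio c, D.hasSign c' r .S = D.colorNW c r * D.hasSign c r .W := by
  classical
  have h1 : (∏ c' ∈ Finset.Iio c, D.hasSign c' r .N) * ∏ c' ∈ Finset.Iio c, D.hasSign c' r .S
      = D.hasSign c r .W := by
    rw [← Finset.prod_mul_distrib]
    have h2 : ∀ c' ∈ Finset.Iio c, D.hasSign c' r .N * D.hasSign c' r .S =
        (if c' = D.left r then -1 else 1) * (if c' = D.right r then -1 else 1) := by
      intro c' _
      have g1 := isPuncture_iff (D := D) c' r
      have g2 := bot_lt_top (D := D) c'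
      have g3 := left_lt_right (D := D) r
      simp only [hasSign, Has, Fin.le_def, Fin.lt_def, Fin.ext_iff] at *
      split_ifs <;> omega
    rw [Finset.prod_congr rfl h2, Finset.prod_mul_distrib, Finset.prod_ite_eq',
      Finset.prod_ite_eq']
    have g3 := left_lt_right (D := D) r
    simp only [hasSign, Has, Finset.mem_Iio, Fin.le_def, Fin.lt_def] at *
    split_ifs <;> omega
  have h3 := colorNW_sq (D := D) c r
  unfold colorNW at *
  rw [← h1, ← mul_assoc, h3, one_mul]

/-- The outward flux of the checkerboard orientation at a lattice point. -/
lemma checkerSign_mul_sgn {c r : Fin n} {e : LatticeEdge n} {a : Direction}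
    (h : e.LeavesIn c r a) : D.checkerSign e * a.sgn = match a with
      | .N => - D.colorNW c r
      | .E => - (D.colorNW c r * D.hasSign c r .N)
      | .S => D.colorNW c r * D.hasSign c r .W
      | .W => D.colorNW c r := by
  cases e <;> cases a <;> simp only [LatticeEdge.LeavesIn] at h
  · obtain ⟨rfl, rfl⟩ := h
    simp [checkerSign, Direction.sgn]
  · obtain ⟨h1, rfl⟩ := h
    rename_i c' r
    have h2 : Finset.Iio c = insert c' (Finset.Iio c') := by
      ext x
      simp only [Finset.mem_Iio, Finset.mem_insert, Fin.lt_def, Fin.ext_iff]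
      omega
    simp only [checkerSign, Direction.sgn, colorNW]
    rw [h2, Finset.prod_insert (by simp)]
    ring
  · obtain ⟨rfl, rfl⟩ := h
    simp [checkerSign, Direction.sgn]
  · obtain ⟨rfl, h1⟩ := h
    rename_i c r'
    simp only [checkerSign, Direction.sgn]
    rw [← prod_hasSign_S, neg_mul_neg, mul_one]
    refine Finset.prod_congr rfl fun x _ => ?_
    unfold hasSign
    congr 1
    simp only [Has, Fin.le_def, Fin.lt_def, eq_iff_iff]
    omega

lemma hasSign_of_has {c r : Fin n} {a : Direction} (h : D.Has c r a) : D.hasSign c r a = -1 :=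
  if_pos h

lemma hasSign_of_not_has {c r : Fin n} {a : Direction} (h : ¬ D.Has c r a) :
    D.hasSign c r a = 1 :=
  if_neg h

/-- The checkerboard orientation is coherent along the arcs of every resolution. -/
lemma Arc.checker {v : D.Resolution} {c r : Fin n} {a a' : Direction} (h : Arc v c r a a')
    {e e' : LatticeEdge n} (he : e.LeavesIn c r a) (he' : e'.LeavesIn c r a') :
    D.checkerSign e * a.sgn + D.checkerSign e' * a'.sgn = 0 := by
  rw [checkerSign_mul_sgn he, checkerSign_mul_sgn he']
  obtain ⟨g1, g2, g3, g4⟩ := h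
  rcases vertex_cases (D := D) c r with ⟨hk, h1, h2, h3, h4⟩ | ⟨hk, h'⟩
  · have g5 := g4 hk
    rw [hasSign_of_has h1, hasSign_of_has h4]
    revert g5
    cases v ⟨(c, r), hk⟩ <;> cases a <;> cases a' <;> simp [ResolutionArc]
  · rcases h' with h' | h' | h' | h' | h' | h' | h' <;> obtain ⟨h1, h2, h3, h4⟩ := h' <;>
      cases a <;> first
          | contradiction
          | (cases a' <;> first | contradiction | simp [hasSign_of_has, hasSign_of_not_has, *])

/-- At a crossing the checkerboard orientation points outward on the vertical edges and inward on
the horizontal ones, or conversely. -/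
lemma checkerSign_crossing {c r : Fin n} (hk : D.IsCrossing c r) {e e' : LatticeEdge n}
    {a a' : Direction} (he : e.LeavesIn c r a) (he' : e'.LeavesIn c r a') :
    D.checkerSign e * a.sgn * (a.vec.1 * a.vec.1 - a.vec.2 * a.vec.2) =
    D.checkerSign e' * a'.sgn * (a'.vec.1 * a'.vec.1 - a'.vec.2 * a'.vec.2) := by
  rw [checkerSign_mul_sgn he, checkerSign_mul_sgn he']
  obtain ⟨h1, h2, h3, h4⟩ := (isCrossing_iff c r).1 hk
  rw [hasSign_of_has h1, hasSign_of_has h4]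
  cases a <;> cases a' <;> simp [Direction.vec]

/-! ### The circles of a resolution as cycles of a permutation -/

/-- `e'` follows `e` in the resolution `v`, with respect to the checkerboard orientation. -/
def Succ (v : D.Resolution) (e e' : D.Edge) : Prop :=
  ∃ (c r : Fin n) (a a' : Direction), e.1.LeavesIn c r a ∧ e'.1.LeavesIn c r a' ∧
    Arc v c r a a' ∧ D.checkerSign e.1 * a.sgn = -1

lemma exists_succ (v : D.Resolution) (e : D.Edge) : ∃ e', Succ v e e' := by
  obtain ⟨c, r, a, h1, h2⟩ := exists_end e (s := - D.checkerSign e.1)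
    (by rcases checkerSign_eq_or (D := D) e.1 with h | h <;> simp [h])
  obtain ⟨a', h3⟩ := exists_arc v (has_of_leavesIn e h1)
  obtain ⟨e', h4⟩ := exists_edge h3.2.1
  refine ⟨e', c, r, a, a', h1, h4, h3, ?_⟩
  rw [h2]
  have := checkerSign_sq (D := D) e.1
  linarith

lemma exists_pred (v : D.Resolution) (e : D.Edge) : ∃ e', Succ v e' e := by
  obtain ⟨c, r, a, h1, h2⟩ := exists_end e (s := D.checkerSign e.1)
    (checkerSign_eq_or (D := D) e.1)
  obtain ⟨a', h3⟩ := exists_arc v (has_of_leavesIn e h1)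
  obtain ⟨e', h4⟩ := exists_edge h3.2.1
  refine ⟨e', c, r, a', a, h4, h1, h3.symm, ?_⟩
  have h5 := h3.checker h1 h4
  rw [h2, checkerSign_sq] at h5
  linarith

lemma Succ.unique {v : D.Resolution} {e e' e'' : D.Edge} (h : Succ v e e') (h' : Succ v e e'') :
    e' = e'' := by
  obtain ⟨c, r, a, b, h1, h2, h3, h4⟩ := h
  obtain ⟨c', r', a', b', h1', h2', h3', h4'⟩ := h'
  have hs : a.sgn = a'.sgn := by
    have := checkerSign_sq (D := D) e.1
    linear_combination D.checkerSign e.1 * (h4 - h4') + (a'.sgn - a.sgn) * this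
  obtain ⟨rfl, rfl, rfl⟩ := h1.vertex_unique h1' hs
  obtain rfl := h3.unique h3'
  exact Subtype.ext (h2.unique h2')

lemma Succ.checker_right {v : D.Resolution} {e e' : D.Edge} {c r : Fin n} {a a' : Direction}
    (h1 : e.1.LeavesIn c r a) (h2 : e'.1.LeavesIn c r a') (h3 : Arc v c r a a')
    (h4 : D.checkerSign e.1 * a.sgn = -1) : D.checkerSign e'.1 * a'.sgn = 1 := by
  have := h3.checker h1 h2
  linarith

lemma Succ.unique_left {v : D.Resolution} {e e' e'' : D.Edge} (h : Succ v e' e)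
    (h' : Succ v e'' e) : e' = e'' := by
  obtain ⟨c, r, b, a, h2, h1, h3, h4⟩ := h
  obtain ⟨c', r', b', a', h2', h1', h3', h4'⟩ := h'
  have g4 := Succ.checker_right h2 h1 h3 h4
  have g4' := Succ.checker_right h2' h1' h3' h4'
  have hs : a.sgn = a'.sgn := by
    have := checkerSign_sq (D := D) e.1
    linear_combination D.checkerSign e.1 * (g4 - g4') + (a'.sgn - a.sgn) * this
  obtain ⟨rfl, rfl, rfl⟩ := h1.vertex_unique h1' hs
  obtain rfl := h3.symm.unique h3'.symm
  exact Subtype.ext (h2.unique h2')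

/-- The permutation of the edges of the diagram whose cycles are the circles of the resolution
`v`, traversed along the checkerboard orientation. -/
def next (v : D.Resolution) : Equiv.Perm D.Edge :=
  Equiv.ofBijective (fun e => (exists_succ v e).choose)
    ⟨fun e e' h => Succ.unique_left (exists_succ v e).choose_spec
      (by rw [show (exists_succ v e).choose = _ from h]; exact (exists_succ v e').choose_spec),
     fun e => ⟨(exists_pred v e).choose,
      (exists_succ v _).choose_spec.unique (exists_pred v e).choose_spec⟩⟩

lemma succ_next (v : D.Resolution) (e : D.Edge) : Succ v e (next v e) :=
  (exists_succ v e).choose_spec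

lemma Succ.eq_next {v : D.Resolution} {e e' : D.Edge} (h : Succ v e e') : e' = next v e :=
  h.unique (succ_next v e)

lemma Arc.succ_or_succ {v : D.Resolution} {c r : Fin n} {a a' : Direction} (h : Arc v c r a a')
    {e e' : D.Edge} (he : e.1.LeavesIn c r a) (he' : e'.1.LeavesIn c r a') :
    Succ v e e' ∨ Succ v e' e := by
  have h1 := h.checker he he'
  have h2 : D.checkerSign e.1 * a.sgn = 1 ∨ D.checkerSign e.1 * a.sgn = -1 := by
    rcases checkerSign_eq_or (D := D) e.1 with h | h <;> rw [h] <;> cases a <;>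
      simp [Direction.sgn]
  rcases h2 with h2 | h2
  · exact Or.inr ⟨c, r, a', a, he', he, h.symm, by linarith⟩
  · exact Or.inl ⟨c, r, a, a', he, he', h, h2⟩

lemma sameCycle_of_adjacent {v : D.Resolution} {e e' : D.Edge} (h : D.Adjacent v e e') :
    (next v).SameCycle e e' := by
  obtain ⟨c, r, a, a', h1, h2, h3⟩ := h
  by_cases haa : a = a'
  · subst haa
    rw [Subtype.ext (h1.unique h2)]
  · have harc : Arc v c r a a' := ⟨has_of_leavesIn e h1, has_of_leavesIn e' h2, haa,
      fun hk => Or.inl (h3 hk)⟩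
    rcases harc.succ_or_succ h1 h2 with h | h
    · rw [h.eq_next]; exact Equiv.Perm.sameCycle_apply_right.2 (Equiv.Perm.SameCycle.refl _ _)
    · rw [h.eq_next]; exact Equiv.Perm.sameCycle_apply_left.2 (Equiv.Perm.SameCycle.refl _ _)

lemma circleOf_next (v : D.Resolution) (e : D.Edge) :
    D.circleOf v (next v e) = D.circleOf v e := by
  obtain ⟨c, r, a, a', h1, h2, h3, -⟩ := succ_next v e
  by_cases hk : D.IsCrossing c r
  · rcases h3.2.2.2 hk with h | h
    · exact (Quot.sound ⟨c, r, a, a', h1, h2, fun _ => h⟩).symm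
    · exact Quot.sound ⟨c, r, a', a, h2, h1, fun _ => h⟩
  · exact Quot.sound ⟨c, r, a', a, h2, h1, fun h => absurd h hk⟩

lemma circleOf_eq_iff {v : D.Resolution} {e e' : D.Edge} :
    D.circleOf v e = D.circleOf v e' ↔ (next v).SameCycle e e' := by
  constructor
  · intro h
    have h' := Quot.eqvGen_exact h
    induction h' with
    | rel x y hxy => exact sameCycle_of_adjacent hxy
    | refl x => exact Equiv.Perm.SameCycle.refl _ _
    | symm x y _ ih => exact (ih (by rw [h])).symm
    | trans x y z hxy hyz ih1 ih2 =>
      exact (ih1 (Quot.eqvGen_sound hxy)).trans (ih2 (Quot.eqvGen_sound hyz))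
  · intro h
    obtain ⟨m, rfl⟩ := sameCycle_iff_exists_nat_pow.1 h
    clear h
    induction m with
    | zero => rfl
    | succ m ih => rw [pow_succ', Equiv.Perm.mul_apply, circleOf_next, ih]

end GridDiagram

/-! ### Flows on the diagram and their winding numbers -/

namespace GridDiagram

variable {n : ℕ} {D : GridDiagram n}

instance : Fintype D.Edge := Fintype.ofFinite _

open Classical in
/-- The value of a function on the edges at the edge leaving `(c, r)` in the direction `a`, or
`0` if there is no such edge. -/
def flowAt (f : D.Edge → ℤ) (c r : Fin n) (a : Direction) : ℤ :=
  if h : ∃ e : D.Edge, e.1.LeavesIn c r a then f h.choose else 0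

lemma flowAt_of_leavesIn (f : D.Edge → ℤ) {c r : Fin n} {a : Direction} {e : D.Edge}
    (h : e.1.LeavesIn c r a) : flowAt f c r a = f e := by
  have hex : ∃ e : D.Edge, e.1.LeavesIn c r a := ⟨e, h⟩
  rw [flowAt, dif_pos hex]
  congr 1
  exact Subtype.ext (hex.choose_spec.unique h)

lemma flowAt_of_not_has (f : D.Edge → ℤ) {c r : Fin n} {a : Direction} (h : ¬ D.Has c r a) :
    flowAt f c r a = 0 := by
  rw [flowAt, dif_neg]
  rintro ⟨e, he⟩
  exact h (has_of_leavesIn e he)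

lemma flowAt_E_eq_W (f : D.Edge → ℤ) (c r : Fin n) (hc : (c : ℕ) + 1 < n) :
    flowAt f ⟨c + 1, hc⟩ r .W = flowAt f c r .E := by
  by_cases h : D.Has c r .E
  · obtain ⟨e, he⟩ := exists_edge h
    have he' : e.1.LeavesIn ⟨c + 1, hc⟩ r .W := by
      obtain ⟨e, h'⟩ := e
      cases e <;> simp only [LatticeEdge.LeavesIn] at he ⊢
      obtain ⟨rfl, rfl⟩ := he
      exact ⟨rfl, rfl⟩
    rw [flowAt_of_leavesIn f he, flowAt_of_leavesIn f he']
  · rw [flowAt_of_not_has f h, flowAt_of_not_has f]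
    simp only [Has, Fin.le_def, Fin.lt_def] at h ⊢
    omega

lemma flowAt_N_eq_S (f : D.Edge → ℤ) (c r : Fin n) (hr : (r : ℕ) + 1 < n) :
    flowAt f c ⟨r + 1, hr⟩ .S = flowAt f c r .N := by
  by_cases h : D.Has c r .N
  · obtain ⟨e, he⟩ := exists_edge h
    have he' : e.1.LeavesIn c ⟨r + 1, hr⟩ .S := by
      obtain ⟨e, h'⟩ := e
      cases e <;> simp only [LatticeEdge.LeavesIn] at he ⊢
      obtain ⟨rfl, rfl⟩ := he
      exact ⟨rfl, rfl⟩
    rw [flowAt_of_leavesIn f he, flowAt_of_leavesIn f he']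
  · rw [flowAt_of_not_has f h, flowAt_of_not_has f]
    simp only [Has, Fin.le_def, Fin.lt_def] at h ⊢
    omega

/-- A function on the edges, read as a flow upward and to the right, is coherent for a resolution
if what enters an arc at one end leaves it at the other one. -/
def IsCoherent (v : D.Resolution) (f : D.Edge → ℤ) : Prop :=
  ∀ ⦃c r : Fin n⦄ ⦃a a' : Direction⦄, Arc v c r a a' → ∀ ⦃e e' : D.Edge⦄,
    e.1.LeavesIn c r a → e'.1.LeavesIn c r a' → f e * a.sgn + f e' * a'.sgn = 0

lemma IsCoherent.flowAt {v : D.Resolution} {f : D.Edge → ℤ} (hf : IsCoherent v f) {c r : Fin n}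
    {a a' : Direction} (h : Arc v c r a a') :
    flowAt f c r a * a.sgn + flowAt f c r a' * a'.sgn = 0 := by
  obtain ⟨e, he⟩ := exists_edge h.1
  obtain ⟨e', he'⟩ := exists_edge h.2.1
  rw [flowAt_of_leavesIn f he, flowAt_of_leavesIn f he']
  exact hf h he he'

/-- A coherent flow is conserved at every lattice point. -/
lemma IsCoherent.conserved {v : D.Resolution} {f : D.Edge → ℤ} (hf : IsCoherent v f)
    (c r : Fin n) : GridDiagram.flowAt f c r .N + GridDiagram.flowAt f c r .E =
      GridDiagram.flowAt f c r .S + GridDiagram.flowAt f c r .W := by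
  rcases vertex_cases (D := D) c r with ⟨hk, h1, h2, h3, h4⟩ | ⟨hk, h'⟩
  · obtain ⟨a, ha⟩ := exists_arc v h1
    obtain ⟨b, hb⟩ := exists_arc v h2
    have fa := hf.flowAt ha
    have fb := hf.flowAt hb
    have ga := ha.2.2.2 hk
    have gb := hb.2.2.2 hk
    revert ga gb fa fb
    cases v ⟨(c, r), hk⟩ <;> cases a <;> cases b <;>
      simp only [ResolutionArc, Direction.sgn, or_self, false_imp_iff, imp_true_iff, or_false,
        true_imp_iff] <;>
      (intros; linarith)
  · have key : ∀ a a', D.Has c r a → D.Has c r a' → a ≠ a' →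
        GridDiagram.flowAt f c r a * a.sgn + GridDiagram.flowAt f c r a' * a'.sgn = 0 :=
      fun a a' h1 h2 h3 => hf.flowAt ⟨h1, h2, h3, fun h => absurd h hk⟩
    rcases h' with h' | h' | h' | h' | h' | h' | h' <;> obtain ⟨h1, h2, h3, h4⟩ := h'
    · have := key _ _ h1 h2 (by decide)
      rw [flowAt_of_not_has f h3, flowAt_of_not_has f h4]
      simp only [Direction.sgn] at this; linarith
    · have := key _ _ h3 h4 (by decide)
      rw [flowAt_of_not_has f h1, flowAt_of_not_has f h2]
      simp only [Direction.sgn] at this; linarith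
    · have := key _ _ h1 h3 (by decide)
      rw [flowAt_of_not_has f h2, flowAt_of_not_has f h4]
      simp only [Direction.sgn] at this; linarith
    · have := key _ _ h1 h4 (by decide)
      rw [flowAt_of_not_has f h2, flowAt_of_not_has f h3]
      simp only [Direction.sgn] at this; linarith
    · have := key _ _ h2 h3 (by decide)
      rw [flowAt_of_not_has f h1, flowAt_of_not_has f h4]
      simp only [Direction.sgn] at this; linarith
    · have := key _ _ h2 h4 (by decide)
      rw [flowAt_of_not_has f h1, flowAt_of_not_has f h3]
      simp only [Direction.sgn] at this; linarith
    · rw [flowAt_of_not_has f h1, flowAt_of_not_has f h2, flowAt_of_not_has f h3,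
        flowAt_of_not_has f h4]

/-- The winding number of a flow in the cell to the northeast of `(c, r)`. -/
def windNE (f : D.Edge → ℤ) (c r : Fin n) : ℤ := - ∑ c' ∈ Finset.Iic c, flowAt f c' r .N

/-- The winding number of a flow in the cell to the northwest of `(c, r)`. -/
def windNW (f : D.Edge → ℤ) (c r : Fin n) : ℤ := - ∑ c' ∈ Finset.Iio c, flowAt f c' r .N

/-- The winding number of a flow in the cell to the southeast of `(c, r)`. -/
def windSE (f : D.Edge → ℤ) (c r : Fin n) : ℤ := - ∑ c' ∈ Finset.Iic c, flowAt f c' r .S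

/-- The winding number of a flow in the cell to the southwest of `(c, r)`. -/
def windSW (f : D.Edge → ℤ) (c r : Fin n) : ℤ := - ∑ c' ∈ Finset.Iio c, flowAt f c' r .S

lemma Iic_eq_insert_Iio (c : Fin n) : Finset.Iic c = insert c (Finset.Iio c) := by
  ext x
  simp only [Finset.mem_Iic, Finset.mem_insert, Finset.mem_Iio]
  exact le_iff_eq_or_lt

lemma Iio_succ_eq_Iic (c : Fin n) (hc : (c : ℕ) + 1 < n) :
    Finset.Iio (⟨c + 1, hc⟩ : Fin n) = Finset.Iic c := by
  ext x
  simp only [Finset.mem_Iic, Finset.mem_Iio, Fin.lt_def, Fin.le_def]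
  omega

lemma windNE_eq (f : D.Edge → ℤ) (c r : Fin n) :
    windNE f c r = windNW f c r - flowAt f c r .N := by
  rw [windNE, windNW, Iic_eq_insert_Iio, Finset.sum_insert (by simp)]
  ring

lemma windSE_eq (f : D.Edge → ℤ) (c r : Fin n) :
    windSE f c r = windSW f c r - flowAt f c r .S := by
  rw [windSE, windSW, Iic_eq_insert_Iio, Finset.sum_insert (by simp)]
  ring

lemma windNW_succ (f : D.Edge → ℤ) (c r : Fin n) (hc : (c : ℕ) + 1 < n) :
    windNW f ⟨c + 1, hc⟩ r = windNE f c r := by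
  rw [windNW, windNE, Iio_succ_eq_Iic]

lemma windSW_succ (f : D.Edge → ℤ) (c r : Fin n) (hc : (c : ℕ) + 1 < n) :
    windSW f ⟨c + 1, hc⟩ r = windSE f c r := by
  rw [windSW, windSE, Iio_succ_eq_Iic]

lemma windSE_succ (f : D.Edge → ℤ) (c r : Fin n) (hr : (r : ℕ) + 1 < n) :
    windSE f c ⟨r + 1, hr⟩ = windNE f c r := by
  simp only [windSE, windNE, flowAt_N_eq_S]

lemma windSW_succ' (f : D.Edge → ℤ) (c r : Fin n) (hr : (r : ℕ) + 1 < n) :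
    windSW f c ⟨r + 1, hr⟩ = windNW f c r := by
  simp only [windSW, windNW, flowAt_N_eq_S]

lemma IsCoherent.windNE_sub_windSE {v : D.Resolution} {f : D.Edge → ℤ} (hf : IsCoherent v f)
    (c r : Fin n) : windNE f c r - windSE f c r = GridDiagram.flowAt f c r .E := by
  obtain ⟨k, hk⟩ := c
  induction k with
  | zero =>
    have h1 := windNE_eq f ⟨0, hk⟩ r
    have h2 := windSE_eq f ⟨0, hk⟩ r
    have h3 := hf.conserved ⟨0, hk⟩ r
    have h4 : GridDiagram.flowAt f ⟨0, hk⟩ r .W = 0 := by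
      apply flowAt_of_not_has; simp [Has, Fin.lt_def]
    have h5 : windNW f ⟨0, hk⟩ r = 0 := by
      rw [windNW, Finset.sum_eq_zero]; · rfl
      intro x hx; rw [Finset.mem_Iio, Fin.lt_def] at hx; simp at hx
    have h6 : windSW f ⟨0, hk⟩ r = 0 := by
      rw [windSW, Finset.sum_eq_zero]; · rfl
      intro x hx; rw [Finset.mem_Iio, Fin.lt_def] at hx; simp at hx
    linarith
  | succ k ih =>
    have h0 := ih (by omega)
    have h1 := windNE_eq f ⟨k + 1, hk⟩ r
    have h2 := windSE_eq f ⟨k + 1, hk⟩ r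
    have h3 := hf.conserved ⟨k + 1, hk⟩ r
    have h4 := flowAt_E_eq_W f ⟨k, by omega⟩ r hk
    have h5 := windNW_succ f ⟨k, by omega⟩ r hk
    have h6 := windSW_succ f ⟨k, by omega⟩ r hk
    simp only at h4 h5 h6
    linarith

lemma IsCoherent.windNW_sub_windSW {v : D.Resolution} {f : D.Edge → ℤ} (hf : IsCoherent v f)
    (c r : Fin n) : windNW f c r - windSW f c r = GridDiagram.flowAt f c r .W := by
  have h1 := hf.windNE_sub_windSE c r
  have h2 := hf.conserved c r
  rw [windNE_eq, windSE_eq] at h1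
  linarith

/-- A sum over the edges as a sum over the lattice points. -/
lemma sum_edges (G : D.Edge → ℤ) :
    ∑ e, G e = ∑ c, ∑ r, (flowAt G c r .E + flowAt G c r .N) := by
  classical
  have h1 : ∑ e, G e = ∑ x : LatticeEdge n, if h : D.HasEdge x then G ⟨x, h⟩ else 0 := by
    rw [← Finset.sum_filter_add_sum_filter_not Finset.univ (fun x => D.HasEdge x)]
    have h2 : ∑ x with ¬ D.HasEdge x, (if h : D.HasEdge x then G ⟨x, h⟩ else 0) = 0 :=
      Finset.sum_eq_zero fun x hx => dif_neg (Finset.mem_filter.1 hx).2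
    rw [h2, add_zero, Finset.sum_subtype (p := D.HasEdge) _ (by simp)]
    exact Finset.sum_congr rfl fun x _ => by rw [dif_pos x.2]
  let φ : (Fin n × Fin n) ⊕ (Fin n × Fin n) ≃ LatticeEdge n :=
    { toFun := fun x => match x with
        | .inl p => .h p.1 p.2
        | .inr p => .v p.1 p.2
      invFun := fun e => match e with
        | .h c r => .inl (c, r)
        | .v c r => .inr (c, r)
      left_inv := by rintro (⟨a, b⟩ | ⟨a, b⟩) <;> rfl
      right_inv := by rintro (⟨a, b⟩ | ⟨a, b⟩) <;> rfl }
  have hE : ∀ c r, (if h : D.HasEdge (.h c r) then G ⟨.h c r, h⟩ else 0) = flowAt G c r .E := by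
    intro c r
    split_ifs with h
    · exact (flowAt_of_leavesIn G (c := c) (r := r) (a := .E) (e := ⟨.h c r, h⟩) ⟨rfl, rfl⟩).symm
    · exact (flowAt_of_not_has G (a := .E) h).symm
  have hN : ∀ c r, (if h : D.HasEdge (.v c r) then G ⟨.v c r, h⟩ else 0) = flowAt G c r .N := by
    intro c r
    split_ifs with h
    · exact (flowAt_of_leavesIn G (c := c) (r := r) (a := .N) (e := ⟨.v c r, h⟩) ⟨rfl, rfl⟩).symm
    · exact (flowAt_of_not_has G (a := .N) h).symm
  rw [h1, ← φ.sum_comp, Fintype.sum_sum_type, Fintype.sum_prod_type, Fintype.sum_prod_type,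
    ← Finset.sum_add_distrib]
  refine Finset.sum_congr rfl fun c _ => ?_
  rw [← Finset.sum_add_distrib]
  refine Finset.sum_congr rfl fun r _ => ?_
  rw [← hE, ← hN]
  rfl

/-- Summation by parts along a column of cells. -/
lemma sum_neg_mul_sub {n : ℕ} (a b : Fin n → ℤ)
    (hab : ∀ (r : Fin n) (h : (r : ℕ) + 1 < n), b ⟨r + 1, h⟩ = a r)
    (hb : ∀ r : Fin n, (r : ℕ) = 0 → b r = 0) (ha : ∀ r : Fin n, (r : ℕ) + 1 = n → a r = 0) :
    ∑ r : Fin n, -(r : ℤ) * (a r - b r) = ∑ r : Fin n, a r := by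
  cases n with
  | zero => simp
  | succ m =>
    have h1 : ∑ r : Fin (m + 1), (r : ℤ) * b r = ∑ r : Fin (m + 1), ((r : ℤ) + 1) * a r := by
      rw [Fin.sum_univ_succ, Fin.sum_univ_castSucc, hb 0 rfl, ha (Fin.last m) (by simp)]
      simp only [mul_zero, zero_add, add_zero]
      refine Finset.sum_congr rfl fun i _ => ?_
      have := hab i.castSucc (by simp)
      rw [← this]
      simp [Fin.succ]
    have h2 : ∑ r : Fin (m + 1), -(r : ℤ) * (a r - b r) = ∑ r : Fin (m + 1), (r : ℤ) * b r - ∑ r : Fin (m + 1), (r : ℤ) * a r := by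
      rw [← Finset.sum_sub_distrib]
      exact Finset.sum_congr rfl fun r _ => by ring
    rw [h2, h1, ← Finset.sum_sub_distrib]
    exact Finset.sum_congr rfl fun r _ => by ring

/-- The area form `-y dx` on edges oriented to the right. -/
def areaForm : LatticeEdge n → ℤ
  | .h _ r => -(r : ℤ)
  | .v _ _ => 0

/-- The area enclosed by a flow is the sum of its winding numbers. -/
lemma IsCoherent.sum_areaForm {v : D.Resolution} {f : D.Edge → ℤ} (hf : IsCoherent v f) :
    ∑ e : D.Edge, f e * areaForm e.1 = ∑ c, ∑ r, windNE f c r := by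
  rw [sum_edges]
  refine Finset.sum_congr rfl fun c _ => ?_
  rw [← sum_neg_mul_sub (fun r => windNE f c r) (fun r => windSE f c r)
    (fun r h => windSE_succ f c r h)]
  · refine Finset.sum_congr rfl fun r _ => ?_
    rw [hf.windNE_sub_windSE]
    have hN : GridDiagram.flowAt (fun e => f e * areaForm e.1) c r .N = 0 := by
      by_cases h : D.Has c r .N
      · rw [flowAt_of_leavesIn _ (c := c) (r := r) (a := .N) (e := ⟨.v c r, h⟩) ⟨rfl, rfl⟩]
        simp [areaForm]
      · exact flowAt_of_not_has _ h
    have hE : GridDiagram.flowAt (fun e => f e * areaForm e.1) c r .E =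
        -(r : ℤ) * GridDiagram.flowAt f c r .E := by
      by_cases h : D.Has c r .E
      · have hl : (⟨.h c r, h⟩ : D.Edge).1.LeavesIn c r .E := ⟨rfl, rfl⟩
        rw [flowAt_of_leavesIn _ hl, flowAt_of_leavesIn _ hl]
        simp [areaForm]; ring
      · rw [flowAt_of_not_has _ h, flowAt_of_not_has _ h]; simp
    rw [hN, hE, add_zero]
  · intro r hr
    rw [windSE, Finset.sum_eq_zero]; · rfl
    intro c' _
    apply flowAt_of_not_has
    simp only [Has, Fin.lt_def]; omega
  · intro r hr
    rw [windNE, Finset.sum_eq_zero]; · rfl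
    intro c' _
    apply flowAt_of_not_has
    have := (D.top c').isLt
    simp only [Has, Fin.lt_def]; omega

/-! ### The circles of a resolution as closed curves -/

/-- The direction of an edge in the checkerboard orientation. -/
def heading (e : D.Edge) : Direction :=
  match e.1 with
  | .h _ _ => if D.checkerSign e.1 = 1 then .E else .W
  | .v _ _ => if D.checkerSign e.1 = 1 then .N else .S

lemma heading_of_out {e : D.Edge} {c r : Fin n} {a : Direction} (h : e.1.LeavesIn c r a)
    (hs : D.checkerSign e.1 * a.sgn = 1) : heading e = a := by
  obtain ⟨e, he⟩ := e
  cases e <;> cases a <;> simp only [LatticeEdge.LeavesIn, Direction.sgn] at h hs <;>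
    simp only [heading] <;> split_ifs with h1 <;> first | rfl | (exfalso; omega)

lemma heading_of_in {e : D.Edge} {c r : Fin n} {a : Direction} (h : e.1.LeavesIn c r a)
    (hs : D.checkerSign e.1 * a.sgn = -1) : heading e = a.opp := by
  obtain ⟨e, he⟩ := e
  cases e <;> cases a <;> simp only [LatticeEdge.LeavesIn, Direction.sgn] at h hs <;>
    simp only [heading] <;> split_ifs with h1 <;> first | rfl | (exfalso; omega)

/-- The sum of a function over the edges of the circle through `e`. -/
def circleSum (v : D.Resolution) (e : D.Edge) (G : D.Edge → ℤ) : ℤ :=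
  open Classical in ∑ e', if D.circleOf v e' = D.circleOf v e then G e' else 0

/-- The area enclosed by the circle through `e`, with its checkerboard orientation. -/
def area (v : D.Resolution) (e : D.Edge) : ℤ :=
  circleSum v e fun e' => D.checkerSign e'.1 * areaForm e'.1

/-- The sign of the area: `1` if the checkerboard orientation of the circle through `e` is
counterclockwise. -/
def circleSign (v : D.Resolution) (e : D.Edge) : ℤ := (SignType.sign (area v e) : SignType)

/-- The contribution to the rotation number of the turn at the end of the edge `e`. -/
def turnAfter (v : D.Resolution) (e : D.Edge) : ℤ := (heading e).turn (heading (next v e))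

lemma circleSum_congr {v : D.Resolution} {e e' : D.Edge} (h : D.circleOf v e = D.circleOf v e')
    (G : D.Edge → ℤ) : circleSum v e G = circleSum v e' G := by
  unfold circleSum; rw [h]

lemma area_congr {v : D.Resolution} {e e' : D.Edge} (h : D.circleOf v e = D.circleOf v e') :
    area v e = area v e' := circleSum_congr h _

lemma circleSign_congr {v : D.Resolution} {e e' : D.Edge}
    (h : D.circleOf v e = D.circleOf v e') : circleSign v e = circleSign v e' := by
  unfold circleSign; rw [area_congr h]

lemma circleSum_eq_sum_iterate (v : D.Resolution) (e : D.Edge) (G : D.Edge → ℤ) :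
    circleSum v e G =
      ∑ i ∈ Finset.range (Function.minimalPeriod (next v) e), G ((next v)^[i] e) := by
  classical
  have h1 : circleSum v e G = ∑ e' with D.circleOf v e' = D.circleOf v e, G e' := by
    rw [circleSum, Finset.sum_filter]
  rw [h1]
  symm
  refine Finset.sum_nbij (fun i => (next v)^[i] e) ?_ ?_ ?_ (fun _ _ => rfl)
  · intro i _
    rw [Finset.mem_filter]
    refine ⟨Finset.mem_univ _, ?_⟩
    rw [eq_comm, circleOf_eq_iff, sameCycle_iff_exists_nat_pow]
    exact ⟨i, by rw [Equiv.Perm.coe_pow]⟩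
  · intro i hi j hj hij
    rw [Finset.coe_range] at hi hj
    exact Function.iterate_injOn_Iio_minimalPeriod hi hj hij
  · intro e' he'
    rw [Finset.coe_filter, Set.mem_ofPred_eq, eq_comm, circleOf_eq_iff,
      sameCycle_iff_exists_nat_pow] at he'
    obtain ⟨-, m, hm⟩ := he'
    refine ⟨m % Function.minimalPeriod (next v) e, ?_, ?_⟩
    · rw [Finset.coe_range]
      exact Nat.mod_lt _ (Function.minimalPeriod_pos_of_mem_periodicPts
        ((next v).injective.mem_periodicPts e))
    · simp only
      rw [Function.iterate_mod_minimalPeriod_eq, ← hm, Equiv.Perm.coe_pow]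

end GridDiagram

/-! ### The Jordan curve theorem and the Umlaufsatz for the circles of a resolution -/

namespace GridDiagram

variable {n : ℕ} {D : GridDiagram n}

open Classical in
/-- The flow of one unit along the circle through `e₀`, with its checkerboard orientation. -/
def circleFlow (v : D.Resolution) (e₀ : D.Edge) (e : D.Edge) : ℤ :=
  if D.circleOf v e = D.circleOf v e₀ then D.checkerSign e.1 else 0

lemma Arc.circleOf_eq {v : D.Resolution} {c r : Fin n} {a a' : Direction} (h : Arc v c r a a')
    {e e' : D.Edge} (he : e.1.LeavesIn c r a) (he' : e'.1.LeavesIn c r a') :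
    D.circleOf v e = D.circleOf v e' := by
  rcases h.succ_or_succ he he' with h | h
  · rw [h.eq_next, circleOf_next]
  · rw [h.eq_next, circleOf_next]

lemma isCoherent_circleFlow (v : D.Resolution) (e₀ : D.Edge) : IsCoherent v (circleFlow v e₀) := by
  intro c r a a' h e e' he he'
  unfold circleFlow
  rw [h.circleOf_eq he he']
  split_ifs
  · exact h.checker he he'
  · simp

lemma area_eq_sum_windNE (v : D.Resolution) (e₀ : D.Edge) :
    area v e₀ = ∑ c, ∑ r, windNE (circleFlow v e₀) c r := by
  rw [← (isCoherent_circleFlow v e₀).sum_areaForm, area, circleSum]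
  refine Finset.sum_congr rfl fun e _ => ?_
  unfold circleFlow
  split_ifs <;> simp

/-- The winding number on the left of an edge with its checkerboard orientation. -/
def windLeft (f : D.Edge → ℤ) (e : D.Edge) : ℤ :=
  match e.1 with
  | .v c r => if D.checkerSign e.1 = 1 then windNW f c r else windNE f c r
  | .h c r => if D.checkerSign e.1 = 1 then windNE f c r else windSE f c r

/-- The winding number on the left of the path leaving `(c, r)` in the direction `a`. -/
def windOut (f : D.Edge → ℤ) (c r : Fin n) : Direction → ℤ
  | .N => windNW f c r
  | .E => windNE f c r
  | .S => windSE f c r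
  | .W => windSW f c r

/-- The winding number on the left of the path arriving at `(c, r)` from the direction `a`. -/
def windIn (f : D.Edge → ℤ) (c r : Fin n) : Direction → ℤ
  | .N => windNE f c r
  | .E => windSE f c r
  | .S => windSW f c r
  | .W => windNW f c r

lemma windLeft_of_out (f : D.Edge → ℤ) {e : D.Edge} {c r : Fin n} {a : Direction}
    (h : e.1.LeavesIn c r a) (hs : D.checkerSign e.1 * a.sgn = 1) :
    windLeft f e = windOut f c r a := by
  obtain ⟨e, he⟩ := e
  cases e <;> cases a <;> simp only [LatticeEdge.LeavesIn, Direction.sgn] at h hs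
  · obtain ⟨rfl, rfl⟩ := h
    simp only [windLeft, windOut]; rw [if_pos (by omega)]
  · obtain ⟨h1, rfl⟩ := h
    rename_i c' r
    have hc : (c' : ℕ) + 1 < n := by omega
    obtain rfl : c = ⟨c' + 1, hc⟩ := Fin.ext h1.symm
    simp only [windLeft, windOut]; rw [if_neg (by omega), windSW_succ]
  · obtain ⟨rfl, rfl⟩ := h
    simp only [windLeft, windOut]; rw [if_pos (by omega)]
  · obtain ⟨rfl, h1⟩ := h
    rename_i c r'
    have hr : (r' : ℕ) + 1 < n := by omega
    obtain rfl : r = ⟨r' + 1, hr⟩ := Fin.ext h1.symm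
    simp only [windLeft, windOut]; rw [if_neg (by omega), windSE_succ]

lemma windLeft_of_in (f : D.Edge → ℤ) {e : D.Edge} {c r : Fin n} {a : Direction}
    (h : e.1.LeavesIn c r a) (hs : D.checkerSign e.1 * a.sgn = -1) :
    windLeft f e = windIn f c r a := by
  obtain ⟨e, he⟩ := e
  cases e <;> cases a <;> simp only [LatticeEdge.LeavesIn, Direction.sgn] at h hs
  · obtain ⟨rfl, rfl⟩ := h
    simp only [windLeft, windIn]; rw [if_neg (by omega)]
  · obtain ⟨h1, rfl⟩ := h
    rename_i c' r
    have hc : (c' : ℕ) + 1 < n := by omega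
    obtain rfl : c = ⟨c' + 1, hc⟩ := Fin.ext h1.symm
    simp only [windLeft, windIn]; rw [if_pos (by omega), windNW_succ]
  · obtain ⟨rfl, rfl⟩ := h
    simp only [windLeft, windIn]; rw [if_neg (by omega)]
  · obtain ⟨rfl, h1⟩ := h
    rename_i c r'
    have hr : (r' : ℕ) + 1 < n := by omega
    obtain rfl : r = ⟨r' + 1, hr⟩ := Fin.ext h1.symm
    simp only [windLeft, windIn]; rw [if_pos (by omega), windSW_succ']

/-- The winding number on the left of a curve is constant along the curve. -/
lemma windLeft_next {v : D.Resolution} {f : D.Edge → ℤ} (hf : IsCoherent v f) {e : D.Edge}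
    (he : f e = D.checkerSign e.1) : windLeft f (next v e) = windLeft f e := by
  obtain ⟨c, r, a, a', h1, h2, h3, h4⟩ := succ_next v e
  have h5 := Succ.checker_right h1 h2 h3 h4
  rw [windLeft_of_in f h1 h4, windLeft_of_out f h2 h5]
  have g1 : flowAt f c r a * a.sgn = -1 := by rw [flowAt_of_leavesIn f h1, he, h4]
  have g2 := hf.flowAt h3
  have w1 := windNE_eq f c r
  have w2 := windSE_eq f c r
  have w3 := hf.windNE_sub_windSE c r
  have w4 := hf.windNW_sub_windSW c r
  have hcr : ∀ b, D.Has c r b → D.Has c r b.opp → ¬ D.IsCrossing c r →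
      ∀ b', b' ≠ b → b' ≠ b.opp → flowAt f c r b' = 0 := by
    intro b hb hb' hk b' hbb hbb'
    apply flowAt_of_not_has
    rcases vertex_cases (D := D) c r with ⟨hk', -⟩ | ⟨-, h'⟩
    · exact absurd hk' hk
    · rcases h' with h' | h' | h' | h' | h' | h' | h' <;> obtain ⟨k1, k2, k3, k4⟩ := h' <;>
        cases b <;> first | contradiction | (cases b' <;> first | contradiction | assumption)
  by_cases ho : a' = a.opp
  · have hk : ¬ D.IsCrossing c r := fun hk => h3.ne_opp hk ho
    have hz := hcr a h3.1 (ho ▸ h3.2.1) hk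
    subst ho
    cases a <;> simp only [windIn, windOut, Direction.opp, Direction.sgn] at *
    · have := hz .E (by decide) (by decide); linarith
    · have := hz .S (by decide) (by decide); linarith
    · have := hz .W (by decide) (by decide); linarith
    · have := hz .N (by decide) (by decide); linarith
  · have hne := h3.2.2.1
    cases a <;> cases a' <;> first
      | exact absurd rfl hne
      | exact absurd rfl ho
      | (simp only [windIn, windOut, Direction.sgn] at * <;> linarith)

lemma windLeft_of_circleOf_eq {v : D.Resolution} {e₀ e : D.Edge}
    (h : D.circleOf v e = D.circleOf v e₀) :
    windLeft (circleFlow v e₀) e = windLeft (circleFlow v e₀) e₀ := by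
  obtain ⟨m, rfl⟩ := sameCycle_iff_exists_nat_pow.1 (circleOf_eq_iff.1 h.symm)
  clear h
  induction m with
  | zero => rfl
  | succ m ih =>
    rw [pow_succ', Equiv.Perm.mul_apply, windLeft_next (isCoherent_circleFlow v e₀), ih]
    unfold circleFlow
    rw [if_pos]
    exact (circleOf_eq_iff.2 (sameCycle_iff_exists_nat_pow.2 ⟨m, rfl⟩)).symm

/-- The winding number of a circle takes at most two values besides `0`: those on its two
sides. -/
lemma windNE_circleFlow (v : D.Resolution) (e₀ : D.Edge) (c r : Fin n) :
    windNE (circleFlow v e₀) c r = 0 ∨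
    windNE (circleFlow v e₀) c r = windLeft (circleFlow v e₀) e₀ ∨
    windNE (circleFlow v e₀) c r = windLeft (circleFlow v e₀) e₀ - 1 := by
  set f := circleFlow v e₀ with hf
  have hside : ∀ c : Fin n, flowAt f c r .N ≠ 0 →
      windNE f c r = windLeft f e₀ ∨ windNE f c r = windLeft f e₀ - 1 := by
    intro c hne
    by_cases hh : D.Has c r .N
    · have hl : (⟨.v c r, hh⟩ : D.Edge).1.LeavesIn c r .N := ⟨rfl, rfl⟩
      rw [flowAt_of_leavesIn f hl] at hne
      have hc : D.circleOf v (⟨.v c r, hh⟩ : D.Edge) = D.circleOf v e₀ := by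
        by_contra hcon
        exact hne (if_neg hcon)
      have hfe : f ⟨.v c r, hh⟩ = D.checkerSign (.v c r) := if_pos hc
      have h1 := windLeft_of_circleOf_eq hc
      rw [← hf] at h1
      generalize windLeft f e₀ = w at h1 ⊢
      have h2 := windNE_eq f c r
      rw [flowAt_of_leavesIn f hl, hfe] at h2
      simp only [windLeft] at h1
      split_ifs at h1 with h3
      · right; rw [h2, h3]; linarith
      · left; exact h1
    · exact absurd (flowAt_of_not_has f hh) hne
  obtain ⟨k, hk⟩ := c
  induction k with
  | zero =>
    by_cases h0 : flowAt f ⟨0, hk⟩ r .N = 0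
    · left
      rw [windNE_eq, h0, windNW, Finset.sum_eq_zero]; · rfl
      intro x hx; rw [Finset.mem_Iio, Fin.lt_def] at hx; simp at hx
    · right; exact hside _ h0
  | succ k ih =>
    by_cases h0 : flowAt f ⟨k + 1, hk⟩ r .N = 0
    · rw [windNE_eq, h0, windNW_succ f ⟨k, by omega⟩ r hk, sub_zero]
      exact ih (by omega)
    · right; exact hside _ h0

/-- The rightmost one among the lowest edges of a circle. -/
lemma exists_lowest_edge (v : D.Resolution) (e : D.Edge) :
    ∃ e₀ : D.Edge, D.circleOf v e₀ = D.circleOf v e ∧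
      (∀ e', D.circleOf v e' = D.circleOf v e₀ → e₀.1.mid.2 ≤ e'.1.mid.2) ∧
      (∀ e', D.circleOf v e' = D.circleOf v e₀ → e'.1.mid.2 = e₀.1.mid.2 →
        e'.1.mid.1 ≤ e₀.1.mid.1) := by
  classical
  obtain ⟨e₀, h1, h2⟩ := Finset.exists_min_image
    (Finset.univ.filter fun e' => D.circleOf v e' = D.circleOf v e)
    (fun e' => toLex (e'.1.mid.2, - e'.1.mid.1)) ⟨e, by simp⟩
  simp only [Finset.mem_filter, Finset.mem_univ, true_and] at h1 h2
  refine ⟨e₀, h1, fun e' h' => ?_, fun e' h' h'' => ?_⟩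
  · have := h2 e' (h'.trans h1)
    rw [Prod.Lex.toLex_le_toLex] at this
    simp only at this
    omega
  · have := h2 e' (h'.trans h1)
    rw [Prod.Lex.toLex_le_toLex] at this
    simp only at this
    omega

/-- A lowest edge of a circle is horizontal. -/
lemma horizontal_of_lowest {v : D.Resolution} {e₀ : D.Edge}
    (hlow : ∀ e', D.circleOf v e' = D.circleOf v e₀ → e₀.1.mid.2 ≤ e'.1.mid.2) :
    ∃ c r, ∃ h : D.Has c r .E, e₀ = ⟨.h c r, h⟩ := by
  obtain ⟨e, he⟩ := e₀
  cases e with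
  | h c r => exact ⟨c, r, he, rfl⟩
  | v c r =>
    exfalso
    have hl : (⟨.v c r, he⟩ : D.Edge).1.LeavesIn c r .N := ⟨rfl, rfl⟩
    obtain ⟨a', ha⟩ := exists_arc v (has_of_leavesIn _ hl)
    obtain ⟨e', he'⟩ := exists_edge ha.2.1
    have h1 := hlow e' (ha.circleOf_eq hl he').symm
    rw [he'.mid, hl.mid] at h1
    have hne := ha.2.2.1
    revert h1 hne
    cases a' <;> simp [Direction.vec]

lemma heading_horizontal {c r : Fin n} (h : D.Has c r .E) :
    (heading (⟨.h c r, h⟩ : D.Edge) = .E ∨ heading (⟨.h c r, h⟩ : D.Edge) = .W) ∧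
      (heading (⟨.h c r, h⟩ : D.Edge)).vec.1 = D.checkerSign (.h c r) := by
  simp only [heading]
  rcases checkerSign_eq_or (D := D) (.h c r) with h1 | h1 <;> simp [h1, Direction.vec]

/-- The sign of the area of a circle is read off at its lowest edges. -/
lemma circleSign_eq_of_lowest {v : D.Resolution} {c r : Fin n} (h : D.Has c r .E)
    (hlow : ∀ e', D.circleOf v e' = D.circleOf v ⟨.h c r, h⟩ → 2 * (r : ℤ) ≤ e'.1.mid.2) :
    circleSign v ⟨.h c r, h⟩ = D.checkerSign (.h c r) := by
  set e₀ : D.Edge := ⟨.h c r, h⟩ with he₀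
  set f := circleFlow v e₀ with hf
  have hcoh := isCoherent_circleFlow v e₀
  have hl : e₀.1.LeavesIn c r .E := ⟨rfl, rfl⟩
  have hfe : f e₀ = D.checkerSign (.h c r) := if_pos rfl
  have hSE : windSE f c r = 0 := by
    rw [windSE, Finset.sum_eq_zero]; · rfl
    intro c' _
    by_contra hne
    have hh : D.Has c' r .S := by
      by_contra hh; exact hne (flowAt_of_not_has f hh)
    obtain ⟨e', he'⟩ := exists_edge hh
    rw [flowAt_of_leavesIn f he'] at hne
    have hc : D.circleOf v e' = D.circleOf v e₀ := by
      by_contra hcon; exact hne (if_neg hcon)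
    have := hlow e' hc
    rw [he'.mid] at this
    simp [Direction.vec] at this
  have hNE := hcoh.windNE_sub_windSE c r
  rw [← hf, hSE, flowAt_of_leavesIn f hl, hfe, sub_zero] at hNE
  have hleft : windLeft f e₀ = if D.checkerSign (.h c r) = 1 then 1 else 0 := by
    simp only [windLeft, he₀]
    split_ifs with h1
    · rw [hNE, h1]
    · exact hSE
  have hval : ∀ c' r', 0 ≤ D.checkerSign (.h c r) * windNE f c' r' := by
    intro c' r'
    have h1 := windNE_circleFlow v e₀ c' r'
    rw [← hf, hleft] at h1
    rcases checkerSign_eq_or (D := D) (.h c r) with h2 | h2 <;> rw [h2] at h1 ⊢ <;> simp at h1 ⊢ <;>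
      omega
  have harea : 0 < D.checkerSign (.h c r) * area v e₀ := by
    rw [area_eq_sum_windNE, Finset.mul_sum]
    refine Finset.sum_pos' (fun c' _ => ?_) ⟨c, Finset.mem_univ _, ?_⟩
    · rw [Finset.mul_sum]; exact Finset.sum_nonneg fun r' _ => hval c' r'
    · rw [Finset.mul_sum]
      refine Finset.sum_pos' (fun r' _ => hval c r') ⟨r, Finset.mem_univ _, ?_⟩
      rw [← hf, hNE, checkerSign_sq]; exact one_pos
  unfold circleSign
  rcases checkerSign_eq_or (D := D) (.h c r) with h2 | h2 <;> rw [h2] at harea ⊢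
  · rw [sign_pos (by linarith)]; rfl
  · rw [sign_neg (by linarith)]; rfl

lemma circleSign_eq_or (v : D.Resolution) (e : D.Edge) :
    circleSign v e = 1 ∨ circleSign v e = -1 := by
  obtain ⟨e₀, h1, h2, -⟩ := exists_lowest_edge v e
  obtain ⟨c, r, h, rfl⟩ := horizontal_of_lowest h2
  rw [← circleSign_congr h1, circleSign_eq_of_lowest h h2]
  exact checkerSign_eq_or _

lemma circleSign_sq (v : D.Resolution) (e : D.Edge) : circleSign v e * circleSign v e = 1 := by
  rcases circleSign_eq_or v e with h | h <;> rw [h] <;> rfl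

lemma area_ne_zero (v : D.Resolution) (e : D.Edge) : area v e ≠ 0 := by
  intro h
  have := circleSign_eq_or v e
  simp [circleSign, h] at this

lemma circleSign_mul_area (v : D.Resolution) (e : D.Edge) :
    circleSign v e * area v e = |area v e| := sign_mul_self _

/-- The lattice point at the end of an edge with its checkerboard orientation. -/
def headPoint (e : D.Edge) : ℤ × ℤ :=
  match e.1 with
  | .h c r => if D.checkerSign e.1 = 1 then ((c : ℤ) + 1, (r : ℤ)) else ((c : ℤ), (r : ℤ))
  | .v c r => if D.checkerSign e.1 = 1 then ((c : ℤ), (r : ℤ) + 1) else ((c : ℤ), (r : ℤ))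

lemma mid_add_heading (e : D.Edge) : e.1.mid + (heading e).vec = 2 • headPoint e := by
  obtain ⟨e, he⟩ := e
  cases e <;> simp only [heading, headPoint, LatticeEdge.mid] <;> split_ifs <;>
    simp [Direction.vec] <;> ring

lemma headPoint_of_in {e : D.Edge} {c r : Fin n} {a : Direction} (h : e.1.LeavesIn c r a)
    (hs : D.checkerSign e.1 * a.sgn = -1) : headPoint e = ((c : ℤ), (r : ℤ)) := by
  have h1 := mid_add_heading e
  rw [heading_of_in h hs, h.mid, Direction.vec_opp, add_neg_cancel_right] at h1
  have h2 := congrArg Prod.fst h1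
  have h3 := congrArg Prod.snd h1
  simp at h2 h3
  ext <;> simp only <;> omega

lemma heading_next_ne (v : D.Resolution) (e : D.Edge) :
    heading (next v e) ≠ (heading e).opp := by
  obtain ⟨c, r, a, a', h1, h2, h3, h4⟩ := succ_next v e
  rw [heading_of_in h1 h4, heading_of_out h2 (Succ.checker_right h1 h2 h3 h4), Direction.opp_opp]
  exact h3.2.2.1.symm

lemma mid_next (v : D.Resolution) (e : D.Edge) :
    (next v e).1.mid = 2 • headPoint e + (heading (next v e)).vec := by
  obtain ⟨c, r, a, a', h1, h2, h3, h4⟩ := succ_next v e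
  rw [headPoint_of_in h1 h4, heading_of_out h2 (Succ.checker_right h1 h2 h3 h4), h2.mid]

/-- Two strands of a resolution which meet at a lattice point turn there. -/
lemma heading_ne_of_headPoint_eq {v : D.Resolution} {e e' : D.Edge} (hne : e ≠ e')
    (h : headPoint e = headPoint e') : heading e ≠ heading (next v e) := by
  obtain ⟨c, r, a, b, h1, h2, h3, h4⟩ := succ_next v e
  obtain ⟨c', r', a', b', h1', h2', h3', h4'⟩ := succ_next v e'
  rw [headPoint_of_in h1 h4, headPoint_of_in h1' h4', Prod.mk.injEq] at h
  obtain rfl : c = c' := Fin.ext (by omega)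
  obtain rfl : r = r' := Fin.ext (by omega)
  have h5 := Succ.checker_right h1 h2 h3 h4
  rw [heading_of_in h1 h4, heading_of_out h2 h5]
  intro hb
  subst hb
  have hk : ¬ D.IsCrossing c r := fun hk => h3.ne_opp hk rfl
  have haa : a' ≠ a := by
    rintro rfl; exact hne (Subtype.ext (h1.unique h1'))
  have hab : a' ≠ a.opp := by
    rintro rfl
    obtain rfl : e' = next v e := Subtype.ext (h1'.unique h2)
    rw [h5] at h4'; exact absurd h4' (by decide)
  have k1 := h3.1
  have k2 := h3.2.1
  have k3 := h3'.1
  rcases vertex_cases (D := D) c r with ⟨hk', -⟩ | ⟨-, h'⟩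
  · exact hk hk'
  · rcases h' with h' | h' | h' | h' | h' | h' | h' <;> obtain ⟨j1, j2, j3, j4⟩ := h' <;>
      cases a <;> first | contradiction | (cases a' <;> contradiction)

lemma latticeCurve_circle (v : D.Resolution) (e : D.Edge) :
    LatticeCurve (Function.minimalPeriod (next v) e) (fun i => ((next v)^[i] e).1.mid)
      (fun i => headPoint ((next v)^[i] e)) (fun i => heading ((next v)^[i] e)) where
  pos := Function.minimalPeriod_pos_of_mem_periodicPts ((next v).injective.mem_periodicPts e)
  period i := by simp only [Function.iterate_add_minimalPeriod_eq]
  period_dir i := by simp only [Function.iterate_add_minimalPeriod_eq]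
  head i := mid_add_heading _
  next i := by simp only [Function.iterate_succ_apply']; exact mid_next _ _
  no_backtrack i := by simp only [Function.iterate_succ_apply']; exact heading_next_ne _ _
  injective i j hi hj hij :=
    Function.iterate_injOn_Iio_minimalPeriod hi hj (Subtype.ext (LatticeEdge.mid_injective hij))
  no_crossing i j hi hj hne hij := by
    simp only [Function.iterate_succ_apply']
    refine heading_ne_of_headPoint_eq (fun h => hne ?_) hij
    exact Function.iterate_injOn_Iio_minimalPeriod hi hj h

/-- The rotation number of a circle with its checkerboard orientation is the sign of its area. -/
theorem circleSum_turnAfter (v : D.Resolution) (e : D.Edge) :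
    circleSum v e (turnAfter v) = circleSign v e := by
  obtain ⟨e₀, h1, h2, h3⟩ := exists_lowest_edge v e
  rw [← circleSum_congr h1, ← circleSign_congr h1, circleSum_eq_sum_iterate]
  have hcirc : ∀ i, D.circleOf v ((next v)^[i] e₀) = D.circleOf v e₀ := fun i => by
    rw [eq_comm, circleOf_eq_iff, sameCycle_iff_exists_nat_pow]
    exact ⟨i, by rw [Equiv.Perm.coe_pow]⟩
  obtain ⟨c, r, h, rfl⟩ := horizontal_of_lowest h2
  have key := (latticeCurve_circle v ⟨.h c r, h⟩).sum_turn (fun i => h2 _ (hcirc i))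
    (fun i => h3 _ (hcirc i)) (heading_horizontal h).1
  simp only [Function.iterate_succ_apply'] at key
  simp only [turnAfter]
  rw [key, circleSign_eq_of_lowest h h2]
  exact (heading_horizontal h).2

end GridDiagram

/-! ### Changing the resolution of one crossing -/

namespace GridDiagram

variable {n : ℕ} {D : GridDiagram n}

/-- The edge of the diagram to the right of a crossing. -/
def edgeE (k : D.Crossing) : D.Edge := ⟨.h k.1.1 k.1.2, k.2.2.1.le, k.2.2.2⟩

/-- The edge of the diagram to the left of a crossing. -/
def edgeW (k : D.Crossing) : D.Edge :=
  (exists_edge ((isCrossing_iff _ _).1 k.2).2.2.2).choose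

lemma leavesIn_edgeN (k : D.Crossing) : (D.edgeN k).1.LeavesIn k.1.1 k.1.2 .N := ⟨rfl, rfl⟩

lemma leavesIn_edgeE (k : D.Crossing) : (edgeE k).1.LeavesIn k.1.1 k.1.2 .E := ⟨rfl, rfl⟩

lemma leavesIn_edgeW (k : D.Crossing) : (edgeW k).1.LeavesIn k.1.1 k.1.2 .W :=
  (exists_edge ((isCrossing_iff _ _).1 k.2).2.2.2).choose_spec

lemma leavesIn_edgeS (k : D.Crossing) : (D.edgeS k).1.LeavesIn k.1.1 k.1.2 .S := by
  refine ⟨rfl, ?_⟩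
  have := k.2.1.1
  rw [Fin.lt_def] at this
  simp only
  omega

/-- The outward flux of the checkerboard orientation on the vertical edges at a crossing. -/
def crossingSign (k : D.Crossing) : ℤ := D.checkerSign (D.edgeN k).1

lemma crossingSign_eq_or (k : D.Crossing) : crossingSign k = 1 ∨ crossingSign k = -1 :=
  checkerSign_eq_or _

lemma checkerSign_mul_sgn_crossing (k : D.Crossing) {e : LatticeEdge n} {a : Direction}
    (h : e.LeavesIn k.1.1 k.1.2 a) :
    D.checkerSign e * a.sgn = crossingSign k * (a.vec.2 * a.vec.2 - a.vec.1 * a.vec.1) := by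
  have h1 := checkerSign_crossing k.2 h (leavesIn_edgeN k)
  rw [show (Direction.N).sgn = 1 from rfl, show (Direction.N).vec = (0, 1) from rfl] at h1
  have h2 : (a.vec.1 * a.vec.1 - a.vec.2 * a.vec.2) * (a.vec.1 * a.vec.1 - a.vec.2 * a.vec.2)
      = 1 := by cases a <;> rfl
  unfold crossingSign
  linear_combination (a.vec.1 * a.vec.1 - a.vec.2 * a.vec.2) * h1 - D.checkerSign e * a.sgn * h2

lemma arc_crossing (v : D.Resolution) (k : D.Crossing) {a a' : Direction}
    (h : ResolutionArc (v k) a a') : Arc v k.1.1 k.1.2 a a' := by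
  obtain ⟨h1, h2, h3, h4⟩ := (isCrossing_iff _ _).1 k.2
  refine ⟨?_, ?_, ?_, fun _ => Or.inl h⟩
  · cases a <;> assumption
  · cases a' <;> assumption
  · rintro rfl
    revert h
    cases v k <;> cases a <;> simp [ResolutionArc]

/-- The two edges entering a crossing, in the checkerboard orientation: first the one next to the
upper vertical edge in the `0`-resolution, then the one next to the lower vertical edge. -/
def inEdges (k : D.Crossing) : D.Edge × D.Edge :=
  if crossingSign k = 1 then (edgeE k, edgeW k) else (D.edgeN k, D.edgeS k)

variable {v : D.Resolution} {k : D.Crossing}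

lemma edge_ne_of_leavesIn {e e' : D.Edge} {c r : Fin n} {a a' : Direction}
    (h : e.1.LeavesIn c r a) (h' : e'.1.LeavesIn c r a') (ha : a ≠ a') : e ≠ e' := by
  rintro rfl
  exact ha (h.direction_unique h')

lemma inEdges_ne (k : D.Crossing) : (inEdges k).1 ≠ (inEdges k).2 := by
  unfold inEdges
  split_ifs
  · exact edge_ne_of_leavesIn (leavesIn_edgeE k) (leavesIn_edgeW k) (by decide)
  · exact edge_ne_of_leavesIn (leavesIn_edgeN k) (leavesIn_edgeS k) (by decide)

lemma next_of_leavesIn {e e' : D.Edge} {a a' : Direction} (h : e.1.LeavesIn k.1.1 k.1.2 a)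
    (h' : e'.1.LeavesIn k.1.1 k.1.2 a') (harc : Arc v k.1.1 k.1.2 a a')
    (hs : crossingSign k * (a.vec.2 * a.vec.2 - a.vec.1 * a.vec.1) = -1) : next v e = e' :=
  (Succ.eq_next ⟨_, _, a, a', h, h', harc, by rw [checkerSign_mul_sgn_crossing k h, hs]⟩).symm

lemma next_update_of_ne (v : D.Resolution) (b : Bool) {e : D.Edge} (h1 : e ≠ (inEdges k).1)
    (h2 : e ≠ (inEdges k).2) : next (Function.update v k b) e = next v e := by
  obtain ⟨c, r, a, a', g1, g2, g3, g4⟩ := succ_next v e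
  refine (Succ.eq_next ⟨c, r, a, a', g1, g2, ⟨g3.1, g3.2.1, g3.2.2.1, fun hk => ?_⟩, g4⟩).symm
  rw [Function.update_of_ne]
  · exact g3.2.2.2 hk
  rintro rfl
  have h3 := checkerSign_mul_sgn_crossing ⟨(c, r), hk⟩ g1
  rw [g4] at h3
  unfold inEdges at h1 h2
  split_ifs at h1 h2 with h
  · rw [h] at h3
    cases a
    · simp [Direction.vec] at h3
    · exact h1 (Subtype.ext (g1.unique (leavesIn_edgeE ⟨(c, r), hk⟩)))
    · simp [Direction.vec] at h3
    · exact h2 (Subtype.ext (g1.unique (leavesIn_edgeW ⟨(c, r), hk⟩)))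
  · rw [(crossingSign_eq_or _).resolve_left h] at h3
    cases a
    · exact h1 (Subtype.ext (g1.unique (leavesIn_edgeN ⟨(c, r), hk⟩)))
    · simp [Direction.vec] at h3
    · exact h2 (Subtype.ext (g1.unique (leavesIn_edgeS ⟨(c, r), hk⟩)))
    · simp [Direction.vec] at h3

open Classical in
/-- Changing the resolution of a crossing composes `next` with a transposition. -/
lemma next_update (hv : v k = false) :
    next (Function.update v k true) = next v * Equiv.swap (inEdges k).1 (inEdges k).2 := by
  have hv' : Function.update v k true k = true := Function.update_self _ _ _
  have a1 : Arc v k.1.1 k.1.2 .N .E := arc_crossing v k (by rw [hv]; trivial)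
  have a2 : Arc v k.1.1 k.1.2 .S .W := arc_crossing v k (by rw [hv]; trivial)
  have a3 : Arc (Function.update v k true) k.1.1 k.1.2 .N .W :=
    arc_crossing _ k (by rw [hv']; trivial)
  have a4 : Arc (Function.update v k true) k.1.1 k.1.2 .S .E :=
    arc_crossing _ k (by rw [hv']; trivial)
  have lN := leavesIn_edgeN k
  have lE := leavesIn_edgeE k
  have lS := leavesIn_edgeS k
  have lW := leavesIn_edgeW k
  ext1 e
  rw [Equiv.Perm.mul_apply]
  by_cases h1 : e = (inEdges k).1
  · rw [h1, Equiv.swap_apply_left]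
    unfold inEdges
    split_ifs with h
    · rw [next_of_leavesIn lE lS a4.symm (by rw [h]; rfl),
        next_of_leavesIn lW lS a2.symm (by rw [h]; rfl)]
    · replace h := (crossingSign_eq_or k).resolve_left h
      rw [next_of_leavesIn lN lW a3 (by rw [h]; rfl), next_of_leavesIn lS lW a2 (by rw [h]; rfl)]
  by_cases h2 : e = (inEdges k).2
  · rw [h2, Equiv.swap_apply_right]
    unfold inEdges
    split_ifs with h
    · rw [next_of_leavesIn lW lN a3.symm (by rw [h]; rfl),
        next_of_leavesIn lE lN a1.symm (by rw [h]; rfl)]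
    · replace h := (crossingSign_eq_or k).resolve_left h
      rw [next_of_leavesIn lS lE a4 (by rw [h]; rfl), next_of_leavesIn lN lE a1 (by rw [h]; rfl)]
  rw [Equiv.swap_apply_of_ne_of_ne h1 h2, next_update_of_ne v true h1 h2]

lemma circleOf_inEdges (hv : v k = false) :
    D.circleOf v (inEdges k).1 = D.circleOf v (D.edgeN k) ∧
      D.circleOf v (inEdges k).2 = D.circleOf v (D.edgeS k) := by
  have a1 : Arc v k.1.1 k.1.2 .N .E := arc_crossing v k (by rw [hv]; trivial)
  have a2 : Arc v k.1.1 k.1.2 .S .W := arc_crossing v k (by rw [hv]; trivial)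
  unfold inEdges
  split_ifs
  · exact ⟨a1.symm.circleOf_eq (leavesIn_edgeE k) (leavesIn_edgeN k),
      a2.symm.circleOf_eq (leavesIn_edgeW k) (leavesIn_edgeS k)⟩
  · exact ⟨rfl, rfl⟩

lemma circleOf_inEdges_iff_of_true (hv : v k = true) :
    D.circleOf v (inEdges k).1 = D.circleOf v (inEdges k).2 ↔
      D.circleOf v (D.edgeN k) = D.circleOf v (D.edgeS k) := by
  have a3 : Arc v k.1.1 k.1.2 .N .W := arc_crossing v k (by rw [hv]; trivial)
  have a4 : Arc v k.1.1 k.1.2 .S .E := arc_crossing v k (by rw [hv]; trivial)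
  unfold inEdges
  split_ifs
  · rw [a4.symm.circleOf_eq (leavesIn_edgeE k) (leavesIn_edgeS k),
      a3.symm.circleOf_eq (leavesIn_edgeW k) (leavesIn_edgeN k), eq_comm]
  · exact Iff.rfl

/-- The edge `e` lies on a circle of the resolution `v` which meets the crossing `k`. -/
def Touches (v : D.Resolution) (k : D.Crossing) (e : D.Edge) : Prop :=
  D.circleOf v e = D.circleOf v (D.edgeN k) ∨ D.circleOf v e = D.circleOf v (D.edgeS k)

/-- The circles which do not meet a crossing are not affected by changing its resolution. -/
lemma circleOf_update_of_not_touches (hv : v k = false) {e : D.Edge} (he : ¬ Touches v k e)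
    (e' : D.Edge) : D.circleOf (Function.update v k true) e =
      D.circleOf (Function.update v k true) e' ↔ D.circleOf v e = D.circleOf v e' := by
  classical
  have h := circleOf_inEdges hv
  rw [circleOf_eq_iff, circleOf_eq_iff, next_update hv]
  convert sameCycle_mul_swap_of_not (σ := next v) (i := (inEdges k).1) (j := (inEdges k).2) ?_ ?_ e'
  · rw [← circleOf_eq_iff, h.1]; exact fun h' => he (Or.inl h'.symm)
  · rw [← circleOf_eq_iff, h.2]; exact fun h' => he (Or.inr h'.symm)

/-- Two circles which meet at a crossing are merged when its resolution is changed. -/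
lemma circleOf_update_merge (hv : v k = false)
    (h : D.circleOf v (D.edgeN k) ≠ D.circleOf v (D.edgeS k)) :
    D.circleOf (Function.update v k true) (D.edgeN k) =
      D.circleOf (Function.update v k true) (D.edgeS k) := by
  classical
  have h' := circleOf_inEdges hv
  rw [← circleOf_inEdges_iff_of_true (Function.update_self _ _ _), circleOf_eq_iff,
    next_update hv]
  convert sameCycle_mul_swap_of_not_sameCycle (σ := next v) (i := (inEdges k).1)
    (j := (inEdges k).2) ?_
  rw [← circleOf_eq_iff, h'.1, h'.2]
  exact h

/-- A circle which meets a crossing twice is split when its resolution is changed. -/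
lemma circleOf_update_split (hv : v k = false)
    (h : D.circleOf v (D.edgeN k) = D.circleOf v (D.edgeS k)) :
    D.circleOf (Function.update v k true) (D.edgeN k) ≠
      D.circleOf (Function.update v k true) (D.edgeS k) := by
  classical
  have h' := circleOf_inEdges hv
  rw [Ne, ← circleOf_inEdges_iff_of_true (Function.update_self _ _ _), circleOf_eq_iff,
    next_update hv]
  have := not_sameCycle_mul_swap (σ := next v) (inEdges_ne k)
    (by rw [← circleOf_eq_iff, h'.1, h'.2]; exact h)
  convert this

lemma touches_edgeN (v : D.Resolution) (k : D.Crossing) : Touches v k (D.edgeN k) := Or.inl rfl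

lemma touches_edgeS (v : D.Resolution) (k : D.Crossing) : Touches v k (D.edgeS k) := Or.inr rfl

lemma Touches.congr {e e' : D.Edge} (h : D.circleOf v e = D.circleOf v e') :
    Touches v k e ↔ Touches v k e' := by
  unfold Touches; rw [h]

lemma touches_update (hv : v k = false) (e : D.Edge) :
    Touches (Function.update v k true) k e ↔ Touches v k e := by
  constructor
  · intro h
    by_contra he
    rcases h with h | h
    · exact he (Or.inl ((circleOf_update_of_not_touches hv he _).1 h))
    · exact he (Or.inr ((circleOf_update_of_not_touches hv he _).1 h))
  · intro h
    classical
    by_contra hcon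
    -- the inverse surgery does not affect the circle of `e`
    have key : next v =
        next (Function.update v k true) * Equiv.swap (inEdges k).1 (inEdges k).2 := by
      rw [next_update hv, mul_assoc, Equiv.swap_mul_self, mul_one]
    have a3 : Arc (Function.update v k true) k.1.1 k.1.2 .N .W :=
      arc_crossing _ k (by rw [Function.update_self]; trivial)
    have a4 : Arc (Function.update v k true) k.1.1 k.1.2 .S .E :=
      arc_crossing _ k (by rw [Function.update_self]; trivial)
    have hT : ∀ x, x = (inEdges k).1 ∨ x = (inEdges k).2 →
        Touches (Function.update v k true) k x := by
      intro x hx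
      unfold inEdges at hx
      split_ifs at hx
      · rcases hx with rfl | rfl
        · exact Or.inr (a4.symm.circleOf_eq (leavesIn_edgeE k) (leavesIn_edgeS k))
        · exact Or.inl (a3.symm.circleOf_eq (leavesIn_edgeW k) (leavesIn_edgeN k))
      · rcases hx with rfl | rfl
        · exact Or.inl rfl
        · exact Or.inr rfl
    have h1 : ∀ x, D.circleOf v e = D.circleOf v x ↔
        D.circleOf (Function.update v k true) e = D.circleOf (Function.update v k true) x := by
      intro x
      have := sameCycle_mul_swap_of_not (σ := next (Function.update v k true))
        (i := (inEdges k).1) (j := (inEdges k).2) (e := e)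
        (fun h' => hcon ((Touches.congr (circleOf_eq_iff.2 h')).1 (hT _ (Or.inl rfl))))
        (fun h' => hcon ((Touches.congr (circleOf_eq_iff.2 h')).1 (hT _ (Or.inr rfl)))) x
      rwa [← key, ← circleOf_eq_iff, ← circleOf_eq_iff] at this
    exact hcon (h.imp (h1 _).1 (h1 _).1)

lemma circleSum_update_of_not_touches (hv : v k = false) {e : D.Edge} (he : ¬ Touches v k e)
    (G : D.Edge → ℤ) : circleSum (Function.update v k true) e G = circleSum v e G := by
  classical
  unfold circleSum
  refine Finset.sum_congr rfl fun e' _ => ?_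
  have h := circleOf_update_of_not_touches hv he e'
  exact if_congr (eq_comm.trans (h.trans eq_comm)) rfl rfl

lemma circleSum_update_merge (hv : v k = false)
    (h : D.circleOf v (D.edgeN k) ≠ D.circleOf v (D.edgeS k)) (G : D.Edge → ℤ) :
    circleSum (Function.update v k true) (D.edgeN k) G =
      circleSum v (D.edgeN k) G + circleSum v (D.edgeS k) G := by
  classical
  have hm := circleOf_update_merge hv h
  unfold circleSum
  rw [← Finset.sum_add_distrib]
  refine Finset.sum_congr rfl fun e' _ => ?_
  have ht := touches_update hv e'
  unfold Touches at ht
  rw [← hm, or_self] at ht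
  rw [if_congr ht rfl rfl]
  by_cases h1 : D.circleOf v e' = D.circleOf v (D.edgeN k)
  · rw [if_pos (Or.inl h1), if_pos h1, if_neg (by rw [h1]; exact h), add_zero]
  · rw [if_neg h1, zero_add]
    exact if_congr (or_iff_right h1) rfl rfl

lemma circleSum_update_split (hv : v k = false)
    (h : D.circleOf v (D.edgeN k) = D.circleOf v (D.edgeS k)) (G : D.Edge → ℤ) :
    circleSum v (D.edgeN k) G = circleSum (Function.update v k true) (D.edgeN k) G +
      circleSum (Function.update v k true) (D.edgeS k) G := by
  classical
  have hm := circleOf_update_split hv h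
  unfold circleSum
  rw [← Finset.sum_add_distrib]
  refine Finset.sum_congr rfl fun e' _ => ?_
  have ht := touches_update hv e'
  unfold Touches at ht
  rw [← h, or_self] at ht
  rw [if_congr ht.symm rfl rfl]
  by_cases h1 : D.circleOf (Function.update v k true) e' =
      D.circleOf (Function.update v k true) (D.edgeN k)
  · rw [if_pos (Or.inl h1), if_pos h1, if_neg (by rw [h1]; exact hm), add_zero]
  · rw [if_neg h1, zero_add]
    exact if_congr (or_iff_right h1) rfl rfl

/-- Among the arcs of the two resolutions of a crossing, the only one which contributes to the
turning number is an arc of the `1`-resolution. -/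
lemma turnAfter_update (hv : v k = false) (e : D.Edge) :
    turnAfter (Function.update v k true) e =
      turnAfter v e + if e = (inEdges k).2 then crossingSign k else 0 := by
  have hv' : Function.update v k true k = true := Function.update_self _ _ _
  have a1 : Arc v k.1.1 k.1.2 .N .E := arc_crossing v k (by rw [hv]; trivial)
  have a2 : Arc v k.1.1 k.1.2 .S .W := arc_crossing v k (by rw [hv]; trivial)
  have a3 : Arc (Function.update v k true) k.1.1 k.1.2 .N .W :=
    arc_crossing _ k (by rw [hv']; trivial)
  have a4 : Arc (Function.update v k true) k.1.1 k.1.2 .S .E :=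
    arc_crossing _ k (by rw [hv']; trivial)
  have lN := leavesIn_edgeN k
  have lE := leavesIn_edgeE k
  have lS := leavesIn_edgeS k
  have lW := leavesIn_edgeW k
  have hN := checkerSign_mul_sgn_crossing k lN
  have hE := checkerSign_mul_sgn_crossing k lE
  have hS := checkerSign_mul_sgn_crossing k lS
  have hW := checkerSign_mul_sgn_crossing k lW
  unfold turnAfter
  have hne := inEdges_ne k
  by_cases h1 : e = (inEdges k).1
  · rw [if_neg (h1 ▸ hne), h1]
    unfold inEdges
    split_ifs with h
    · rw [h] at hN hE hS hW
      rw [next_of_leavesIn lE lS a4.symm (by rw [h]; rfl),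
        next_of_leavesIn lE lN a1.symm (by rw [h]; rfl), heading_of_in lE hE,
        heading_of_out lS hS, heading_of_out lN hN]
      rfl
    · replace h := (crossingSign_eq_or k).resolve_left h
      rw [h] at hN hE hS hW
      rw [next_of_leavesIn lN lW a3 (by rw [h]; rfl), next_of_leavesIn lN lE a1 (by rw [h]; rfl),
        heading_of_in lN hN, heading_of_out lW hW, heading_of_out lE hE]
      rfl
  by_cases h2 : e = (inEdges k).2
  · rw [if_pos h2, h2]
    unfold inEdges
    split_ifs with h
    · rw [h] at hN hE hS hW
      rw [next_of_leavesIn lW lN a3.symm (by rw [h]; rfl),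
        next_of_leavesIn lW lS a2.symm (by rw [h]; rfl), heading_of_in lW hW,
        heading_of_out lS hS, heading_of_out lN hN, h]
      rfl
    · replace h := (crossingSign_eq_or k).resolve_left h
      rw [h] at hN hE hS hW
      rw [next_of_leavesIn lS lE a4 (by rw [h]; rfl), next_of_leavesIn lS lW a2 (by rw [h]; rfl),
        heading_of_in lS hS, heading_of_out lW hW, heading_of_out lE hE, h]
      rfl
  rw [next_update_of_ne v true h1 h2, if_neg h2, add_zero]

lemma area_update_of_not_touches (hv : v k = false) {e : D.Edge} (he : ¬ Touches v k e) :
    area (Function.update v k true) e = area v e := circleSum_update_of_not_touches hv he _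

lemma circleSign_update_of_not_touches (hv : v k = false) {e : D.Edge} (he : ¬ Touches v k e) :
    circleSign (Function.update v k true) e = circleSign v e := by
  unfold circleSign; rw [area_update_of_not_touches hv he]

lemma area_update_merge (hv : v k = false)
    (h : D.circleOf v (D.edgeN k) ≠ D.circleOf v (D.edgeS k)) :
    area (Function.update v k true) (D.edgeN k) = area v (D.edgeN k) + area v (D.edgeS k) :=
  circleSum_update_merge hv h _

lemma area_update_split (hv : v k = false)
    (h : D.circleOf v (D.edgeN k) = D.circleOf v (D.edgeS k)) :
    area v (D.edgeN k) = area (Function.update v k true) (D.edgeN k) +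
      area (Function.update v k true) (D.edgeS k) :=
  circleSum_update_split hv h _

lemma circleSum_turnAfter_update (hv : v k = false) (w : D.Resolution) {e : D.Edge}
    (he : D.circleOf w (inEdges k).2 = D.circleOf w e) :
    circleSum w e (turnAfter (Function.update v k true)) =
      circleSum w e (turnAfter v) + crossingSign k := by
  classical
  unfold circleSum
  have : crossingSign k = ∑ e', if e' = (inEdges k).2 then crossingSign k else 0 := by simp
  rw [this, ← Finset.sum_add_distrib]
  refine Finset.sum_congr rfl fun e' _ => ?_
  rw [turnAfter_update hv]
  by_cases h : e' = (inEdges k).2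
  · subst h; simp [he]
  · simp [h]

/-- By the Umlaufsatz, when two circles are merged the signs add up to the sign of the new
circle, with a correction which depends only on the crossing. -/
lemma circleSign_update_merge (hv : v k = false)
    (h : D.circleOf v (D.edgeN k) ≠ D.circleOf v (D.edgeS k)) :
    circleSign (Function.update v k true) (D.edgeN k) =
      circleSign v (D.edgeN k) + circleSign v (D.edgeS k) + crossingSign k := by
  have hm := circleOf_update_merge hv h
  have ht := (touches_update hv (inEdges k).2).2 (Or.inr (circleOf_inEdges hv).2)
  unfold Touches at ht
  rw [← hm, or_self] at ht
  rw [← circleSum_turnAfter, circleSum_turnAfter_update hv _ ht, circleSum_update_merge hv h,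
    circleSum_turnAfter, circleSum_turnAfter]

lemma circleSign_update_split (hv : v k = false)
    (h : D.circleOf v (D.edgeN k) = D.circleOf v (D.edgeS k)) :
    circleSign (Function.update v k true) (D.edgeN k) +
      circleSign (Function.update v k true) (D.edgeS k) =
      circleSign v (D.edgeN k) + crossingSign k := by
  rw [← circleSum_turnAfter, ← circleSum_turnAfter, ← circleSum_update_split hv h,
    circleSum_turnAfter_update hv _ ((circleOf_inEdges hv).2.trans h.symm), circleSum_turnAfter]

end GridDiagram

/-! ### The Khovanov differential -/

namespace GridDiagram

variable {n : ℕ} {D : GridDiagram n}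

lemma khD_single (s t : D.EnhancedState) : D.khD (Finsupp.single s 1) t = D.khCoeff s t := by
  simp [khD]

lemma exists_khStep_of_khD_ne_zero {s t : D.EnhancedState}
    (h : D.khD (Finsupp.single s 1) t ≠ 0) : ∃ k, D.KhStep k s t := by
  classical
  rw [khD_single, khCoeff] at h
  obtain ⟨k, -, hk⟩ := Finset.exists_ne_zero_of_sum_ne_zero h
  exact ⟨k, by by_contra hn; exact hk (if_neg hn)⟩

lemma height_update {v : D.Resolution} {k : D.Crossing} (hv : v k = false) :
    D.height (Function.update v k true) = D.height v + 1 := by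
  unfold height
  rw [← Finset.add_sum_erase _ _ (Finset.mem_univ k), ← Finset.add_sum_erase _
    (fun k => if v k then (1 : ℤ) else 0) (Finset.mem_univ k)]
  simp only [Function.update_self, hv, if_true]
  rw [Finset.sum_congr rfl (g := fun k => if v k then (1 : ℤ) else 0)]
  · simp; ring
  · intro l hl
    rw [Function.update_of_ne (Finset.ne_of_mem_erase hl)]

/-- By the Umlaufsatz, a sum over the circles of a resolution is a sum over edges. -/
lemma sum_circles (v : D.Resolution) (g : D.Circle v → ℤ) :
    ∑ C, g C = ∑ e, g (D.circleOf v e) * circleSign v e * turnAfter v e := by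
  classical
  have h : ∀ e, g (D.circleOf v e) * circleSign v e * turnAfter v e =
      ∑ C, if D.circleOf v e = C then g C * circleSign v e * turnAfter v e else 0 := by
    intro e; simp
  rw [Finset.sum_congr rfl fun e _ => h e, Finset.sum_comm]
  refine Finset.sum_congr rfl fun C _ => ?_
  obtain ⟨e₀, rfl⟩ := Quot.exists_rep C
  change g (D.circleOf v e₀) = _
  trans g (D.circleOf v e₀) * circleSign v e₀ * circleSum v e₀ (turnAfter v)
  · rw [circleSum_turnAfter, mul_assoc, circleSign_sq, mul_one]
  · unfold circleSum
    rw [Finset.mul_sum]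
    refine Finset.sum_congr rfl fun e _ => ?_
    by_cases h : D.circleOf v e = D.circleOf v e₀
    · rw [if_pos h, if_pos (show D.circleOf v e = Quot.mk _ e₀ from h), circleSign_congr h]
    · rw [if_neg h, if_neg (show ¬ D.circleOf v e = Quot.mk _ e₀ from h), mul_zero]

open Classical in
/-- A sum over the circles of a resolution, split according to whether they meet a crossing. -/
lemma sum_circles_touches (v : D.Resolution) (k : D.Crossing) (g : D.Circle v → ℤ) :
    ∑ C, g C = g (D.circleOf v (D.edgeN k)) +
      (if D.circleOf v (D.edgeN k) = D.circleOf v (D.edgeS k) then 0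
        else g (D.circleOf v (D.edgeS k))) +
      ∑ e, if Touches v k e then 0
        else g (D.circleOf v e) * circleSign v e * turnAfter v e := by
  have h := sum_circles v fun C => if C = D.circleOf v (D.edgeN k) ∨ C = D.circleOf v (D.edgeS k)
    then 0 else g C
  have h1 : (∑ e, if Touches v k e then 0
        else g (D.circleOf v e) * circleSign v e * turnAfter v e) =
      ∑ e, (if D.circleOf v e = D.circleOf v (D.edgeN k) ∨
        D.circleOf v e = D.circleOf v (D.edgeS k) then 0 else g (D.circleOf v e)) *
        circleSign v e * turnAfter v e := by
    refine Finset.sum_congr rfl fun e _ => ?_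
    unfold Touches
    split_ifs <;> simp
  rw [h1, ← h]
  have h2 : ∀ C : D.Circle v, g C = ((if C = D.circleOf v (D.edgeN k) then g C else 0) +
      (if D.circleOf v (D.edgeN k) = D.circleOf v (D.edgeS k) then 0
        else if C = D.circleOf v (D.edgeS k) then g C else 0)) +
      if C = D.circleOf v (D.edgeN k) ∨ C = D.circleOf v (D.edgeS k) then 0 else g C := by
    intro C
    by_cases hN : C = D.circleOf v (D.edgeN k)
    · by_cases hS : C = D.circleOf v (D.edgeS k)
      · simp [hN, hN.symm.trans hS]
      · simp [hN, hN ▸ hS]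
    · by_cases hS : C = D.circleOf v (D.edgeS k)
      · rw [if_neg hN, if_neg (fun h => hN (hS.trans h.symm)), if_pos hS, if_pos (Or.inr hS)]
        ring
      · simp [hN, hS]
  conv_lhs => rw [Finset.sum_congr rfl fun C _ => h2 C]
  rw [Finset.sum_add_distrib, Finset.sum_add_distrib]
  congr 2
  · simp
  · split_ifs
    · simp
    · simp

lemma sum_not_touches_update {v : D.Resolution} {k : D.Crossing} (hv : v k = false)
    (f f' : D.Edge → ℤ) (hf : ∀ e, ¬ Touches v k e → f' e = f e) :
    (open Classical in ∑ e, if Touches (Function.update v k true) k e then 0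
      else f' e * circleSign (Function.update v k true) e *
        turnAfter (Function.update v k true) e) =
    open Classical in ∑ e, if Touches v k e then 0
      else f e * circleSign v e * turnAfter v e := by
  classical
  refine Finset.sum_congr rfl fun e _ => ?_
  rw [if_congr (touches_update hv e) rfl rfl]
  split_ifs with h
  · rfl
  · have hne : e ≠ (inEdges k).2 := by
      rintro rfl
      exact h (Or.inr (circleOf_inEdges hv).2)
    rw [hf e h, circleSign_update_of_not_touches hv h, turnAfter_update hv, if_neg hne, add_zero]

/-- The number of circles decreases by one when two circles are merged, and increases by one when
a circle is split. -/
lemma card_circle_update {v : D.Resolution} {k : D.Crossing} (hv : v k = false) :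
    (Fintype.card (D.Circle (Function.update v k true)) : ℤ) = Fintype.card (D.Circle v) +
      open Classical in
      if D.circleOf v (D.edgeN k) = D.circleOf v (D.edgeS k) then 1 else -1 := by
  classical
  have h1 := sum_circles_touches v k fun _ => 1
  have h2 := sum_circles_touches (Function.update v k true) k fun _ => 1
  rw [sum_not_touches_update hv (fun _ => 1) (fun _ => 1) fun _ _ => rfl] at h2
  simp only [Finset.sum_const, Finset.card_univ, nsmul_eq_mul, mul_one] at h1 h2
  rw [h1, h2]
  by_cases h : D.circleOf v (D.edgeN k) = D.circleOf v (D.edgeS k)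
  · rw [if_neg (circleOf_update_split hv h), if_pos h, if_pos h]; ring
  · rw [if_pos (circleOf_update_merge hv h), if_neg h, if_neg h]; ring

lemma khI_of_khStep {k : D.Crossing} {s t : D.EnhancedState} (h : D.KhStep k s t) :
    D.khI t = D.khI s + 1 := by
  unfold khI
  rw [h.2.1, height_update h.1]
  ring

lemma khJ_of_khStep {k : D.Crossing} {s t : D.EnhancedState} (h : D.KhStep k s t) :
    D.khJ t = D.khJ s := by
  classical
  obtain ⟨v, l⟩ := s
  obtain ⟨v', l'⟩ := t
  obtain ⟨h1, h2, h3, h4⟩ := h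
  simp only at h1 h2
  subst h2
  unfold khJ
  simp only
  rw [height_update h1]
  have e1 := sum_circles_touches v k fun C => if l C then 1 else -1
  have e2 := sum_circles_touches _ k fun C => if l' C then 1 else -1
  rw [sum_not_touches_update h1 (fun e => if l (D.circleOf v e) then 1 else -1)
    (fun e => if l' (D.circleOf _ e) then 1 else -1)] at e2
  · rw [e1, e2]
    simp only [label] at h4
    by_cases h : D.circleOf v (D.edgeN k) = D.circleOf v (D.edgeS k)
    · rw [if_neg (circleOf_update_split h1 h), if_pos h]
      rw [if_pos h] at h4
      unfold ComulRule at h4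
      revert h4
      cases l (D.circleOf v (D.edgeN k)) <;> cases l' (D.circleOf _ (D.edgeN k)) <;>
        cases l' (D.circleOf _ (D.edgeS k)) <;> simp <;> ring
    · rw [if_pos (circleOf_update_merge h1 h), if_neg h]
      rw [if_neg h] at h4
      unfold MulRule at h4
      revert h4
      cases l (D.circleOf v (D.edgeN k)) <;> cases l (D.circleOf v (D.edgeS k)) <;>
        cases l' (D.circleOf _ (D.edgeN k)) <;> simp <;> ring
  · intro e he
    have := h3 e (fun h => he (Or.inl h)) fun h => he (Or.inr h)
    simp only [label] at this
    rw [this]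

lemma hasBidegree_khD : HasBidegree D.khI D.khJ D.khI D.khJ D.khD 1 0 := by
  rw [hasBidegree_iff]
  intro s t h
  obtain ⟨k, hk⟩ := exists_khStep_of_khD_ne_zero h
  exact ⟨khI_of_khStep hk, by rw [khJ_of_khStep hk, add_zero]⟩

lemma EnhancedState.ext_label {s t : D.EnhancedState} (h : s.1 = t.1)
    (h' : ∀ e, D.label s e = D.label t e) : s = t := by
  obtain ⟨v, l⟩ := s
  obtain ⟨v', l'⟩ := t
  simp only at h
  subst h
  congr 1
  funext C
  obtain ⟨e, rfl⟩ := Quot.exists_rep C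
  exact h' e

lemma label_congr {s : D.EnhancedState} {e e' : D.Edge}
    (h : D.circleOf s.1 e = D.circleOf s.1 e') : D.label s e = D.label s e' := by
  unfold label; rw [h]

open Classical in
/-- The enhanced state obtained by changing the label of the circle through `e`. -/
def setLabel (s : D.EnhancedState) (e : D.Edge) (b : Bool) : D.EnhancedState :=
  ⟨s.1, Function.update s.2 (D.circleOf s.1 e) b⟩

open Classical in
lemma label_setLabel (s : D.EnhancedState) (e e' : D.Edge) (b : Bool) :
    D.label (setLabel s e b) e' =
      if D.circleOf s.1 e' = D.circleOf s.1 e then b else D.label s e' := by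
  simp [setLabel, label, Function.update_apply]

open Classical in
lemma label_setLabel_of_eq {s : D.EnhancedState} {v : D.Resolution} (h : s.1 = v) (e e' : D.Edge)
    (b : Bool) : D.label (setLabel s e b) e' =
      if D.circleOf v e' = D.circleOf v e then b else D.label s e' := by
  subst h
  exact label_setLabel s e e' b

lemma setLabel_setLabel (s : D.EnhancedState) (e : D.Edge) (b b' : Bool) :
    setLabel (setLabel s e b) e b' = setLabel s e b' := by
  refine EnhancedState.ext_label rfl fun e' => ?_
  rw [label_setLabel, label_setLabel, label_setLabel]
  simp only [setLabel]
  split_ifs with h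
  · simp [h]
  · simp [h]

lemma setLabel_label (s : D.EnhancedState) (e : D.Edge) : setLabel s e (D.label s e) = s := by
  refine EnhancedState.ext_label rfl fun e' => ?_
  rw [label_setLabel]
  split_ifs with h
  · exact (label_congr h).symm
  · rfl

/-- The edge map of the cube of resolutions at a crossing, without signs. -/
def khMap (k : D.Crossing) : Module.End ℤ (D.EnhancedState →₀ ℤ) :=
  Finsupp.linearCombination ℤ fun s =>
    Finsupp.equivFunOnFinite.symm fun t => open Classical in if D.KhStep k s t then 1 else 0

/-- Multiplication by `x` on the tensor factor of the circle through `e`. -/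
def mulX (e : D.Edge) : Module.End ℤ (D.EnhancedState →₀ ℤ) :=
  Finsupp.linearCombination ℤ fun s =>
    if D.label s e = true then Finsupp.single (setLabel s e false) 1 else 0

open Classical in
lemma khMap_single (k : D.Crossing) (s t : D.EnhancedState) :
    khMap k (Finsupp.single s 1) t = if D.KhStep k s t then 1 else 0 := by
  simp [khMap]

lemma mulX_single (e : D.Edge) (s : D.EnhancedState) : mulX e (Finsupp.single s 1) =
    if D.label s e = true then Finsupp.single (setLabel s e false) 1 else 0 := by
  simp [mulX]

lemma mulX_apply (e : D.Edge) (x : D.EnhancedState →₀ ℤ) (t : D.EnhancedState) :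
    mulX e x t = if D.label t e = false then x (setLabel t e true) else 0 := by
  classical
  induction x using Finsupp.induction_linear with
  | zero => simp
  | add x y hx hy =>
    rw [map_add, Finsupp.add_apply, hx, hy]
    split_ifs <;> simp
  | single s b =>
    rw [show Finsupp.single s b = b • Finsupp.single s 1 by simp, map_smul, mulX_single,
      Finsupp.smul_apply, Finsupp.smul_apply]
    have key : (D.label s e = true ∧ setLabel s e false = t) ↔
        (D.label t e = false ∧ s = setLabel t e true) := by
      constructor
      · rintro ⟨h, rfl⟩
        refine ⟨by rw [label_setLabel, if_pos rfl], ?_⟩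
        rw [setLabel_setLabel, ← h, setLabel_label]
      · rintro ⟨h, rfl⟩
        refine ⟨by rw [label_setLabel, if_pos rfl], ?_⟩
        rw [setLabel_setLabel, ← h, setLabel_label]
    by_cases h : D.label s e = true
    · rw [if_pos h, Finsupp.single_apply]
      by_cases h' : D.label t e = false
      · rw [if_pos h', Finsupp.single_apply]
        by_cases h'' : setLabel s e false = t
        · rw [if_pos h'', if_pos (key.1 ⟨h, h''⟩).2]
        · rw [if_neg h'', if_neg fun hc => h'' (key.2 ⟨h', hc⟩).2]
      · rw [if_neg h', if_neg fun hc => h' (key.1 ⟨h, hc⟩).1]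
        simp
    · rw [if_neg h]
      by_cases h' : D.label t e = false
      · rw [if_pos h', Finsupp.single_apply, if_neg fun hc => h (key.2 ⟨h', hc⟩).1]
        simp
      · rw [if_neg h']; simp

/-- The edge maps commute with multiplication by `x`. -/
lemma khStep_setLabel (k : D.Crossing) (s t : D.EnhancedState) (e : D.Edge) :
    (D.label s e = true ∧ D.KhStep k (setLabel s e false) t) ↔
      (D.label t e = false ∧ D.KhStep k s (setLabel t e true)) := by
  classical
  by_cases hvt : s.1 k = false ∧ t.1 = Function.update s.1 k true
  swap
  · exact ⟨fun h => absurd ⟨h.2.1, h.2.2.1⟩ hvt, fun h => absurd ⟨h.2.1, h.2.2.1⟩ hvt⟩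
  obtain ⟨hv, ht⟩ := hvt
  unfold KhStep
  rw [show (setLabel s e false).1 = s.1 from rfl, show (setLabel t e true).1 = t.1 from rfl]
  simp only [hv, ht, true_and, label_setLabel_of_eq ht, label_setLabel s]
  have hunt := fun {e : D.Edge} (he : ¬ Touches s.1 k e) => circleOf_update_of_not_touches hv he
  have htou := touches_update hv e
  by_cases he : Touches s.1 k e
  · -- the labels of the circles away from the crossing are not involved
    have hcomm : (∀ e' : D.Edge, D.circleOf s.1 e' ≠ D.circleOf s.1 (D.edgeN k) →
        D.circleOf s.1 e' ≠ D.circleOf s.1 (D.edgeS k) → D.label t e' =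
          if D.circleOf s.1 e' = D.circleOf s.1 e then false else D.label s e') ↔
        (∀ e' : D.Edge, D.circleOf s.1 e' ≠ D.circleOf s.1 (D.edgeN k) →
          D.circleOf s.1 e' ≠ D.circleOf s.1 (D.edgeS k) →
          (if D.circleOf (Function.update s.1 k true) e' =
            D.circleOf (Function.update s.1 k true) e then true else D.label t e') =
            D.label s e') := by
      refine forall_congr' fun e' => forall_congr' fun h1 => forall_congr' fun h2 => ?_
      have h3 : ¬ Touches s.1 k e' := fun h => h.elim h1 h2
      have h4 : D.circleOf s.1 e' ≠ D.circleOf s.1 e := fun h => h3 ((Touches.congr h).2 he)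
      rw [if_neg h4, if_neg (fun h => h4 ((hunt h3 e).1 h))]
    rw [hcomm, and_left_comm, and_left_comm (a := D.label t e = false)]
    refine and_congr_right fun _ => ?_
    have he' := htou.2 he
    have hst : ∀ {e'}, D.circleOf s.1 e = D.circleOf s.1 e' → D.label s e = D.label s e' :=
      fun h => label_congr h
    have htt : ∀ {e'}, D.circleOf (Function.update s.1 k true) e =
        D.circleOf (Function.update s.1 k true) e' → D.label t e = D.label t e' :=
      fun h => label_congr (by rw [ht]; exact h)
    by_cases hNS : D.circleOf s.1 (D.edgeN k) = D.circleOf s.1 (D.edgeS k)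
    · have hsp := circleOf_update_split hv hNS
      have hN : D.circleOf s.1 e = D.circleOf s.1 (D.edgeN k) := he.elim id fun h => h.trans hNS.symm
      rw [if_pos hNS, if_pos hNS, if_pos hN.symm, hst hN]
      rcases he' with h | h
      · rw [if_pos h.symm, if_neg (fun h' => hsp (h.symm.trans h'.symm)), htt h]
        unfold ComulRule
        cases D.label s (D.edgeN k) <;> cases D.label t (D.edgeN k) <;>
          cases D.label t (D.edgeS k) <;> simp
      · rw [if_pos h.symm, if_neg (fun h' => hsp (h'.trans h)), htt h]
        unfold ComulRule
        cases D.label s (D.edgeN k) <;> cases D.label t (D.edgeN k) <;>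
          cases D.label t (D.edgeS k) <;> simp
    · have hme := circleOf_update_merge hv hNS
      have hN : D.circleOf (Function.update s.1 k true) e =
        D.circleOf (Function.update s.1 k true) (D.edgeN k) := he'.elim id fun h => h.trans hme.symm
      rw [if_neg hNS, if_neg hNS, if_pos hN.symm, htt hN]
      rcases he with h | h
      · rw [if_pos h.symm, if_neg (fun h' => hNS (h.symm.trans h'.symm)), hst h]
        unfold MulRule
        cases D.label s (D.edgeN k) <;> cases D.label t (D.edgeN k) <;>
          cases D.label s (D.edgeS k) <;> simp
      · rw [if_pos h.symm, if_neg (fun h' => hNS (h'.trans h)), hst h]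
        unfold MulRule
        cases D.label s (D.edgeN k) <;> cases D.label t (D.edgeN k) <;>
          cases D.label s (D.edgeS k) <;> simp
  · have he' := fun h => he (htou.1 h)
    have n1 : D.circleOf s.1 (D.edgeN k) ≠ D.circleOf s.1 e := fun h => he (Or.inl h.symm)
    have n2 : D.circleOf s.1 (D.edgeS k) ≠ D.circleOf s.1 e := fun h => he (Or.inr h.symm)
    have n3 : D.circleOf (Function.update s.1 k true) (D.edgeN k) ≠
      D.circleOf (Function.update s.1 k true) e := fun h => he' (Or.inl h.symm)
    have n4 : D.circleOf (Function.update s.1 k true) (D.edgeS k) ≠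
      D.circleOf (Function.update s.1 k true) e := fun h => he' (Or.inr h.symm)
    simp only [if_neg n1, if_neg n2, if_neg n3, if_neg n4]
    rw [← and_assoc, ← and_assoc]
    refine and_congr_left fun _ => ?_
    have hiff : ∀ e', D.circleOf (Function.update s.1 k true) e' =
        D.circleOf (Function.update s.1 k true) e ↔ D.circleOf s.1 e' = D.circleOf s.1 e :=
      fun e' => eq_comm.trans ((hunt he e').trans eq_comm)
    have hst : ∀ {e'}, D.circleOf s.1 e' = D.circleOf s.1 e → D.label s e' = D.label s e :=
      fun h => label_congr h
    have htt : ∀ {e'}, D.circleOf s.1 e' = D.circleOf s.1 e → D.label t e' = D.label t e :=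
      fun h => label_congr (by rw [ht]; exact (hiff _).2 h)
    constructor
    · rintro ⟨h1, h2⟩
      have h3 := h2 e n1.symm n2.symm
      rw [if_pos rfl] at h3
      refine ⟨h3, fun e' m1 m2 => ?_⟩
      have := h2 e' m1 m2
      rw [if_congr (hiff e') rfl rfl]
      split_ifs with h
      · rw [hst h, h1]
      · rwa [if_neg h] at this
    · rintro ⟨h1, h2⟩
      have h3 := h2 e n1.symm n2.symm
      rw [if_pos rfl] at h3
      refine ⟨h3.symm, fun e' m1 m2 => ?_⟩
      have := h2 e' m1 m2
      rw [if_congr (hiff e') rfl rfl] at this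
      split_ifs with h
      · rw [htt h, h1]
      · rwa [if_neg h] at this

lemma khMap_mulX (k : D.Crossing) (e : D.Edge) : Commute (khMap k) (mulX e) := by
  classical
  refine Finsupp.lhom_ext fun s b => ?_
  rw [show Finsupp.single s b = b • Finsupp.single s 1 by simp, map_smul, map_smul]
  congr 1
  ext t
  rw [Module.End.mul_apply, Module.End.mul_apply, mulX_apply, mulX_single, khMap_single]
  have key := khStep_setLabel k s t e
  by_cases h : D.label s e = true
  · rw [if_pos h, khMap_single]
    by_cases h' : D.label t e = false
    · rw [if_pos h']
      exact if_congr ⟨fun a => (key.1 ⟨h, a⟩).2, fun a => (key.2 ⟨h', a⟩).2⟩ rfl rfl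
    · rw [if_neg h', if_neg fun a => h' (key.1 ⟨h, a⟩).1]
  · rw [if_neg h]
    by_cases h' : D.label t e = false
    · rw [if_pos h', if_neg fun a => h (key.2 ⟨h', a⟩).1]; simp
    · rw [if_neg h']; simp

/-- The state of the resolution `v` with all labels equal to `1`. -/
def oneState (v : D.Resolution) : D.EnhancedState := ⟨v, fun _ => true⟩

lemma label_oneState (v : D.Resolution) (e : D.Edge) : D.label (oneState v) e = true := rfl

/-- The states with all labels equal to `1` generate the Khovanov complex under multiplication
by `x`. -/
lemma ext_of_commute_mulX {f g : Module.End ℤ (D.EnhancedState →₀ ℤ)}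
    (hf : ∀ e, Commute f (mulX e)) (hg : ∀ e, Commute g (mulX e))
    (h : ∀ v, f (Finsupp.single (oneState v) 1) = g (Finsupp.single (oneState v) 1)) : f = g := by
  classical
  refine Finsupp.lhom_ext fun s b => ?_
  rw [show Finsupp.single s b = b • Finsupp.single s 1 by simp, map_smul, map_smul]
  congr 1
  clear b
  induction hm : (Finset.univ.filter fun e => D.label s e = false).card using
    Nat.strong_induction_on generalizing s with
  | _ m ih =>
  by_cases hs : ∀ e, D.label s e = true
  · rw [show s = oneState s.1 from EnhancedState.ext_label rfl fun e => hs e]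
    exact h _
  · push Not at hs
    obtain ⟨e, he⟩ := hs
    replace he : D.label s e = false := Bool.eq_false_of_not_eq_true he
    have hse : Finsupp.single s 1 = mulX e (Finsupp.single (setLabel s e true) (1 : ℤ)) := by
      rw [mulX_single, if_pos (by rw [label_setLabel, if_pos rfl]), setLabel_setLabel, ← he,
        setLabel_label]
    have hlt : (Finset.univ.filter fun e' => D.label (setLabel s e true) e' = false).card < m := by
      rw [← hm]
      refine Finset.card_lt_card ⟨fun e' h' => ?_, fun hsub => ?_⟩
      · simp only [Finset.mem_filter, Finset.mem_univ, true_and, label_setLabel] at h' ⊢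
        split_ifs at h'
        exact h'
      · have := hsub (show e ∈ _ by simpa using he)
        simp [label_setLabel] at this
    rw [hse, ← Module.End.mul_apply, ← Module.End.mul_apply, (hf e).eq, (hg e).eq,
      Module.End.mul_apply, Module.End.mul_apply, ih _ hlt _ rfl]

lemma mulX_commute (e e' : D.Edge) : Commute (mulX e) (mulX e') := by
  classical
  refine Finsupp.lhom_ext fun s b => ?_
  rw [show Finsupp.single s b = b • Finsupp.single s 1 by simp, map_smul, map_smul]
  congr 1
  ext t
  rw [Module.End.mul_apply, Module.End.mul_apply, mulX_apply, mulX_apply, mulX_apply, mulX_apply]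
  by_cases h : D.circleOf t.1 e' = D.circleOf t.1 e
  · simp only [label_setLabel, h, if_true]
    simp
  · simp only [label_setLabel]
    rw [if_neg h, if_neg (Ne.symm h)]
    have : setLabel (setLabel t e true) e' true = setLabel (setLabel t e' true) e true := by
      refine EnhancedState.ext_label rfl fun x => ?_
      rw [label_setLabel_of_eq (s := setLabel t e true) (v := t.1) rfl, label_setLabel,
        label_setLabel_of_eq (s := setLabel t e' true) (v := t.1) rfl, label_setLabel]
      split_ifs <;> rfl
    rw [this]
    split_ifs <;> rfl

lemma mulX_oneState_congr {v : D.Resolution} {e e' : D.Edge}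
    (h : D.circleOf v e = D.circleOf v e') :
    mulX e (Finsupp.single (oneState v) 1) = mulX e' (Finsupp.single (oneState v) 1) := by
  classical
  rw [mulX_single, mulX_single, if_pos (label_oneState v e), if_pos (label_oneState v e')]
  congr 1
  refine EnhancedState.ext_label rfl fun x => ?_
  rw [label_setLabel, label_setLabel]
  exact if_congr (by rw [show (oneState v).1 = v from rfl, h]) rfl rfl

lemma khMap_single_eq_zero {k : D.Crossing} {s : D.EnhancedState} (h : s.1 k = true) :
    khMap k (Finsupp.single s 1) = 0 := by
  classical
  ext t
  rw [khMap_single, if_neg fun h' => by rw [h'.1] at h; exact absurd h (by simp)]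
  rfl

lemma khMap_oneState_merge {k : D.Crossing} {v : D.Resolution} (hv : v k = false)
    (h : D.circleOf v (D.edgeN k) ≠ D.circleOf v (D.edgeS k)) :
    khMap k (Finsupp.single (oneState v) 1) =
      Finsupp.single (oneState (Function.update v k true)) 1 := by
  classical
  ext t
  rw [khMap_single, Finsupp.single_apply]
  refine if_congr ⟨fun ht => ?_, ?_⟩ rfl rfl
  · obtain ⟨h1, h2, h3, h4⟩ := ht
    refine (EnhancedState.ext_label h2 fun e => ?_).symm
    rw [if_neg (show ¬ D.circleOf (oneState v).1 (D.edgeN k) = D.circleOf (oneState v).1 (D.edgeS k) from h)] at h4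
    by_cases he : Touches v k e
    · have he' := (touches_update hv e).2 he
      unfold Touches at he'
      rw [← circleOf_update_merge hv h, or_self] at he'
      rw [label_congr (show D.circleOf t.1 e = D.circleOf t.1 (D.edgeN k) by rw [h2]; exact he'), h4.2]
      rfl
    · exact h3 e (fun h => he (Or.inl h)) fun h => he (Or.inr h)
  · rintro rfl
    refine ⟨hv, rfl, fun _ _ _ => rfl, ?_⟩
    rw [if_neg (show ¬ D.circleOf (oneState v).1 (D.edgeN k) = D.circleOf (oneState v).1 (D.edgeS k) from h)]
    exact ⟨rfl, rfl⟩

lemma khMap_oneState_split {k : D.Crossing} {v : D.Resolution} (hv : v k = false)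
    (h : D.circleOf v (D.edgeN k) = D.circleOf v (D.edgeS k)) :
    khMap k (Finsupp.single (oneState v) 1) = (mulX (D.edgeN k) + mulX (D.edgeS k))
      (Finsupp.single (oneState (Function.update v k true)) 1) := by
  classical
  have hsp := circleOf_update_split hv h
  ext t
  rw [khMap_single, LinearMap.add_apply, mulX_single, mulX_single, if_pos (label_oneState _ _),
    if_pos (label_oneState _ _), Finsupp.add_apply, Finsupp.single_apply, Finsupp.single_apply]
  set v' := Function.update v k true with hv'
  have hne : setLabel (oneState v') (D.edgeN k) false ≠ setLabel (oneState v') (D.edgeS k) false := by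
    intro hc
    have := congrArg (fun s => D.label s (D.edgeN k)) hc
    rw [label_setLabel_of_eq (v := v') rfl, label_setLabel_of_eq (v := v') rfl, if_pos rfl,
      if_neg hsp] at this
    exact absurd this (by simp [label_oneState])
  have key : D.KhStep k (oneState v) t ↔ (setLabel (oneState v') (D.edgeN k) false = t ∨
      setLabel (oneState v') (D.edgeS k) false = t) := by
    constructor
    · rintro ⟨h1, h2, h3, h4⟩
      rw [if_pos (show D.circleOf (oneState v).1 (D.edgeN k) = D.circleOf (oneState v).1 (D.edgeS k) from h)] at h4
      have h2' : t.1 = v' := h2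
      have hcase : D.label t (D.edgeN k) ≠ D.label t (D.edgeS k) := by
        rcases h4 with h4 | h4
        · exact h4.2
        · exact absurd h4.1 (by simp [label_oneState])
      have hout : ∀ e, ¬ Touches v k e → D.label t e = true := fun e he =>
        h3 e (fun h => he (Or.inl h)) fun h => he (Or.inr h)
      have hgen : ∀ x y : D.Edge, D.label t x = false → D.label t y = true →
          (∀ e, Touches v k e → D.circleOf v' e = D.circleOf v' x ∨
            D.circleOf v' e = D.circleOf v' y) → Touches v k x →
          setLabel (oneState v') x false = t := by
        intro x y hx hy hxy htx
        refine EnhancedState.ext_label h2'.symm fun e => ?_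
        rw [label_setLabel]
        split_ifs with hex
        · rw [← hx]
          exact label_congr (by rw [h2']; exact hex.symm)
        · rw [label_oneState]
          by_cases he : Touches v k e
          · rw [← hy]
            exact label_congr (by rw [h2']; exact ((hxy e he).resolve_left hex).symm)
          · exact (hout e he).symm
      have htt := fun e he => (touches_update hv e).2 he
      cases hN : D.label t (D.edgeN k)
      · left
        refine hgen _ (D.edgeS k) hN ?_ htt (touches_edgeN v k)
        rw [hN] at hcase
        exact (Bool.eq_not_of_ne hcase.symm).trans rfl
      · right
        refine hgen _ (D.edgeN k) ?_ hN (fun e he => (htt e he).symm) (touches_edgeS v k)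
        rw [hN] at hcase
        exact (Bool.eq_not_of_ne hcase.symm).trans rfl
    · intro ht
      have h1 : (oneState v).1 k = false := hv
      rcases ht with rfl | rfl
      all_goals
        refine ⟨h1, rfl, fun e e1 e2 => ?_, ?_⟩
        · have he : ¬ Touches v k e := fun h => h.elim e1 e2
          have he' := fun h => he ((touches_update hv e).1 h)
          rw [label_setLabel, if_neg]
          · rfl
          · first
            | exact fun h => he' (Or.inl h)
            | exact fun h => he' (Or.inr h)
        · rw [if_pos (show D.circleOf (oneState v).1 (D.edgeN k) = D.circleOf (oneState v).1 (D.edgeS k) from h)]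
          refine Or.inl ⟨rfl, ?_⟩
          rw [label_setLabel_of_eq (v := v') rfl, label_setLabel_of_eq (v := v') rfl,
            label_oneState, label_oneState]
          simp [hsp, hsp.symm]
  by_cases hN : setLabel (oneState v') (D.edgeN k) false = t
  · rw [if_pos (key.2 (Or.inl hN)), if_pos hN, if_neg fun hS => hne (hN.trans hS.symm), add_zero]
  · by_cases hS : setLabel (oneState v') (D.edgeS k) false = t
    · rw [if_pos (key.2 (Or.inr hS)), if_neg hN, if_pos hS, zero_add]
    · rw [if_neg fun hc => (key.1 hc).elim hN hS, if_neg hN, if_neg hS, add_zero]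

/-- The faces of the cube of resolutions commute: by `ext_of_commute_mulX` it suffices to compare
the two composites on the states with all labels equal to `1`, where only merges and splits have
to be counted. -/
lemma khMap_commute {k l : D.Crossing} (hkl : k ≠ l) : Commute (khMap k) (khMap l) := by
  classical
  refine ext_of_commute_mulX (fun e => (khMap_mulX k e).mul_left (khMap_mulX l e))
    (fun e => (khMap_mulX l e).mul_left (khMap_mulX k e)) fun v => ?_
  -- an edge map applied to a state in which the crossing is already `1`-resolved
  have hzero : ∀ {k l : D.Crossing}, k ≠ l → v k = true →
      khMap k (khMap l (Finsupp.single (oneState v) 1)) = 0 := by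
    intro k l hkl hk
    by_cases hl : v l = false
    · have h0 : khMap k (Finsupp.single (oneState (Function.update v l true)) 1) = 0 :=
        khMap_single_eq_zero (by
          change Function.update v l true k = true
          rw [Function.update_of_ne hkl, hk])
      by_cases hs : D.circleOf v (D.edgeN l) = D.circleOf v (D.edgeS l)
      · rw [khMap_oneState_split hl hs, ← Module.End.mul_apply,
          ((khMap_mulX k _).add_right (khMap_mulX k _)).eq, Module.End.mul_apply, h0, map_zero]
      · rw [khMap_oneState_merge hl hs, h0]
    · rw [khMap_single_eq_zero (Bool.eq_true_of_not_eq_false hl : (oneState v).1 l = true), map_zero]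
  rw [Module.End.mul_apply, Module.End.mul_apply]
  by_cases hk : v k = false
  swap
  · rw [Bool.not_eq_false] at hk
    rw [hzero hkl hk, khMap_single_eq_zero (s := oneState v) hk, map_zero]
  by_cases hl : v l = false
  swap
  · rw [Bool.not_eq_false] at hl
    rw [hzero hkl.symm hl, khMap_single_eq_zero (s := oneState v) hl, map_zero]
  set vk := Function.update v k true with hvk
  set vl := Function.update v l true with hvl
  have hkl' : vk l = false := by rw [hvk, Function.update_of_ne hkl.symm, hl]
  have hlk' : vl k = false := by rw [hvl, Function.update_of_ne hkl, hk]
  have hv2 : Function.update vl k true = Function.update vk l true := by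
    rw [hvk, hvl, Function.update_comm hkl]
  set w := Function.update vk l true with hw
  have c1 := card_circle_update hk
  have c2 := card_circle_update hl
  have c3 := card_circle_update hkl'
  have c4 := card_circle_update hlk'
  rw [← hvk] at c1
  rw [← hvl] at c2
  rw [← hw] at c3
  rw [hv2] at c4
  by_cases a : D.circleOf v (D.edgeN k) = D.circleOf v (D.edgeS k) <;>
  by_cases b : D.circleOf v (D.edgeN l) = D.circleOf v (D.edgeS l) <;>
  by_cases a' : D.circleOf vl (D.edgeN k) = D.circleOf vl (D.edgeS k) <;>
  by_cases b' : D.circleOf vk (D.edgeN l) = D.circleOf vk (D.edgeS l)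
  all_goals
    try (exfalso; simp only [a, b, a', b', if_true, if_false] at c1 c2 c3 c4; omega)
  · rw [khMap_oneState_split hk a, khMap_oneState_split hl b, ← hvk, ← hvl,
      ← Module.End.mul_apply, ← Module.End.mul_apply,
      ((khMap_mulX k _).add_right (khMap_mulX k _)).eq,
      ((khMap_mulX l _).add_right (khMap_mulX l _)).eq, Module.End.mul_apply,
      Module.End.mul_apply, khMap_oneState_split hkl' b', khMap_oneState_split hlk' a', hv2,
      ← hw, ← Module.End.mul_apply, ← Module.End.mul_apply,
      (((mulX_commute _ _).add_right (mulX_commute _ _)).add_left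
        ((mulX_commute _ _).add_right (mulX_commute _ _))).eq]
  · -- each crossing alone splits a circle, and the other one merges the two parts again
    have m1 := circleOf_update_merge hkl' b'
    have m2 := circleOf_update_merge hlk' a'
    rw [← hw] at m1
    rw [hv2] at m2
    have htN : Touches v k (D.edgeN l) := by
      by_contra hn
      exact b' ((circleOf_update_of_not_touches hk hn _).2 b)
    have htN' : Touches vk l (D.edgeN k) := by
      have t1 := (touches_update hk (D.edgeN l)).2 htN
      have t2 := (touches_update hk (D.edgeS l)).2 ((Touches.congr b).1 htN)
      rw [← hvk] at t1 t2
      rcases t1 with t1 | t1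
      · exact Or.inl t1.symm
      · rcases t2 with t2 | t2
        · exact Or.inr t2.symm
        · exact absurd (t1.trans t2.symm) b'
    have htw := (touches_update hkl' (D.edgeN k)).2 htN'
    rw [← hw] at htw
    have hNN : D.circleOf w (D.edgeN k) = D.circleOf w (D.edgeN l) :=
      htw.elim id fun h => h.trans m1.symm
    rw [khMap_oneState_split hk a, khMap_oneState_split hl b, ← hvk, ← hvl,
      ← Module.End.mul_apply, ← Module.End.mul_apply,
      ((khMap_mulX k _).add_right (khMap_mulX k _)).eq,
      ((khMap_mulX l _).add_right (khMap_mulX l _)).eq, Module.End.mul_apply,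
      Module.End.mul_apply, khMap_oneState_merge hkl' b', khMap_oneState_merge hlk' a', hv2,
      ← hw, LinearMap.add_apply, LinearMap.add_apply, mulX_oneState_congr hNN,
      mulX_oneState_congr (m2.symm.trans hNN), mulX_oneState_congr m1]
  · rw [khMap_oneState_split hk a, khMap_oneState_merge hl b, ← hvk, ← hvl,
      ← Module.End.mul_apply, ((khMap_mulX l _).add_right (khMap_mulX l _)).eq,
      Module.End.mul_apply, khMap_oneState_merge hkl' b', khMap_oneState_split hlk' a', hv2]
  · rw [khMap_oneState_merge hk a, khMap_oneState_split hl b, ← hvk, ← hvl,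
      ← Module.End.mul_apply, ((khMap_mulX k _).add_right (khMap_mulX k _)).eq,
      Module.End.mul_apply, khMap_oneState_split hkl' b', khMap_oneState_merge hlk' a', hv2]
  · -- each crossing alone merges two circles, and the other one splits the result again
    have m1 := circleOf_update_split hkl' b'
    have m2 := circleOf_update_split hlk' a'
    rw [← hw] at m1
    rw [hv2] at m2
    have htN : Touches v k (D.edgeN l) := by
      by_contra hn
      exact b ((circleOf_update_of_not_touches hk hn _).1 b')
    have t1 := (touches_update hk (D.edgeN l)).2 htN
    have m3 := circleOf_update_merge hk a
    rw [← hvk] at t1 m3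
    have t2 : D.circleOf vk (D.edgeN k) = D.circleOf vk (D.edgeN l) :=
      t1.elim Eq.symm fun h => (h.trans m3.symm).symm
    have tN := (touches_update hkl' (D.edgeN k)).2 (Or.inl t2)
    have tS := (touches_update hkl' (D.edgeS k)).2 (Or.inl (m3.symm.trans t2))
    rw [← hw] at tN tS
    rw [khMap_oneState_merge hk a, khMap_oneState_merge hl b, ← hvk, ← hvl,
      khMap_oneState_split hkl' b', khMap_oneState_split hlk' a', hv2, ← hw,
      LinearMap.add_apply, LinearMap.add_apply]
    rcases tN with tN | tN <;> rcases tS with tS | tS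
    · exact absurd (tN.trans tS.symm) m2
    · rw [mulX_oneState_congr tN, mulX_oneState_congr tS]
    · rw [mulX_oneState_congr tN, mulX_oneState_congr tS, add_comm]
    · exact absurd (tN.trans tS.symm) m2
  · rw [khMap_oneState_merge hk a, khMap_oneState_merge hl b, ← hvk, ← hvl,
      khMap_oneState_merge hkl' b', khMap_oneState_merge hlk' a', hv2]

lemma khD_eq_sum (s : D.EnhancedState) : D.khD (Finsupp.single s 1) =
    ∑ k, D.khSign s.1 k • khMap k (Finsupp.single s 1) := by
  classical
  ext t
  rw [khD_single, khCoeff, Finsupp.finsetSum_apply]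
  refine Finset.sum_congr rfl fun k _ => ?_
  rw [Finsupp.smul_apply, khMap_single]
  split_ifs <;> simp

lemma khD_of_supported {w : D.Resolution} {x : D.EnhancedState →₀ ℤ}
    (hx : ∀ t, x t ≠ 0 → t.1 = w) : D.khD x = ∑ k, D.khSign w k • khMap k x := by
  conv_lhs => rw [← Finsupp.sum_single x]
  rw [Finsupp.sum, map_sum]
  have h : ∀ k, D.khSign w k • khMap k x =
      ∑ t ∈ x.support, x t • D.khSign w k • khMap k (Finsupp.single t 1) := by
    intro k
    conv_lhs => rw [← Finsupp.sum_single x]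
    rw [Finsupp.sum, map_sum, Finset.smul_sum]
    refine Finset.sum_congr rfl fun t _ => ?_
    rw [show Finsupp.single t (x t) = x t • Finsupp.single t 1 by simp, map_smul, smul_comm]
  rw [Finset.sum_congr rfl fun k _ => h k, Finset.sum_comm]
  refine Finset.sum_congr rfl fun t ht => ?_
  rw [show Finsupp.single t (x t) = x t • Finsupp.single t 1 by simp, map_smul, khD_eq_sum,
    Finset.smul_sum, hx t (Finsupp.mem_support_iff.1 ht)]

lemma khSign_update {v : D.Resolution} {k : D.Crossing} (hk : v k = false) (l : D.Crossing) :
    D.khSign (Function.update v k true) l = D.khSign v l *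
      if k.1.1 < l.1.1 ∨ (k.1.1 = l.1.1 ∧ k.1.2 < l.1.2) then -1 else 1 := by
  unfold khSign
  rw [← Finset.mul_prod_erase _ _ (Finset.mem_univ k), ← Finset.mul_prod_erase Finset.univ
    (fun m => if (m.1.1 < l.1.1 ∨ (m.1.1 = l.1.1 ∧ m.1.2 < l.1.2)) ∧ v m = true then (-1 : ℤ)
      else 1) (Finset.mem_univ k)]
  rw [Finset.prod_congr rfl (g := fun m => if (m.1.1 < l.1.1 ∨ (m.1.1 = l.1.1 ∧ m.1.2 < l.1.2)) ∧
    v m = true then (-1 : ℤ) else 1) fun m hm => by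
      rw [Function.update_of_ne (Finset.ne_of_mem_erase hm)]]
  simp [hk, mul_comm]

lemma khSign_anticommute {v : D.Resolution} {k l : D.Crossing} (hkl : k ≠ l) (hk : v k = false)
    (hl : v l = false) : D.khSign v k * D.khSign (Function.update v k true) l =
      -(D.khSign v l * D.khSign (Function.update v l true) k) := by
  rw [khSign_update hk, khSign_update hl]
  have h : ¬ (k.1.1 = l.1.1 ∧ k.1.2 = l.1.2) := fun h => hkl (Subtype.ext (Prod.ext h.1 h.2))
  have : (if k.1.1 < l.1.1 ∨ (k.1.1 = l.1.1 ∧ k.1.2 < l.1.2) then (-1 : ℤ) else 1) =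
      - (if l.1.1 < k.1.1 ∨ (l.1.1 = k.1.1 ∧ l.1.2 < k.1.2) then (-1 : ℤ) else 1) := by
    split_ifs with h1 h2 h2
    · omega
    · rfl
    · rfl
    · omega
  rw [this]
  ring

theorem khD_comp_khD : D.khD ∘ₗ D.khD = 0 := by
  classical
  refine Finsupp.lhom_ext fun s b => ?_
  rw [show Finsupp.single s b = b • Finsupp.single s 1 by simp, map_smul, map_smul]
  congr 1
  rw [LinearMap.comp_apply, khD_eq_sum, map_sum, LinearMap.zero_apply]
  set F : D.Crossing → D.Crossing → (D.EnhancedState →₀ ℤ) := fun k l =>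
    (D.khSign s.1 k * D.khSign (Function.update s.1 k true) l) •
      khMap l (khMap k (Finsupp.single s 1)) with hF
  have h1 : ∀ k, D.khD (D.khSign s.1 k • khMap k (Finsupp.single s 1)) = ∑ l, F k l := by
    intro k
    rw [map_smul, khD_of_supported (w := Function.update s.1 k true), Finset.smul_sum]
    · refine Finset.sum_congr rfl fun l _ => ?_
      rw [hF, smul_smul]
    · intro t ht
      rw [khMap_single] at ht
      by_contra hc
      exact ht (if_neg fun h => hc h.2.1)
  have hzero : ∀ k l, s.1 k = true → F l k = 0 := by
    intro k l hk
    simp only [hF]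
    by_cases hkl : k = l
    · subst hkl
      rw [khMap_single_eq_zero hk, map_zero, smul_zero]
    · rw [← Module.End.mul_apply, (khMap_commute hkl).eq, Module.End.mul_apply,
        khMap_single_eq_zero hk, map_zero, smul_zero]
  have h2 : ∀ k l, F k l = - F l k := by
    intro k l
    by_cases hk : s.1 k = false
    swap
    · rw [Bool.not_eq_false] at hk
      rw [hzero k l hk, neg_zero]
      simp only [hF]
      rw [khMap_single_eq_zero hk, map_zero, smul_zero]
    by_cases hl : s.1 l = false
    swap
    · rw [Bool.not_eq_false] at hl
      rw [hzero l k hl, zero_eq_neg]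
      simp only [hF]
      rw [khMap_single_eq_zero hl, map_zero, smul_zero]
    by_cases hkl : k = l
    · subst hkl
      have : F k k = 0 := by
        simp only [hF]
        have hsup : ∀ x : D.EnhancedState →₀ ℤ, (∀ t, x t ≠ 0 → t.1 k = true) →
            khMap k x = 0 := by
          intro x hx
          rw [← Finsupp.sum_single x, Finsupp.sum, map_sum]
          refine Finset.sum_eq_zero fun t ht => ?_
          rw [show Finsupp.single t (x t) = x t • Finsupp.single t 1 by simp, map_smul,
            khMap_single_eq_zero (hx t (Finsupp.mem_support_iff.1 ht)), smul_zero]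
        rw [hsup, smul_zero]
        intro t ht
        rw [khMap_single] at ht
        by_contra hc
        exact ht (if_neg fun h => hc (by rw [h.2.1, Function.update_self]))
      rw [this, neg_zero]
    · simp only [hF]
      rw [khSign_anticommute hkl hk hl, neg_smul, ← Module.End.mul_apply,
        ← Module.End.mul_apply, (khMap_commute hkl).eq]
  rw [Finset.sum_congr rfl fun k _ => h1 k]
  have h3 : ∑ k, ∑ l, F k l = - ∑ k, ∑ l, F k l := by
    conv_lhs => rw [Finset.sum_comm]
    rw [← Finset.sum_neg_distrib]
    refine Finset.sum_congr rfl fun k _ => ?_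
    rw [← Finset.sum_neg_distrib]
    exact Finset.sum_congr rfl fun l _ => h2 l k
  exact self_eq_neg.1 h3

theorem isBigradedDifferential_khD : IsBigradedDifferential D.khI D.khJ D.khD :=
  ⟨hasBidegree_khD, khD_comp_khD⟩

end GridDiagram

/-! ### Orientations of circles and the Morse matching -/

namespace GridDiagram

variable {n : ℕ} {D : GridDiagram n}

/-- An enhanced state orients the circles of its resolution, clockwise if the label is `1` and
counterclockwise if the label is `x`. The orientation is encoded by its sign relative to the
checkerboard orientation. -/
def orient (s : D.EnhancedState) (e : D.Edge) : ℤ :=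
  -(if D.label s e then 1 else -1) * circleSign s.1 e

lemma orient_def (s : D.EnhancedState) (e : D.Edge) :
    orient s e = -(if D.label s e then 1 else -1) * circleSign s.1 e := rfl

lemma orient_eq_or (s : D.EnhancedState) (e : D.Edge) : orient s e = 1 ∨ orient s e = -1 := by
  unfold orient
  rcases circleSign_eq_or s.1 e with h | h <;> rw [h] <;> split_ifs <;> simp

lemma orient_congr (s : D.EnhancedState) {e e' : D.Edge}
    (h : D.circleOf s.1 e = D.circleOf s.1 e') : orient s e = orient s e' := by
  unfold orient
  rw [label_congr h, circleSign_congr h]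

/-- An enhanced state is determined by its resolution and the orientations of the circles. -/
lemma ext_orient {s t : D.EnhancedState} (h : s.1 = t.1) (h' : orient s = orient t) : s = t := by
  refine EnhancedState.ext_label h fun e => ?_
  have := congrFun h' e
  unfold orient at this
  rw [h] at this
  rcases circleSign_eq_or t.1 e with h1 | h1 <;> rw [h1] at this <;> revert this <;>
    cases D.label s e <;> cases D.label t e <;> simp

lemma exists_orient_eq (v : D.Resolution) (o : D.Edge → ℤ) (ho : ∀ e, o e = 1 ∨ o e = -1)
    (hv : ∀ e e', D.circleOf v e = D.circleOf v e' → o e = o e') :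
    ∃ s : D.EnhancedState, s.1 = v ∧ orient s = o := by
  refine ⟨⟨v, Quot.lift (fun e => decide (o e * circleSign v e = -1)) ?_⟩, rfl, ?_⟩
  · intro e e' h
    have := Quot.sound h
    rw [hv e e' this, circleSign_congr this]
  · funext e
    unfold orient
    simp only [label]
    rcases ho e with h | h <;> rcases circleSign_eq_or v e with h' | h' <;> simp [h, h']

lemma orient_of_not_touches {k : D.Crossing} {s t : D.EnhancedState} (h : D.KhStep k s t)
    {e : D.Edge} (he : ¬ Touches s.1 k e) : orient t e = orient s e := by
  unfold orient
  rw [h.2.2.1 e (fun h => he (Or.inl h)) (fun h => he (Or.inr h)), h.2.1,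
    circleSign_update_of_not_touches h.1 he]

/-- The total signed area enclosed by the oriented circles. -/
def energy (o : D.Edge → ℤ) : ℤ := ∑ e : D.Edge, o e * (D.checkerSign e.1 * areaForm e.1)

open Classical in
lemma energy_eq (v : D.Resolution) (k : D.Crossing) (o : D.Edge → ℤ)
    (ho : ∀ e e', D.circleOf v e = D.circleOf v e' → o e = o e') :
    energy o = o (D.edgeN k) * area v (D.edgeN k) +
      (if D.circleOf v (D.edgeN k) = D.circleOf v (D.edgeS k) then 0
        else o (D.edgeS k) * area v (D.edgeS k)) +
      ∑ e : D.Edge, if Touches v k e then 0 else o e * (D.checkerSign e.1 * areaForm e.1) := by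
  have h1 : ∀ x : D.Edge, o x * area v x = ∑ e : D.Edge, if D.circleOf v e = D.circleOf v x then
      o e * (D.checkerSign e.1 * areaForm e.1) else 0 := by
    intro x
    unfold area circleSum
    rw [Finset.mul_sum]
    refine Finset.sum_congr rfl fun e _ => ?_
    split_ifs with h
    · rw [ho e x h]
    · rw [mul_zero]
  unfold energy
  by_cases hNS : D.circleOf v (D.edgeN k) = D.circleOf v (D.edgeS k)
  · rw [if_pos hNS, add_zero, h1, ← Finset.sum_add_distrib]
    refine Finset.sum_congr rfl fun e _ => ?_
    unfold Touches
    rw [← hNS, or_self]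
    split_ifs <;> simp
  · rw [if_neg hNS, h1, h1, ← Finset.sum_add_distrib, ← Finset.sum_add_distrib]
    refine Finset.sum_congr rfl fun e _ => ?_
    unfold Touches
    by_cases hN : D.circleOf v e = D.circleOf v (D.edgeN k)
    · rw [if_pos hN, if_pos (Or.inl hN), if_neg (by rw [hN]; exact hNS)]; ring
    · rw [if_neg hN, zero_add]
      by_cases hS : D.circleOf v e = D.circleOf v (D.edgeS k)
      · rw [if_pos hS, if_pos (Or.inr hS), add_zero]
      · rw [if_neg hS, if_neg (fun h => h.elim hN hS), zero_add]

lemma circleSign_mul_area_pos (v : D.Resolution) (e : D.Edge) :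
    0 < circleSign v e * area v e := by
  rw [circleSign_mul_area]
  exact abs_pos.2 (area_ne_zero v e)

/-- By the triangle inequality for areas, the Khovanov differential does not decrease the energy,
and it preserves the energy only if it preserves the orientations. -/
lemma energy_le_of_khStep {k : D.Crossing} {s t : D.EnhancedState} (h : D.KhStep k s t) :
    energy (orient s) ≤ energy (orient t) ∧
      (energy (orient s) = energy (orient t) → orient s = orient t) := by
  classical
  have hs := h
  obtain ⟨hv, ht, -, hrule⟩ := h
  have hrest : (∑ e : D.Edge, if Touches t.1 k e then 0 else
        orient t e * (D.checkerSign e.1 * areaForm e.1)) =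
      ∑ e : D.Edge, if Touches s.1 k e then 0 else
        orient s e * (D.checkerSign e.1 * areaForm e.1) := by
    refine Finset.sum_congr rfl fun e _ => ?_
    rw [ht, if_congr (touches_update hv e) rfl rfl]
    split_ifs with he
    · rfl
    · rw [orient_of_not_touches hs he]
  rw [energy_eq s.1 k _ fun e e' => orient_congr s, energy_eq t.1 k _ fun e e' => orient_congr t,
    hrest, add_le_add_iff_right, add_left_inj]
  -- it suffices to compare the orientations of the circles which meet the crossing
  have hext : orient s (D.edgeN k) = orient t (D.edgeN k) →
      orient s (D.edgeS k) = orient t (D.edgeS k) →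
      (D.circleOf s.1 (D.edgeN k) ≠ D.circleOf s.1 (D.edgeS k) →
        orient s (D.edgeN k) = orient s (D.edgeS k)) →
      (D.circleOf s.1 (D.edgeN k) = D.circleOf s.1 (D.edgeS k) →
        orient t (D.edgeN k) = orient t (D.edgeS k)) →
      orient s = orient t := by
    intro h1 h2 h3 h4
    have h5 : orient s (D.edgeN k) = orient s (D.edgeS k) := by
      by_cases hNS : D.circleOf s.1 (D.edgeN k) = D.circleOf s.1 (D.edgeS k)
      · exact orient_congr s hNS
      · exact h3 hNS
    funext e
    by_cases he : Touches s.1 k e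
    · have he' := (touches_update hv e).2 he
      rw [← ht] at he'
      have g1 : orient s e = orient s (D.edgeN k) :=
        he.elim (orient_congr s) fun h => (orient_congr s h).trans h5.symm
      have g2 : orient t e = orient t (D.edgeN k) :=
        he'.elim (orient_congr t) fun h => (orient_congr t h).trans (h2.symm.trans (h5.symm.trans h1))
      rw [g1, g2, h1]
    · exact (orient_of_not_touches hs he).symm
  have p1 := circleSign_mul_area_pos s.1 (D.edgeN k)
  have p2 := circleSign_mul_area_pos s.1 (D.edgeS k)
  have p3 := circleSign_mul_area_pos t.1 (D.edgeN k)
  have p4 := circleSign_mul_area_pos t.1 (D.edgeS k)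
  have q1 := circleSign_eq_or s.1 (D.edgeN k)
  have q2 := circleSign_eq_or s.1 (D.edgeS k)
  have q3 := circleSign_eq_or t.1 (D.edgeN k)
  have q4 := circleSign_eq_or t.1 (D.edgeS k)
  have o1 := orient_def s (D.edgeN k)
  have o2 := orient_def s (D.edgeS k)
  have o3 := orient_def t (D.edgeN k)
  have o4 := orient_def t (D.edgeS k)
  by_cases hNS : D.circleOf s.1 (D.edgeN k) = D.circleOf s.1 (D.edgeS k)
  · have hsp := circleOf_update_split hv hNS
    have ha := area_update_split hv hNS
    rw [← ht] at hsp ha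
    rw [if_pos hNS] at hrule
    rw [if_pos hNS, if_neg hsp]
    have e1 := orient_congr s hNS
    -- in a split the areas with checkerboard orientation add up, and each term of the energy is an area
    -- up to sign, with the sign given by the label
    have key : (orient s (D.edgeN k) * area s.1 (D.edgeN k) + 0 ≤
        orient t (D.edgeN k) * area t.1 (D.edgeN k) +
          orient t (D.edgeS k) * area t.1 (D.edgeS k)) ∧
        (orient s (D.edgeN k) * area s.1 (D.edgeN k) + 0 =
        orient t (D.edgeN k) * area t.1 (D.edgeN k) +
          orient t (D.edgeS k) * area t.1 (D.edgeS k) →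
          orient s (D.edgeN k) = orient t (D.edgeN k) ∧
          orient s (D.edgeN k) = orient t (D.edgeS k)) := by
      cases g1 : D.label s (D.edgeN k) <;> cases g2 : D.label t (D.edgeN k) <;>
        cases g3 : D.label t (D.edgeS k) <;> rw [g1, g2, g3] at hrule <;>
        simp [ComulRule] at hrule
      all_goals
        rw [g1] at o1
        rw [g2] at o3
        rw [g3] at o4
        rcases q1 with q1 | q1 <;> rcases q3 with q3 | q3 <;> rcases q4 with q4 | q4 <;>
          simp only [q1, q3, q4] at o1 o3 o4 p1 p3 p4 <;> simp at o1 o3 o4 <;>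
          rw [o1, o3, o4] <;> omega
    refine ⟨key.1, fun heq => ?_⟩
    obtain ⟨k1, k2⟩ := key.2 heq
    exact hext k1 (e1.symm.trans k2) (fun h => absurd hNS h) fun _ => k1.symm.trans k2
  · have hme := circleOf_update_merge hv hNS
    have ha := area_update_merge hv hNS
    rw [← ht] at hme ha
    rw [if_neg hNS] at hrule
    rw [if_neg hNS, if_pos hme]
    have e1 := orient_congr t hme
    -- the same comparison for a merge
    have key : (orient s (D.edgeN k) * area s.1 (D.edgeN k) +
          orient s (D.edgeS k) * area s.1 (D.edgeS k) ≤
        orient t (D.edgeN k) * area t.1 (D.edgeN k) + 0) ∧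
        (orient s (D.edgeN k) * area s.1 (D.edgeN k) +
          orient s (D.edgeS k) * area s.1 (D.edgeS k) =
        orient t (D.edgeN k) * area t.1 (D.edgeN k) + 0 →
          orient s (D.edgeN k) = orient t (D.edgeN k) ∧
          orient s (D.edgeS k) = orient t (D.edgeN k)) := by
      obtain ⟨g1, g2⟩ := hrule
      rw [g2] at o3
      cases g3 : D.label s (D.edgeN k) <;> cases g4 : D.label s (D.edgeS k)
      · rw [g3, g4] at g1; simp at g1
      all_goals
        rw [g3] at o1 o3
        rw [g4] at o2 o3
        rcases q1 with q1 | q1 <;> rcases q2 with q2 | q2 <;> rcases q3 with q3 | q3 <;>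
          simp only [q1, q2, q3] at o1 o2 o3 p1 p2 p3 <;> simp at o1 o2 o3 <;>
          rw [o1, o2, o3] <;> omega
    refine ⟨key.1, fun heq => ?_⟩
    obtain ⟨k1, k2⟩ := key.2 heq
    exact hext k1 (k2.trans e1) (fun _ => k1.trans k2.symm) fun h => absurd h hNS

/-- At the crossing `k` the two vertical edges are oriented away from the crossing. -/
def IsSource (o : D.Edge → ℤ) (k : D.Crossing) : Prop :=
  o (D.edgeN k) = crossingSign k ∧ o (D.edgeS k) = crossingSign k

/-- If the vertical edges at a crossing are oriented away from it, then both resolutions of the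
crossing are compatible with the orientation. -/
lemma IsSource.congr_update {o : D.Edge → ℤ} {k : D.Crossing} (hk : IsSource o k)
    {v : D.Resolution} (ho : ∀ e e', D.circleOf v e = D.circleOf v e' → o e = o e') (b : Bool) :
    ∀ e e', D.circleOf (Function.update v k b) e = D.circleOf (Function.update v k b) e' →
      o e = o e' := by
  have htouch : ∀ e, Touches v k e → o e = crossingSign k := by
    rintro e (h | h)
    · exact (ho _ _ h).trans hk.1
    · exact (ho _ _ h).trans hk.2
  cases hv : v k <;> cases b
  · rwa [show Function.update v k false = v by rw [← hv, Function.update_eq_self]]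
  · intro e e' h
    by_cases he : Touches v k e
    · have he' := (Touches.congr h).1 ((touches_update hv e).2 he)
      rw [htouch e he, htouch e' ((touches_update hv e').1 he')]
    · exact ho e e' ((circleOf_update_of_not_touches hv he e').1 h)
  · intro e e' h
    set u := Function.update v k false with hu
    have hu' : u k = false := Function.update_self _ _ _
    have hv' : v = Function.update u k true := by
      rw [hu, Function.update_idem, ← hv, Function.update_eq_self]
    by_cases he : Touches u k e
    · have he' := (Touches.congr h).1 he
      have g := (touches_update hu' e).2 he
      have g' := (touches_update hu' e').2 he'
      rw [← hv'] at g g'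
      rw [htouch e g, htouch e' g']
    · refine ho e e' ?_
      rw [hv']
      exact (circleOf_update_of_not_touches hu' he e').2 h
  · rwa [show Function.update v k true = v by rw [← hv, Function.update_eq_self]]

/-- The states which differ only in the resolution of a crossing at which the vertical edges are
oriented away from the crossing are joined by an edge of the cube. -/
lemma khStep_of_orient_eq {k : D.Crossing} {s t : D.EnhancedState} (hk : IsSource (orient s) k)
    (hv : s.1 k = false) (ht : t.1 = Function.update s.1 k true) (ho : orient t = orient s) :
    D.KhStep k s t := by
  classical
  have hlab : ∀ (s : D.EnhancedState) e, (if D.label s e then (1 : ℤ) else -1) =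
      - orient s e * circleSign s.1 e := by
    intro s e
    unfold orient
    rcases circleSign_eq_or s.1 e with h | h <;> rw [h] <;> ring
  refine ⟨hv, ht, fun e e1 e2 => ?_, ?_⟩
  · have he : ¬ Touches s.1 k e := fun h => h.elim e1 e2
    have h1 := hlab s e
    have h2 := hlab t e
    rw [ho, ht, circleSign_update_of_not_touches hv he, ← h1] at h2
    revert h2
    cases D.label s e <;> cases D.label t e <;> simp
  · obtain ⟨k1, k2⟩ := hk
    have a1 := hlab s (D.edgeN k)
    have a2 := hlab s (D.edgeS k)
    have a3 := hlab t (D.edgeN k)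
    have a4 := hlab t (D.edgeS k)
    rw [ho] at a3 a4
    rw [k1] at a1 a3
    rw [k2] at a2 a4
    have c := crossingSign_eq_or k
    split_ifs with hNS
    · have hsp := circleSign_update_split hv hNS
      rw [← ht] at hsp
      unfold ComulRule
      clear a2
      revert a1 a3 a4
      cases D.label s (D.edgeN k) <;> cases D.label t (D.edgeN k) <;>
        cases D.label t (D.edgeS k) <;> intro a1 a3 a4 <;> simp at a1 a3 a4 ⊢ <;>
        rcases c with c | c <;> rw [c] at a1 a3 a4 hsp <;> omega
    · have hme := circleSign_update_merge hv hNS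
      rw [← ht] at hme
      unfold MulRule
      revert a1 a2 a3
      cases D.label s (D.edgeN k) <;> cases D.label s (D.edgeS k) <;>
        cases D.label t (D.edgeN k) <;> intro a1 a2 a3 <;> simp at a1 a2 a3 ⊢ <;>
        rcases c with c | c <;> rw [c] at a1 a2 a3 hme <;> omega

/-- A crossing at which the vertical edges are oriented away from the crossing, chosen in
dependence only on the orientation. -/
def source (o : D.Edge → ℤ) (h : ∃ k, IsSource o k) : D.Crossing := h.choose

lemma isSource_source (o : D.Edge → ℤ) (h : ∃ k, IsSource o k) : IsSource o (source o h) :=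
  h.choose_spec

/-- The states which have sources, and in which the distinguished source has the
resolution `b`. -/
def matched (D : GridDiagram n) (b : Bool) : Set D.EnhancedState :=
  {s | ∃ h : ∃ k, IsSource (orient s) k, s.1 (source (orient s) h) = b}

lemma source_congr {o o' : D.Edge → ℤ} (h : o = o') (h1 : ∃ k, IsSource o k)
    (h2 : ∃ k, IsSource o' k) : source o h1 = source o' h2 := by
  subst h; rfl

lemma exists_partner (b : Bool) (s : D.EnhancedState) (h : ∃ k, IsSource (orient s) k) :
    ∃ t : D.EnhancedState, t.1 = Function.update s.1 (source (orient s) h) b ∧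
      orient t = orient s :=
  exists_orient_eq _ _ (orient_eq_or s)
    ((isSource_source _ h).congr_update (fun _ _ => orient_congr s) b)

/-- The state with the same orientation and the resolution `b` at the distinguished source. -/
def partner (b b' : Bool) (s : matched D b) : matched D b' :=
  ⟨(exists_partner b' s.1 s.2.choose).choose, by
    obtain ⟨h1, h2⟩ := (exists_partner b' s.1 s.2.choose).choose_spec
    refine ⟨by rw [h2]; exact s.2.choose, ?_⟩
    rw [h1, source_congr h2 _ s.2.choose, Function.update_self]⟩

lemma partner_fst (b b' : Bool) (s : matched D b) (h : ∃ k, IsSource (orient s.1) k) :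
    (partner b b' s).1.1 = Function.update s.1.1 (source (orient s.1) h) b' :=
  (exists_partner b' s.1 s.2.choose).choose_spec.1

lemma orient_partner (b b' : Bool) (s : matched D b) :
    orient (partner b b' s).1 = orient s.1 :=
  (exists_partner b' s.1 s.2.choose).choose_spec.2

lemma partner_partner (b b' : Bool) (s : matched D b) : partner b' b (partner b b' s) = s := by
  obtain ⟨h, hs⟩ := s.2
  have ho := orient_partner b b' s
  refine Subtype.ext (ext_orient ?_ ((orient_partner _ _ _).trans ho))
  rw [partner_fst b' b (partner b b' s) (by rw [ho]; exact h), partner_fst b b' s h,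
    source_congr ho _ h, Function.update_idem]
  exact Function.update_eq_self_iff.2 hs.symm

/-- The matching of the states which have sources. -/
def matching (D : GridDiagram n) : matched D false ≃ matched D true where
  toFun := partner false true
  invFun := partner true false
  left_inv := partner_partner _ _
  right_inv := partner_partner _ _

lemma khSign_eq_or (v : D.Resolution) (k : D.Crossing) :
    D.khSign v k = 1 ∨ D.khSign v k = -1 := by
  unfold khSign
  refine Finset.prod_induction _ (fun x : ℤ => x = 1 ∨ x = -1) ?_ (Or.inl rfl) ?_
  · rintro a b (rfl | rfl) (rfl | rfl) <;> simp
  · intro l _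
    split_ifs <;> simp

lemma eq_of_khStep {k l : D.Crossing} {s t : D.EnhancedState} (h : D.KhStep k s t)
    (hs : s.1 l = false) (ht : t.1 l = true) : l = k := by
  by_contra hne
  rw [h.2.1, Function.update_of_ne hne, hs] at ht
  exact absurd ht (by simp)

/-- Cancelling the matched pairs, the Khovanov complex reduces to a complex generated by the
states without sources. -/
theorem exists_reduction {G : Type*} (r : G → D.EnhancedState) (hr : Function.Injective r)
    (hrange : ∀ s, s ∈ Set.range r ↔ ∀ k, ¬ IsSource (orient s) k) :
    ∃ δ, IsBigradedDifferential (D.khI ∘ r) (D.khJ ∘ r) δ ∧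
      BigradedHomotopyEquivalent (D.khI ∘ r) (D.khJ ∘ r) δ D.khI D.khJ D.khD := by
  classical
  refine exists_gaussian_elimination isBigradedDifferential_khD (matched D false) (matched D true)
    ?_ (matching D) (fun s => energy (orient s)) ?_ ?_ r hr ?_
  · rintro s ⟨h, h1⟩ ⟨h', h2⟩
    rw [h1] at h2
    exact absurd h2 (by simp)
  · intro s
    obtain ⟨h, hs⟩ := s.2
    have hst : D.KhStep (source (orient s.1) h) s.1 (matching D s).1 :=
      khStep_of_orient_eq (isSource_source _ h) hs (partner_fst false true s h)
        (orient_partner false true s)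
    rw [khD_single, khCoeff, Finset.sum_eq_single (source (orient s.1) h)]
    · rw [if_pos hst]
      rcases khSign_eq_or s.1.1 (source (orient s.1) h) with g | g <;> rw [g]
      · exact isUnit_one
      · exact isUnit_one.neg
    · intro k _ hk
      refine if_neg fun hk' => hk (eq_of_khStep hst hk'.1 ?_)
      rw [hk'.2.1, Function.update_self]
    · intro hc
      exact absurd (Finset.mem_univ _) hc
  · intro s t h
    obtain ⟨k, hk⟩ := exists_khStep_of_khD_ne_zero h
    -- a nonzero entry between `s` and the partner of `t` does not decrease the energy, and if it
    -- preserves it, then `s` and `t` have the same orientation and the same resolution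
    have ho : orient (matching D t).1 = orient t.1 := orient_partner false true t
    have he := energy_le_of_khStep hk
    rw [ho] at he
    rcases he.1.lt_or_eq with h1 | h1
    · exact Or.inr h1
    · left
      have hst := he.2 h1
      obtain ⟨gs, hs⟩ := s.2
      obtain ⟨gt, ht⟩ := t.2
      have hsrc : source (orient s.1) gs = source (orient t.1) gt := source_congr hst _ _
      have hfst : (matching D t).1.1 = _ := partner_fst false true t gt
      have hks := eq_of_khStep hk hs (by rw [hsrc, hfst, Function.update_self])
      refine Subtype.ext (ext_orient ?_ hst.symm)
      have h2 := hk.2.1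
      rw [hfst, ← hks, hsrc] at h2
      rw [hsrc] at hs
      funext l
      by_cases hl : l = source (orient t.1) gt
      · rw [hl, ht, hs]
      · have := congrFun h2 l
        rwa [Function.update_of_ne hl, Function.update_of_ne hl] at this
  · intro s
    rw [hrange]
    constructor
    · intro h
      exact ⟨fun ⟨⟨k, hk⟩, _⟩ => h k hk, fun ⟨⟨k, hk⟩, _⟩ => h k hk⟩
    · rintro ⟨h1, h2⟩ k hk
      cases hb : s.1 (source (orient s) ⟨k, hk⟩)
      · exact h1 ⟨⟨k, hk⟩, hb⟩
      · exact h2 ⟨⟨k, hk⟩, hb⟩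

end GridDiagram

/-! ### Generators and the states without sources -/

namespace GridDiagram

variable {n : ℕ} {D : GridDiagram n}

/-- The vertical segments are oriented towards the points of the generator, and the horizontal
segments away from them; the value is `1` if an edge is oriented upward or rightward. -/
def genFlow (g : D.Generator) : LatticeEdge n → ℤ
  | .v c r => if r < g.row c then 1 else -1
  | .h c r => if g.row.symm r ≤ c then 1 else -1

/-- The resolution which belongs to a generator. At a crossing which is not a point of the
generator it is determined by the flow. At the points of the generator both resolutions are
compatible with the flow, and the strand of the figure-eight makes the choice. -/
def genRes (F : D.FigureEights) (g : D.Generator) : D.Resolution := fun k =>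
  if g.row k.1.1 = k.1.2 then !(F.isUpward g k.1.1)
  else decide (k.1.2 < g.row k.1.1 ↔ g.row.symm k.1.2 < k.1.1)

lemma genFlow_eq_or (g : D.Generator) (e : LatticeEdge n) : genFlow g e = 1 ∨ genFlow g e = -1 := by
  cases e <;> unfold genFlow <;> simp only <;> split_ifs <;> simp

/-- The flow of a generator out of the lattice point `(c, r)` in a given direction. -/
def genOut (g : D.Generator) (c r : Fin n) : Direction → ℤ
  | .N => if r < g.row c then 1 else -1
  | .E => if g.row.symm r ≤ c then 1 else -1
  | .S => if r ≤ g.row c then -1 else 1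
  | .W => if g.row.symm r < c then -1 else 1

lemma genFlow_mul_sgn (g : D.Generator) {e : LatticeEdge n} {c r : Fin n} {a : Direction}
    (h : e.LeavesIn c r a) : genFlow g e * a.sgn = genOut g c r a := by
  cases e <;> cases a <;> simp only [LatticeEdge.LeavesIn] at h <;> obtain ⟨h1, h2⟩ := h
  · subst h1; subst h2; simp [genFlow, genOut, Direction.sgn]
  · subst h2
    simp only [genFlow, genOut, Direction.sgn]
    split_ifs <;> first | rfl | omega
  · subst h1; subst h2; simp [genFlow, genOut, Direction.sgn]
  · subst h1
    simp only [genFlow, genOut, Direction.sgn]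
    split_ifs <;> first | rfl | omega

lemma Generator.meets_row (g : D.Generator) (c : Fin n) :
    (D.bot c ≤ g.row c ∧ g.row c ≤ D.top c) ∧
      (D.left (g.row c) ≤ c ∧ c ≤ D.right (g.row c)) := by
  obtain ⟨h1, h2, h3⟩ := g.meets c
  unfold strandX at h2 h3
  refine ⟨h1, ?_, ?_⟩
  · split_ifs at h2 <;> omega
  · split_ifs at h3 <;> omega

lemma Generator.meets_column (g : D.Generator) (r : Fin n) :
    (D.bot (g.row.symm r) ≤ r ∧ r ≤ D.top (g.row.symm r)) ∧
      (D.left r ≤ g.row.symm r ∧ g.row.symm r ≤ D.right r) := by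
  have := g.meets_row (g.row.symm r)
  rwa [Equiv.apply_symm_apply] at this

lemma isCoherent_genFlow (F : D.FigureEights) (g : D.Generator) :
    IsCoherent (genRes F g) (fun e => genFlow g e.1) := by
  intro c r a a' h e e' he he'
  simp only
  rw [genFlow_mul_sgn g he, genFlow_mul_sgn g he']
  unfold genOut
  have h1 := g.meets_row c
  have h2 := g.meets_column r
  have h3 : g.row c = r ↔ g.row.symm r = c := by
    rw [Equiv.symm_apply_eq, eq_comm]
  have h4 := D.bot_lt_top c
  have h5 := D.left_lt_right r
  have h6 := D.isPuncture_iff c r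
  obtain ⟨ha, ha', hne, hcr⟩ := h
  by_cases hk : D.IsCrossing c r
  · have h7 := hcr hk
    unfold genRes at h7
    simp only at h7
    by_cases hγ : g.row c = r
    · have hρ := h3.1 hγ
      rw [hγ, hρ]
      cases a <;> cases a' <;> simp at hne ⊢ <;>
        revert h7 <;> cases (if g.row c = r then !F.isUpward g c else
          decide (r < g.row c ↔ g.row.symm r < c)) <;> simp [ResolutionArc]
    · have hρ := fun h => hγ (h3.2 h)
      rw [if_neg hγ] at h7
      by_cases hlt : r < g.row c <;> by_cases hlt' : g.row.symm r < c <;>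
        simp only [hlt, hlt', iff_self, decide_true, decide_false, iff_true,
          iff_false, not_true] at h7 <;>
        cases a <;> cases a' <;> simp [ResolutionArc] at h7 <;> simp only <;> split_ifs <;> omega
  · have h8 : (r = g.row c ∧ D.left r ≤ c ∧ c ≤ D.right r) ∨ r ≠ g.row c := by
      by_cases h : r = g.row c
      · exact Or.inl ⟨h, h ▸ h1.2⟩
      · exact Or.inr h
    unfold IsCrossing at hk
    generalize g.row c = γ at *
    generalize g.row.symm r = ρ at *
    clear hcr
    cases a <;> cases a' <;> simp only [Has] at ha ha' <;> simp only <;>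
      first | exact absurd rfl hne | (split_ifs <;> first | rfl | (exfalso; omega))

lemma sgn_mul_sgn (a : Direction) : a.sgn * a.sgn = 1 := by cases a <;> rfl

/-- A coherent flow along the edges of a resolution with values `±1` is an orientation of its
circles. -/
lemma IsCoherent.mul_checkerSign_congr {v : D.Resolution} {f : D.Edge → ℤ} (hf : IsCoherent v f)
    {e e' : D.Edge} (h : D.circleOf v e = D.circleOf v e') :
    f e * D.checkerSign e.1 = f e' * D.checkerSign e'.1 := by
  have key : ∀ e, f (next v e) * D.checkerSign (next v e).1 = f e * D.checkerSign e.1 := by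
    intro e
    obtain ⟨c, r, a, a', h1, h2, h3, h4⟩ := succ_next v e
    have h5 := hf h3 h1 h2
    have h6 := h3.checker h1 h2
    have h7 := sgn_mul_sgn a
    have h8 := sgn_mul_sgn a'
    linear_combination (-(D.checkerSign (next v e).1 * f (next v e)) * h8
      + (D.checkerSign e.1 * f e) * h7 + f (next v e) * a'.sgn * h6
      - D.checkerSign e.1 * a.sgn * h5)
  obtain ⟨i, rfl⟩ := sameCycle_iff_exists_nat_pow.1 (circleOf_eq_iff.1 h)
  induction i with
  | zero => simp
  | succ i ih =>
    rw [pow_succ', Equiv.Perm.mul_apply, key]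
    refine ih ?_
    rw [h, pow_succ', Equiv.Perm.mul_apply, circleOf_next]

lemma IsCoherent.of_orient (s : D.EnhancedState) :
    IsCoherent s.1 (fun e => orient s e * D.checkerSign e.1) := by
  intro c r a a' h e e' he he'
  simp only
  rw [orient_congr s (h.circleOf_eq he he')]
  linear_combination orient s e' * h.checker he he'

/-- The Khovanov generator which belongs to a Bigelow generator. -/
lemma exists_genState (F : D.FigureEights) (g : D.Generator) :
    ∃ s : D.EnhancedState, s.1 = genRes F g ∧
      orient s = fun e => genFlow g e.1 * D.checkerSign e.1 := by
  refine exists_orient_eq _ _ (fun e => ?_) fun e e' h =>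
    (isCoherent_genFlow F g).mul_checkerSign_congr h
  rcases genFlow_eq_or g e.1 with h | h <;> rcases checkerSign_eq_or (D := D) e.1 with h' | h' <;>
    simp [h, h']

/-- The Khovanov generator which belongs to a Bigelow generator. -/
def genState (F : D.FigureEights) (g : D.Generator) : D.EnhancedState :=
  (exists_genState F g).choose

lemma genState_fst (F : D.FigureEights) (g : D.Generator) : (genState F g).1 = genRes F g :=
  (exists_genState F g).choose_spec.1

lemma orient_genState (F : D.FigureEights) (g : D.Generator) :
    orient (genState F g) = fun e => genFlow g e.1 * D.checkerSign e.1 :=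
  (exists_genState F g).choose_spec.2

/-- In terms of the flow, a source is a crossing at which both vertical edges are oriented away
from the crossing. -/
lemma isSource_iff (s : D.EnhancedState) (k : D.Crossing) : IsSource (orient s) k ↔
    orient s (D.edgeN k) * D.checkerSign (D.edgeN k).1 = 1 ∧
      orient s (D.edgeS k) * D.checkerSign (D.edgeS k).1 = -1 := by
  have h1 := checkerSign_mul_sgn_crossing k (leavesIn_edgeS k)
  rw [show (Direction.S).sgn = -1 from rfl, show (Direction.S).vec = (0, -1) from rfl] at h1
  have h2 : D.checkerSign (D.edgeN k).1 = crossingSign k := rfl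
  have h3 : D.checkerSign (D.edgeS k).1 = - crossingSign k := by linarith
  unfold IsSource
  rw [h2, h3]
  rcases crossingSign_eq_or k with h | h <;> rw [h] <;> constructor <;> rintro ⟨g1, g2⟩ <;>
    constructor <;> linarith

lemma not_isSource_genState (F : D.FigureEights) (g : D.Generator) (k : D.Crossing) :
    ¬ IsSource (orient (genState F g)) k := by
  rw [isSource_iff, orient_genState]
  simp only [mul_assoc, checkerSign_sq, mul_one]
  have h1 := genFlow_mul_sgn g (leavesIn_edgeN k)
  have h2 := genFlow_mul_sgn g (leavesIn_edgeS k)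
  rw [show (Direction.N).sgn = 1 from rfl] at h1
  rw [show (Direction.S).sgn = -1 from rfl] at h2
  unfold genOut at h1 h2
  simp only at h1 h2
  rintro ⟨h3, h4⟩
  rw [h3] at h1
  rw [h4] at h2
  split_ifs at h1 h2 <;> omega

lemma genState_injective (F : D.FigureEights) : Function.Injective (genState F) := by
  intro g g' h
  have hv : genRes F g = genRes F g' := by rw [← genState_fst, h, genState_fst]
  have ho : ∀ e : D.Edge, genFlow g e.1 = genFlow g' e.1 := by
    intro e
    have := congrFun ((orient_genState F g).symm.trans (h ▸ orient_genState F g')) e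
    have h1 := D.checkerSign_sq e.1
    linear_combination D.checkerSign e.1 * this + (genFlow g' e.1 - genFlow g e.1) * h1
  have hrow : g.row = g'.row := by
    ext1 c
    have m1 := g.meets_row c
    have m2 := g'.meets_row c
    by_contra hne
    rcases lt_or_gt_of_ne hne with hlt | hlt
    · have := ho ⟨.v c (g.row c), m1.1.1, hlt.trans_le m2.1.2⟩
      simp [genFlow, hlt] at this
    · have := ho ⟨.v c (g'.row c), m2.1.1, hlt.trans_le m1.1.2⟩
      simp [genFlow, hlt] at this
  refine Generator.ext hrow (funext fun c => ?_)
  have m1 := g.meets_row c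
  by_cases hk : D.IsCrossing c (g.row c)
  · have := congrFun hv ⟨(c, g.row c), hk⟩
    unfold genRes FigureEights.isUpward at this
    simp only [← hrow, if_true] at this
    revert this
    cases g.side c <;> cases g'.side c <;> simp
  · have hp := D.isPuncture_iff c (g.row c)
    have h1 := (g.meets c).2
    have h2 := (g'.meets c).2
    rw [← hrow] at h2
    have h5 := D.left_lt_right (g.row c)
    unfold strandX at h1 h2
    unfold IsCrossing at hk
    revert h1 h2
    cases g.side c <;> cases g'.side c <;> simp <;> intros <;> omega

/-- A sequence with values `±1` which stays at `-1` once it gets there has a threshold. -/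
lemma exists_threshold {f : Fin n → ℤ} {a b : Fin n} (hab : a ≤ b)
    (hf : ∀ r, a ≤ r → r < b → f r = 1 ∨ f r = -1)
    (hstep : ∀ (r : Fin n) (h : (r : ℕ) + 1 < n), a ≤ r → (r : ℕ) + 1 < b → f r = -1 →
      f ⟨r + 1, h⟩ = -1) :
    ∃ t, a ≤ t ∧ t ≤ b ∧ ∀ r, a ≤ r → r < b → f r = if r < t then 1 else -1 := by
  classical
  have hne : (Finset.univ.filter fun r => a ≤ r ∧ r ≤ b ∧ (r = b ∨ f r = -1)).Nonempty :=
    ⟨b, by simp [hab]⟩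
  obtain ⟨h1, h2, h3⟩ := (Finset.mem_filter.1 (Finset.min'_mem _ hne)).2
  have hmin : ∀ r ∈ Finset.univ.filter fun r => a ≤ r ∧ r ≤ b ∧ (r = b ∨ f r = -1),
      Finset.min' _ hne ≤ r := fun r hr => Finset.min'_le _ r hr
  set t := Finset.min' _ hne
  refine ⟨t, h1, h2, fun r hr hr' => ?_⟩
  split_ifs with h
  · refine (hf r hr hr').resolve_right fun hc => ?_
    exact absurd (hmin r (by simp [hr, hr'.le, hc])) (not_le.2 h)
  · -- the value `-1` propagates from the threshold on
    obtain ⟨r, hrn⟩ := r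
    induction r with
    | zero =>
      have : t = ⟨0, hrn⟩ := Fin.ext (by rw [Fin.lt_def] at h; simp at h; exact h)
      exact this ▸ h3.resolve_left (fun h' => by rw [this] at h'; exact hr'.ne h')
    | succ m ih =>
      by_cases hm : t = ⟨m + 1, hrn⟩
      · exact hm ▸ h3.resolve_left (fun h' => by rw [hm] at h'; exact hr'.ne h')
      · have hlt : t < ⟨m + 1, hrn⟩ := lt_of_le_of_ne (not_lt.1 h) hm
        rw [Fin.lt_def] at hlt hr'
        rw [Fin.le_def] at h1
        simp only at hlt hr'
        exact hstep ⟨m, by omega⟩ hrn (by rw [Fin.le_def]; simp only; omega) hr'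
          (ih (by omega) (by rw [Fin.le_def]; simp only; omega)
            (by rw [Fin.lt_def]; simp only; omega) (by rw [Fin.lt_def]; simp only; omega))

/-- A coherent flow at a crossing. -/
lemma IsCoherent.flowAt_crossing {v : D.Resolution} {f : D.Edge → ℤ} (hf : IsCoherent v f)
    {c r : Fin n} (hk : D.IsCrossing c r) :
    (v ⟨(c, r), hk⟩ = false ∧ GridDiagram.flowAt f c r .E = - GridDiagram.flowAt f c r .N ∧
      GridDiagram.flowAt f c r .W = - GridDiagram.flowAt f c r .S) ∨
    (v ⟨(c, r), hk⟩ = true ∧ GridDiagram.flowAt f c r .W = GridDiagram.flowAt f c r .N ∧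
      GridDiagram.flowAt f c r .E = GridDiagram.flowAt f c r .S) := by
  cases hv : v ⟨(c, r), hk⟩
  · have h1 := hf.flowAt (arc_crossing v ⟨(c, r), hk⟩ (a := .N) (a' := .E) (by rw [hv]; trivial))
    have h2 := hf.flowAt (arc_crossing v ⟨(c, r), hk⟩ (a := .S) (a' := .W) (by rw [hv]; trivial))
    simp only [Direction.sgn] at h1 h2
    exact Or.inl ⟨rfl, by linarith, by linarith⟩
  · have h1 := hf.flowAt (arc_crossing v ⟨(c, r), hk⟩ (a := .N) (a' := .W) (by rw [hv]; trivial))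
    have h2 := hf.flowAt (arc_crossing v ⟨(c, r), hk⟩ (a := .S) (a' := .E) (by rw [hv]; trivial))
    simp only [Direction.sgn] at h1 h2
    exact Or.inr ⟨rfl, by linarith, by linarith⟩

lemma IsCoherent.flowAt_of_not_crossing {v : D.Resolution} {f : D.Edge → ℤ}
    (hf : IsCoherent v f) {c r : Fin n} (hk : ¬ D.IsCrossing c r) {a a' : Direction}
    (ha : D.Has c r a) (ha' : D.Has c r a') (hne : a ≠ a') :
    GridDiagram.flowAt f c r a * a.sgn + GridDiagram.flowAt f c r a' * a'.sgn = 0 :=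
  hf.flowAt ⟨ha, ha', hne, fun h => absurd h hk⟩

lemma flowAt_eq_or {f : D.Edge → ℤ} (hf : ∀ e, f e = 1 ∨ f e = -1) {c r : Fin n} {a : Direction}
    (h : D.Has c r a) : flowAt f c r a = 1 ∨ flowAt f c r a = -1 := by
  obtain ⟨e, he⟩ := exists_edge h
  rw [flowAt_of_leavesIn f he]
  exact hf e

/-- In a flow without sources, each vertical segment has a height at which the flow turns from
upward to downward. -/
lemma exists_turning_row {v : D.Resolution} {f : D.Edge → ℤ} (hf : IsCoherent v f)
    (hpm : ∀ e, f e = 1 ∨ f e = -1)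
    (hsrc : ∀ k : D.Crossing, ¬ (f (D.edgeN k) = 1 ∧ f (D.edgeS k) = -1)) (c : Fin n) :
    ∃ t, D.bot c ≤ t ∧ t ≤ D.top c ∧
      (∀ r, D.Has c r .N → flowAt f c r .N = if r < t then 1 else -1) ∧
      ∀ r, D.Has c r .S → flowAt f c r .S = if r ≤ t then 1 else -1 := by
  obtain ⟨t, h1, h2, h3⟩ := exists_threshold (f := fun r => flowAt f c r .N) (D.bot_lt_top c).le
    (fun r ha hb => flowAt_eq_or hpm (show D.Has c r .N from ⟨ha, hb⟩)) (by
      intro r hr ha hb hneg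
      have hN : D.Has c ⟨r + 1, hr⟩ .N := ⟨by simp only [Fin.le_def] at ha ⊢; omega, hb⟩
      have hS : D.Has c ⟨r + 1, hr⟩ .S :=
        ⟨by simp only [Fin.le_def, Fin.lt_def] at ha ⊢; omega, hN.2.le⟩
      rw [← flowAt_N_eq_S f c r hr] at hneg
      by_cases hk : D.IsCrossing c ⟨r + 1, hr⟩
      · refine (flowAt_eq_or hpm hN).resolve_left fun hc => hsrc ⟨(c, ⟨r + 1, hr⟩), hk⟩ ?_
        rw [← flowAt_of_leavesIn f (leavesIn_edgeN ⟨(c, ⟨r + 1, hr⟩), hk⟩),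
          ← flowAt_of_leavesIn f (leavesIn_edgeS ⟨(c, ⟨r + 1, hr⟩), hk⟩)]
        exact ⟨hc, hneg⟩
      · have := hf.flowAt_of_not_crossing hk hN hS (by decide)
        simp only [Direction.sgn] at this
        linarith)
  refine ⟨t, h1, h2, fun r hr => h3 r hr.1 hr.2, ?_⟩
  rintro ⟨r, hrn⟩ hr
  obtain ⟨hr1, hr2⟩ := hr
  rw [Fin.lt_def] at hr1
  rw [Fin.le_def] at hr2
  simp only at hr1 hr2
  obtain ⟨m, rfl⟩ : ∃ m, r = m + 1 := ⟨r - 1, by omega⟩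
  rw [flowAt_N_eq_S f c ⟨m, by omega⟩ hrn,
    h3 ⟨m, by omega⟩ (by rw [Fin.le_def]; simp only; omega) (by rw [Fin.lt_def]; simp only; omega)]
  exact if_congr (by rw [Fin.lt_def, Fin.le_def]; simp only; omega) rfl rfl

/-- In a flow without sources, each horizontal segment has a point at which the flow turns from
leftward to rightward. -/
lemma exists_turning_column {v : D.Resolution} {f : D.Edge → ℤ} (hf : IsCoherent v f)
    (hpm : ∀ e, f e = 1 ∨ f e = -1)
    (hsrc : ∀ k : D.Crossing, ¬ (f (D.edgeN k) = 1 ∧ f (D.edgeS k) = -1)) (r : Fin n) :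
    ∃ t, D.left r ≤ t ∧ t ≤ D.right r ∧
      (∀ c, D.Has c r .E → flowAt f c r .E = if t ≤ c then 1 else -1) ∧
      ∀ c, D.Has c r .W → flowAt f c r .W = if t < c then 1 else -1 := by
  obtain ⟨t, h1, h2, h3⟩ := exists_threshold (f := fun c => - flowAt f c r .E)
    (D.left_lt_right r).le
    (fun c ha hb => by
      rcases flowAt_eq_or hpm (show D.Has c r .E from ⟨ha, hb⟩) with h | h <;> rw [h] <;> simp) (by
      intro c hc ha hb hneg
      have hE : D.Has ⟨c + 1, hc⟩ r .E := ⟨by simp only [Fin.le_def] at ha ⊢; omega, hb⟩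
      have hW : D.Has ⟨c + 1, hc⟩ r .W :=
        ⟨by simp only [Fin.le_def, Fin.lt_def] at ha ⊢; omega, hE.2.le⟩
      rw [← flowAt_E_eq_W f c r hc] at hneg
      by_cases hk : D.IsCrossing ⟨c + 1, hc⟩ r
      · rw [neg_inj]
        refine (flowAt_eq_or hpm hE).resolve_right fun hneg' => hsrc ⟨(⟨c + 1, hc⟩, r), hk⟩ ?_
        rw [← flowAt_of_leavesIn f (leavesIn_edgeN ⟨(⟨c + 1, hc⟩, r), hk⟩),
          ← flowAt_of_leavesIn f (leavesIn_edgeS ⟨(⟨c + 1, hc⟩, r), hk⟩)]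
        simp only
        rcases hf.flowAt_crossing hk with ⟨-, g1, g2⟩ | ⟨-, g1, g2⟩ <;> constructor <;> linarith
      · have := hf.flowAt_of_not_crossing hk hE hW (by decide)
        simp only [Direction.sgn] at this
        linarith)
  refine ⟨t, h1, h2, fun c hc => ?_, ?_⟩
  · have := h3 c hc.1 hc.2
    split_ifs at this ⊢ <;> omega
  rintro ⟨c, hcn⟩ hc
  obtain ⟨hr1, hr2⟩ := hc
  rw [Fin.lt_def] at hr1
  rw [Fin.le_def] at hr2
  simp only at hr1 hr2
  obtain ⟨m, rfl⟩ : ∃ m, c = m + 1 := ⟨c - 1, by omega⟩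
  have := h3 ⟨m, by omega⟩ (by rw [Fin.le_def]; simp only; omega)
    (by rw [Fin.lt_def]; simp only; omega)
  rw [flowAt_E_eq_W f ⟨m, by omega⟩ r hcn]
  simp only [Fin.lt_def] at this ⊢
  split_ifs at this ⊢ <;> omega

/-- Every state without sources belongs to a generator, formed by the points at which the vertical
flow turns; these are also the points at which the horizontal flow turns. -/
lemma exists_genState_eq (F : D.FigureEights) {s : D.EnhancedState}
    (hs : ∀ k, ¬ IsSource (orient s) k) : ∃ g, genState F g = s := by
  classical
  set f : D.Edge → ℤ := fun e => orient s e * D.checkerSign e.1 with hf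
  have hcoh : IsCoherent s.1 f := IsCoherent.of_orient s
  have hpm : ∀ e, f e = 1 ∨ f e = -1 := fun e => by
    rcases orient_eq_or s e with h | h <;> rcases checkerSign_eq_or (D := D) e.1 with h' | h' <;>
      simp [hf, h, h']
  have hsrc : ∀ k : D.Crossing, ¬ (f (D.edgeN k) = 1 ∧ f (D.edgeS k) = -1) := fun k hk =>
    hs k ((isSource_iff s k).2 hk)
  choose γ hγ1 hγ2 hN hS using exists_turning_row hcoh hpm hsrc
  choose ρ hρ1 hρ2 hE hW using exists_turning_column hcoh hpm hsrc
  -- the vertical flow can turn only at a crossing or at an end of the vertical segment, which are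
  -- points of the horizontal segment of the row
  have hrange : ∀ c, D.left (γ c) ≤ c ∧ c ≤ D.right (γ c) := by
    intro c
    have hp := D.isPuncture_iff c (γ c)
    have hlr := D.left_lt_right (γ c)
    by_cases hk : D.IsCrossing c (γ c)
    · exact ⟨hk.2.1.le, hk.2.2.le⟩
    · by_contra hcon
      have gN : D.Has c (γ c) .N := ⟨hγ1 c, lt_of_le_of_ne (hγ2 c) fun h => by omega⟩
      have gS : D.Has c (γ c) .S := ⟨lt_of_le_of_ne (hγ1 c) fun h => by omega, hγ2 c⟩
      have := hcoh.flowAt_of_not_crossing hk gN gS (by decide)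
      rw [hN c _ gN, hS c _ gS] at this
      simp [Direction.sgn] at this
  -- at the turning point the vertical flow comes in from both sides, so the horizontal flow goes out
  have hρβ : ∀ c, ρ (γ c) = c := by
    intro c
    have hp := D.isPuncture_iff c (γ c)
    have hbt := D.bot_lt_top c
    have b1 := hγ1 c
    have b2 := hγ2 c
    have b3 := hρ1 (γ c)
    have b4 := hρ2 (γ c)
    obtain ⟨b5, b6⟩ := hrange c
    have vN : D.Has c (γ c) .N → flowAt f c (γ c) .N = -1 := fun h => by simp [hN c _ h]
    have vS : D.Has c (γ c) .S → flowAt f c (γ c) .S = 1 := fun h => by simp [hS c _ h]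
    have vE : D.Has c (γ c) .E → flowAt f c (γ c) .E = 1 → ρ (γ c) ≤ c := fun h h' => by
      rw [hE _ c h] at h'
      by_contra hc
      simp [hc] at h'
    have vW : D.Has c (γ c) .W → flowAt f c (γ c) .W = -1 → c ≤ ρ (γ c) := fun h h' => by
      rw [hW _ c h] at h'
      by_contra hc
      simp [not_le.1 hc] at h'
    by_cases hk : D.IsCrossing c (γ c)
    · obtain ⟨g1, g2, g3, g4⟩ := (isCrossing_iff _ _).1 hk
      have e1 := vN g1
      have e2 := vS g2
      refine le_antisymm (vE g3 ?_) (vW g4 ?_)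
      all_goals
        rcases hcoh.flowAt_crossing hk with ⟨-, h1, h2⟩ | ⟨-, h1, h2⟩ <;> linarith
    · have hcorner : γ c = D.bot c ∨ γ c = D.top c := by
        unfold IsCrossing at hk
        omega
      have key : ∀ a, D.Has c (γ c) a → a = .E ∨ a = .W → flowAt f c (γ c) a * a.sgn = 1 := by
        intro a ha haEW
        rcases hcorner with hb | hb
        · have gN : D.Has c (γ c) .N := ⟨b1, hb.trans_lt hbt⟩
          have := hcoh.flowAt_of_not_crossing hk gN ha (by rcases haEW with rfl | rfl <;> decide)
          rw [vN gN] at this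
          simp only [Direction.sgn] at this ⊢
          linarith
        · have gS : D.Has c (γ c) .S := ⟨hb ▸ hbt, b2⟩
          have := hcoh.flowAt_of_not_crossing hk gS ha (by rcases haEW with rfl | rfl <;> decide)
          rw [vS gS] at this
          simp only [Direction.sgn] at this ⊢
          linarith
      have hlr := D.left_lt_right (γ c)
      rcases hp.1 hcorner with hc | hc
      · have gE : D.Has c (γ c) .E := ⟨hc.ge, hc.trans_lt hlr⟩
        have h1 := key .E gE (Or.inl rfl)
        simp only [Direction.sgn] at h1
        exact le_antisymm (vE gE (by linarith)) (hc.trans_le b3)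
      · have gW : D.Has c (γ c) .W := ⟨hlr.trans_eq hc.symm, hc.le⟩
        have h1 := key .W gW (Or.inr rfl)
        simp only [Direction.sgn] at h1
        exact le_antisymm (b4.trans hc.ge) (vW gW (by linarith))
  have hinj : Function.Injective γ := Function.LeftInverse.injective hρβ
  let row : Equiv.Perm (Fin n) := Equiv.ofBijective γ (Finite.injective_iff_bijective.1 hinj)
  have hrow : ∀ c, row c = γ c := fun c => rfl
  have hsymm : ∀ r, row.symm r = ρ r := by
    intro r
    rw [Equiv.symm_apply_eq, hrow]
    obtain ⟨c, rfl⟩ := (Finite.injective_iff_bijective.1 hinj).2 r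
    rw [hρβ]
  -- at a crossing the strand records the resolution, at a puncture only one strand meets the row
  let side : Fin n → Bool := fun c =>
    if h : D.IsCrossing c (γ c) then decide (F.level c < γ c) != !(s.1 ⟨(c, γ c), h⟩)
    else decide (c = D.left (γ c))
  have hmeets : ∀ c, D.Meets c (row c) (side c) := by
    intro c
    have hp := D.isPuncture_iff c (γ c)
    have hlr := D.left_lt_right (γ c)
    obtain ⟨b5, b6⟩ := hrange c
    have b1 := hγ1 c
    have b2 := hγ2 c
    refine ⟨⟨b1, b2⟩, ?_⟩
    rw [hrow]
    unfold strandX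
    simp only [side]
    by_cases hk : D.IsCrossing c (γ c)
    · obtain ⟨-, b7, b8⟩ := hk
      constructor <;> split_ifs <;> omega
    · simp only [dif_neg hk, decide_eq_true_eq]
      unfold IsCrossing at hk
      constructor <;> split_ifs <;> omega
  refine ⟨⟨row, side, hmeets⟩, ?_⟩
  refine ext_orient ?_ ?_
  · rw [genState_fst]
    funext k
    obtain ⟨⟨c, r⟩, hk⟩ := k
    unfold genRes FigureEights.isUpward
    simp only [hrow, hsymm]
    split_ifs with h
    · subst h
      simp only [side]
      rw [dif_pos hk]
      cases decide (F.level c < γ c) <;> cases s.1 ⟨(c, γ c), hk⟩ <;> rfl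
    · obtain ⟨g1, g2, g3, g4⟩ := (isCrossing_iff _ _).1 hk
      have v1 := hN c r g1
      have v2 := hS c r g2
      have v3 := hE r c g3
      have v4 := hW r c g4
      have hlt : r ≤ γ c ↔ r < γ c := ⟨fun h' => lt_of_le_of_ne h' (Ne.symm h), le_of_lt⟩
      rcases hcoh.flowAt_crossing hk with ⟨h0, h1, h2⟩ | ⟨h0, h1, h2⟩ <;> rw [h0]
      · rw [decide_eq_false_iff_not]
        rw [v4, v2, if_congr hlt rfl rfl] at h2
        intro hiff
        rw [if_congr hiff rfl rfl] at h2
        split_ifs at h2 <;> omega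
      · rw [decide_eq_true_iff]
        rw [v4, v1] at h1
        split_ifs at h1 with h3 h4 h4
        · exact ⟨fun _ => h3, fun _ => h4⟩
        · exact ⟨fun h => absurd h h4, fun h => absurd h h3⟩
  · rw [orient_genState]
    funext e
    have hfe : genFlow (⟨row, side, hmeets⟩ : D.Generator) e.1 = f e := by
      obtain ⟨e, he⟩ := e
      cases e with
      | h c r =>
        rw [← flowAt_of_leavesIn f (e := ⟨.h c r, he⟩) (c := c) (r := r) (a := .E) ⟨rfl, rfl⟩,
          hE r c he]
        simp only [genFlow, hsymm]
      | v c r =>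
        rw [← flowAt_of_leavesIn f (e := ⟨.v c r, he⟩) (c := c) (r := r) (a := .N) ⟨rfl, rfl⟩,
          hN c r he]
        simp only [genFlow, hrow]
    rw [hfe, hf]
    simp only
    rw [mul_assoc, checkerSign_sq, mul_one]

/-- The Bigelow generators correspond to the states without sources. -/
theorem range_genState (F : D.FigureEights) (s : D.EnhancedState) :
    s ∈ Set.range (genState F) ↔ ∀ k, ¬ IsSource (orient s) k :=
  ⟨fun ⟨g, hg⟩ => hg ▸ not_isSource_genState F g, exists_genState_eq F⟩

end GridDiagram

/-! ### Rotation numbers as sums over the columns -/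

/-- The cross product of two unit vectors: the signed quarter turn from `a` to `b`, if `b` is not
opposite to `a`. -/
def Direction.cross (a b : Direction) : ℤ := a.vec.1 * b.vec.2 - a.vec.2 * b.vec.1

/-- A potential for the difference between quarter turns and crossings of the diagonal direction. -/
def Direction.potential : Direction → ℤ
  | E => 0
  | N => -3
  | W => -2
  | S => -1

lemma Direction.cross_eq {a b : Direction} (h : b ≠ a.opp) :
    a.cross b = 4 * a.turn b + b.potential - a.potential := by
  revert h
  cases a <;> cases b <;> decide

namespace GridDiagram

variable {n : ℕ} {D : GridDiagram n}

lemma sum_label (s : D.EnhancedState) :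
    (∑ C : D.Circle s.1, if s.2 C then (1 : ℤ) else -1) =
      - ∑ e, orient s e * turnAfter s.1 e := by
  rw [sum_circles, ← Finset.sum_neg_distrib]
  refine Finset.sum_congr rfl fun e _ => ?_
  rw [orient_def]
  unfold label
  ring

lemma orient_next (s : D.EnhancedState) (e : D.Edge) : orient s (next s.1 e) = orient s e :=
  orient_congr s (circleOf_next s.1 e)

/-- The total turning number is a quarter of the number of quarter turns. -/
lemma sum_cross (s : D.EnhancedState) :
    ∑ e, orient s e * (heading e).cross (heading (next s.1 e)) =
      4 * ∑ e, orient s e * turnAfter s.1 e := by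
  have h1 : ∑ e, orient s e * (heading (next s.1 e)).potential =
      ∑ e, orient s e * (heading e).potential := by
    rw [← Equiv.sum_comp (next s.1) fun e => orient s e * (heading e).potential]
    exact Finset.sum_congr rfl fun e _ => by rw [orient_next]
  have h2 : ∀ e, orient s e * (heading e).cross (heading (next s.1 e)) =
      4 * (orient s e * turnAfter s.1 e) + orient s e * (heading (next s.1 e)).potential -
        orient s e * (heading e).potential := by
    intro e
    rw [Direction.cross_eq (heading_next_ne s.1 e)]
    unfold turnAfter
    ring
  rw [Finset.sum_congr rfl fun e _ => h2 e, Finset.sum_sub_distrib, Finset.sum_add_distrib, h1,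
    ← Finset.mul_sum]
  ring

/-- The quarter turn which the flow `f` makes on the arc of the resolution that starts at a lattice
point in the direction `a`; zero if there is no such arc. -/
def arcTurn (v : D.Resolution) (f : D.Edge → ℤ) (c r : Fin n) (a : Direction) : ℤ :=
  open Classical in
  if h : D.Has c r a then flowAt f c r a * a.sgn * a.cross (exists_arc v h).choose else 0

lemma arcTurn_eq {v : D.Resolution} (f : D.Edge → ℤ) {c r : Fin n} {a a' : Direction}
    (h : Arc v c r a a') : arcTurn v f c r a = flowAt f c r a * a.sgn * a.cross a' := by
  unfold arcTurn
  rw [dif_pos h.1, (exists_arc v h.1).choose_spec.unique h]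

lemma arcTurn_of_not_has (v : D.Resolution) (f : D.Edge → ℤ) {c r : Fin n} {a : Direction}
    (h : ¬ D.Has c r a) : arcTurn v f c r a = 0 := dif_neg h

lemma arcTurn_head (s : D.EnhancedState) {e : D.Edge} {c r : Fin n} {a : Direction}
    (h : e.1.LeavesIn c r a) (hs : D.checkerSign e.1 * a.sgn = -1) :
    orient s e * (heading e).cross (heading (next s.1 e)) =
      arcTurn s.1 (fun e => orient s e * D.checkerSign e.1) c r a := by
  obtain ⟨c', r', a', b, h1, h2, h3, h4⟩ := succ_next s.1 e
  have ha : a.sgn = a'.sgn := by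
    have := D.checkerSign_sq e.1
    linear_combination D.checkerSign e.1 * (hs - h4) + (a'.sgn - a.sgn) * this
  obtain ⟨rfl, rfl, rfl⟩ := h.vertex_unique h1 ha
  rw [arcTurn_eq _ h3, flowAt_of_leavesIn _ h1, heading_of_in h1 h4,
    heading_of_out h2 (Succ.checker_right h1 h2 h3 h4)]
  have hc : a.opp.cross b = - a.cross b := by
    unfold Direction.cross
    rw [Direction.vec_opp]
    simp only [Prod.fst_neg, Prod.snd_neg]
    ring
  rw [hc]
  linear_combination -orient s e * a.cross b * h4

lemma arcTurn_tail (s : D.EnhancedState) {e : D.Edge} {c r : Fin n} {a : Direction}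
    (h : e.1.LeavesIn c r a) (hs : D.checkerSign e.1 * a.sgn = 1) :
    orient s ((next s.1).symm e) * (heading ((next s.1).symm e)).cross (heading e) =
      arcTurn s.1 (fun e => orient s e * D.checkerSign e.1) c r a := by
  obtain ⟨e', rfl⟩ := (next s.1).surjective e
  rw [Equiv.symm_apply_apply]
  obtain ⟨c', r', b, a', h1, h2, h3, h4⟩ := succ_next s.1 e'
  have h5 := Succ.checker_right h1 h2 h3 h4
  have ha : a.sgn = a'.sgn := by
    have := D.checkerSign_sq (next s.1 e').1
    linear_combination D.checkerSign (next s.1 e').1 * (hs - h5) + (a'.sgn - a.sgn) * this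
  obtain ⟨rfl, rfl, rfl⟩ := h.vertex_unique h2 ha
  rw [arcTurn_eq _ h3.symm, flowAt_of_leavesIn _ h2, heading_of_in h1 h4, heading_of_out h2 h5,
    orient_next]
  have hc : b.opp.cross a = a.cross b := by
    unfold Direction.cross
    rw [Direction.vec_opp]
    simp only [Prod.fst_neg, Prod.snd_neg]
    ring
  rw [hc]
  linear_combination -orient s e' * a.cross b * h5

lemma sum_shift {n : ℕ} (x y : Fin n → ℤ)
    (hxy : ∀ (r : Fin n) (h : (r : ℕ) + 1 < n), y ⟨r + 1, h⟩ = x r)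
    (hy : ∀ r : Fin n, (r : ℕ) = 0 → y r = 0) (hx : ∀ r : Fin n, (r : ℕ) + 1 = n → x r = 0) :
    ∑ r, x r = ∑ r, y r := by
  cases n with
  | zero => simp
  | succ m =>
    rw [Fin.sum_univ_castSucc, Fin.sum_univ_succ, hx _ (by simp), hy 0 rfl, add_zero, zero_add]
    exact Finset.sum_congr rfl fun i _ => (hxy i.castSucc (by simp)).symm

/-- The number of quarter turns of the oriented circles as a sum over the vertical edges. -/
lemma sum_cross_eq_sum_arcTurn (s : D.EnhancedState) :
    ∑ e, orient s e * (heading e).cross (heading (next s.1 e)) =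
      ∑ c, ∑ r, (arcTurn s.1 (fun e => orient s e * D.checkerSign e.1) c r .N +
        arcTurn s.1 (fun e => orient s e * D.checkerSign e.1) c r .S) := by
  set f : D.Edge → ℤ := fun e => orient s e * D.checkerSign e.1 with hf
  set A : D.Edge → ℤ := fun e => orient s e * (heading e).cross (heading (next s.1 e)) with hA
  set V : D.Edge → ℤ := fun e => (heading e).vec.2 * (heading e).vec.2 with hV
  -- at a quarter turn exactly one of the two edges is vertical
  have h1 : ∀ e, A e = V e * A e + V (next s.1 e) * A e := by
    intro e
    simp only [hA, hV]
    cases heading e <;> cases heading (next s.1 e) <;> simp [Direction.cross, Direction.vec]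
  have h2 : ∑ e, V (next s.1 e) * A e = ∑ e, V e * A ((next s.1).symm e) := by
    rw [← Equiv.sum_comp (next s.1) fun e => V e * A ((next s.1).symm e)]
    simp only [Equiv.symm_apply_apply]
  rw [Finset.sum_congr rfl fun e _ => h1 e, Finset.sum_add_distrib, h2, ← Finset.sum_add_distrib,
    sum_edges]
  refine Finset.sum_congr rfl fun c _ => ?_
  rw [Finset.sum_add_distrib (f := fun r => arcTurn s.1 f c r .N),
    ← sum_shift (fun r => if h : (r : ℕ) + 1 < n then arcTurn s.1 f c ⟨r + 1, h⟩ .S else 0)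
      (fun r => arcTurn s.1 f c r .S), ← Finset.sum_add_distrib]
  · refine Finset.sum_congr rfl fun r _ => ?_
    have hE : flowAt (fun e => V e * A e + V e * A ((next s.1).symm e)) c r .E = 0 := by
      by_cases h : D.Has c r .E
      · obtain ⟨e, he⟩ := exists_edge h
        rw [flowAt_of_leavesIn _ he]
        have : V e = 0 := by
          simp only [hV]
          rcases D.checkerSign_eq_or e.1 with h' | h'
          · rw [heading_of_out he (by rw [h']; rfl)]; rfl
          · rw [heading_of_in he (by rw [h']; rfl)]; rfl
        rw [this]; ring
      · exact flowAt_of_not_has _ h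
    rw [hE, zero_add]
    by_cases h : D.Has c r .N
    · have hr : (r : ℕ) + 1 < n := by
        have := h.2
        rw [Fin.lt_def] at this
        omega
      obtain ⟨e, he⟩ := exists_edge h
      have he' : e.1.LeavesIn c ⟨r + 1, hr⟩ .S := by
        obtain ⟨e, _⟩ := e
        cases e
        · exact absurd he (by simp [LatticeEdge.LeavesIn])
        · exact ⟨he.1, by rw [he.2]⟩
      rw [flowAt_of_leavesIn _ he, dif_pos hr]
      rcases D.checkerSign_eq_or e.1 with h' | h'
      · rw [← arcTurn_tail s he (by rw [h']; rfl), ← arcTurn_head s he' (by rw [h']; rfl)]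
        have : V e = 1 := by
          simp only [hV]
          rw [heading_of_out he (by rw [h']; rfl)]; rfl
        rw [this]
        simp only [hA, Equiv.apply_symm_apply]
        ring
      · rw [← arcTurn_head s he (by rw [h']; rfl), ← arcTurn_tail s he' (by rw [h']; rfl)]
        have : V e = 1 := by
          simp only [hV]
          rw [heading_of_in he (by rw [h']; rfl)]; rfl
        rw [this]
        simp only [hA, Equiv.apply_symm_apply]
        ring
    · rw [flowAt_of_not_has _ h, arcTurn_of_not_has _ _ h, zero_add]
      split_ifs with hr
      · refine (arcTurn_of_not_has _ _ fun h' => h ?_).symm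
        obtain ⟨g1, g2⟩ := h'
        simp only [Fin.lt_def, Fin.le_def] at g1 g2
        refine ⟨?_, ?_⟩
        · rw [Fin.le_def]; omega
        · rw [Fin.lt_def]; omega
      · rfl
  · intro r hr
    rw [dif_pos hr]
  · intro r hr
    refine arcTurn_of_not_has _ _ fun h' => ?_
    have := h'.1
    rw [Fin.lt_def] at this
    omega
  · intro r hr
    rw [dif_neg (by omega)]

lemma genFlow_eq (F : D.FigureEights) (g : D.Generator) :
    (fun e => orient (genState F g) e * D.checkerSign e.1) = fun e : D.Edge => genFlow g e.1 := by
  rw [orient_genState]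
  funext e
  rw [mul_assoc, checkerSign_sq, mul_one]

lemma flowAt_genFlow (g : D.Generator) {c r : Fin n} {a : Direction} (h : D.Has c r a) :
    flowAt (fun e : D.Edge => genFlow g e.1) c r a * a.sgn = genOut g c r a := by
  obtain ⟨e, he⟩ := exists_edge h
  rw [flowAt_of_leavesIn _ he, genFlow_mul_sgn g he]

/-- The quarter turns of the flow of a generator at a lattice point: they cancel at the crossings
which are not points of the generator. -/
lemma arcTurn_genState (F : D.FigureEights) (g : D.Generator) (c r : Fin n) :
    arcTurn (genRes F g) (fun e => genFlow g e.1) c r .N +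
      arcTurn (genRes F g) (fun e => genFlow g e.1) c r .S =
    (if r = g.row c then 4 * (if F.isUpward g c then 1 else 0) - 2 else 0) +
      (if r = D.bot c then (if c = D.left r then -1 else 1) else 0) +
      (if r = D.top c then (if c = D.left r then 1 else -1) else 0) := by
  have h1 := g.meets_row c
  have h2 := g.meets_column r
  have h3 : g.row c = r ↔ g.row.symm r = c := by
    rw [Equiv.symm_apply_eq, eq_comm]
  have h4 := D.bot_lt_top c
  have h5 := D.left_lt_right r
  have h6 := D.isPuncture_iff c r
  have turn : ∀ {a b}, Arc (genRes F g) c r a b →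
      arcTurn (genRes F g) (fun e => genFlow g e.1) c r a = genOut g c r a * a.cross b := by
    intro a b h
    rw [arcTurn_eq _ h, flowAt_genFlow g h.1]
  by_cases hk : D.IsCrossing c r
  · have hb : r ≠ D.bot c := fun h => absurd hk.1.1 (by rw [h]; exact lt_irrefl _)
    have ht : r ≠ D.top c := fun h => absurd hk.1.2 (by rw [h]; exact lt_irrefl _)
    rw [if_neg hb, if_neg ht, add_zero, add_zero]
    have hres : genRes F g ⟨(c, r), hk⟩ = if g.row c = r then !(F.isUpward g c)
      else decide (r < g.row c ↔ g.row.symm r < c) := rfl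
    have key : ∀ b : Bool, genRes F g ⟨(c, r), hk⟩ = b →
        arcTurn (genRes F g) (fun e => genFlow g e.1) c r .N +
          arcTurn (genRes F g) (fun e => genFlow g e.1) c r .S =
        (genOut g c r .N + genOut g c r .S) * if b then 1 else -1 := by
      intro b hb
      cases b
      · rw [turn (arc_crossing (genRes F g) ⟨(c, r), hk⟩ (a := .N) (a' := .E) (by
            rw [hb]; trivial)), turn (arc_crossing (genRes F g) ⟨(c, r), hk⟩ (a := .S) (a' := .W)
            (by rw [hb]; trivial))]
        simp [Direction.cross, Direction.vec]
        ring
      · rw [turn (arc_crossing (genRes F g) ⟨(c, r), hk⟩ (a := .N) (a' := .W) (by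
            rw [hb]; trivial)), turn (arc_crossing (genRes F g) ⟨(c, r), hk⟩ (a := .S) (a' := .E)
            (by rw [hb]; trivial))]
        simp [Direction.cross, Direction.vec]
    rw [key _ rfl, hres]
    by_cases hγ : g.row c = r
    · rw [if_pos hγ, if_pos hγ.symm]
      simp only [genOut, hγ, lt_irrefl, le_refl, if_true, if_false]
      cases F.isUpward g c <;> simp
    · rw [if_neg hγ, if_neg (Ne.symm hγ)]
      have : genOut g c r .N + genOut g c r .S = 0 := by
        simp only [genOut]
        split_ifs <;> omega
      rw [this, zero_mul]
  · have turn' : ∀ {a b}, D.Has c r a → D.Has c r b → a ≠ b →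
        arcTurn (genRes F g) (fun e => genFlow g e.1) c r a = genOut g c r a * a.cross b :=
      fun ha hb hne => turn ⟨ha, hb, hne, fun h => absurd h hk⟩
    -- at a puncture the strand is determined by the end of the horizontal segment
    have hside : g.row c = r → ((g.side c = true → c = D.left r) ∧
        (g.side c = false → c = D.right r)) := by
      intro hγ
      have hm := (g.meets c).2
      rw [hγ] at hm
      rw [hγ] at h1
      unfold IsCrossing at hk
      unfold strandX at hm
      constructor <;> intro hs <;> rw [hs] at hm <;> simp at hm <;> omega
    have hlev := F.bot_le c
    have hlev' := F.lt_top c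
    have hup : g.row c = r → (F.isUpward g c = true ↔
        ((r = D.bot c ∧ c = D.left r) ∨ (r = D.top c ∧ c = D.right r))) := by
      intro hγ
      have hs := hside hγ
      unfold IsCrossing at hk
      unfold FigureEights.isUpward
      rw [hγ] at h1 ⊢
      revert hs
      cases g.side c <;> simp <;> intro hs <;> omega
    have z1 : ∀ {a}, ¬ D.Has c r a →
        arcTurn (genRes F g) (fun e => genFlow g e.1) c r a = 0 := arcTurn_of_not_has _ _
    have hvals : (r = D.bot c ∨ r = D.top c) ∨ (r ≠ D.bot c ∧ r ≠ D.top c) := by omega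
    have hcase := (D.vertex_cases c r).resolve_left fun h => hk h.1
    have hγne : r ≠ D.bot c → r ≠ D.top c → r ≠ g.row c := by
      intro hb ht hγ
      rw [← hγ] at h1
      unfold IsCrossing at hk
      omega
    obtain ⟨-, ⟨gN, gS, gE, gW⟩ | ⟨gN, gS, gE, gW⟩ | ⟨gN, gS, gE, gW⟩ | ⟨gN, gS, gE, gW⟩ |
      ⟨gN, gS, gE, gW⟩ | ⟨gN, gS, gE, gW⟩ | ⟨gN, gS, gE, gW⟩⟩ := hcase
    · rw [turn' gN gS (by decide), turn' gS gN (by decide)]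
      simp only [Has] at gN gS
      rw [if_neg (hγne (by omega) (by omega)), if_neg (by omega), if_neg (by omega)]
      simp [Direction.cross, Direction.vec]
    · rw [z1 gN, z1 gS]
      simp only [Has] at gN gS gE gW
      rw [if_neg (hγne (by omega) (by omega)), if_neg (by omega), if_neg (by omega)]
      simp
    · rw [turn' gN gE (by decide), z1 gS]
      simp only [Has] at gN gS gE gW
      have e1 : r = D.bot c := by omega
      have e2 : c = D.left r := by omega
      rw [if_pos e1, if_neg (by omega : ¬ r = D.top c), if_pos e2]
      simp only [genOut, Direction.cross, Direction.vec]
      by_cases hγ : g.row c = r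
      · rw [if_pos hγ.symm, if_pos ((hup hγ).2 (Or.inl ⟨e1, e2⟩)), if_neg (by omega)]
        norm_num
      · rw [if_neg (Ne.symm hγ), if_pos (by omega)]
        norm_num
    · rw [turn' gN gW (by decide), z1 gS]
      simp only [Has] at gN gS gE gW
      have e1 : r = D.bot c := by omega
      have e2 : c ≠ D.left r := by omega
      rw [if_pos e1, if_neg (by omega : ¬ r = D.top c), if_neg e2]
      simp only [genOut, Direction.cross, Direction.vec]
      by_cases hγ : g.row c = r
      · have hdown : ¬ F.isUpward g c = true := fun h => by have := (hup hγ).1 h; omega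
        rw [if_pos hγ.symm, if_neg hdown, if_neg (by omega)]
        norm_num
      · rw [if_neg (Ne.symm hγ), if_pos (by omega)]
        norm_num
    · rw [turn' gS gE (by decide), z1 gN]
      simp only [Has] at gN gS gE gW
      have e1 : r = D.top c := by omega
      have e2 : c = D.left r := by omega
      rw [if_pos e1, if_neg (by omega : ¬ r = D.bot c), if_pos e2]
      simp only [genOut, Direction.cross, Direction.vec]
      by_cases hγ : g.row c = r
      · have hdown : ¬ F.isUpward g c = true := fun h => by have := (hup hγ).1 h; omega
        rw [if_pos hγ.symm, if_neg hdown, if_pos (by omega)]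
        norm_num
      · rw [if_neg (Ne.symm hγ), if_neg (by omega)]
        norm_num
    · rw [turn' gS gW (by decide), z1 gN]
      simp only [Has] at gN gS gE gW
      have e1 : r = D.top c := by omega
      have e2 : c ≠ D.left r := by omega
      rw [if_pos e1, if_neg (by omega : ¬ r = D.bot c), if_neg e2]
      simp only [genOut, Direction.cross, Direction.vec]
      by_cases hγ : g.row c = r
      · rw [if_pos hγ.symm, if_pos ((hup hγ).2 (Or.inr ⟨e1, by omega⟩)), if_pos (by omega)]
        norm_num
      · rw [if_neg (Ne.symm hγ), if_neg (by omega)]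
        norm_num
    · rw [z1 gN, z1 gS]
      simp only [Has] at gN gS gE gW
      rw [if_neg (hγne (by omega) (by omega)), if_neg (by omega), if_neg (by omega)]
      simp

/-- The labels of the Khovanov generator of `g` determine the grading `P` of `g` up to a constant
which depends only on the diagram. -/
lemma exists_sum_label_add_barP (F : D.FigureEights) : ∃ K : ℤ, ∀ g : D.Generator,
    4 * (∑ C : D.Circle (genState F g).1, if (genState F g).2 C then (1 : ℤ) else -1) =
      K - 4 * F.barP g := by
  refine ⟨- ∑ c : Fin n, (-2 + (if c = D.left (D.bot c) then -1 else 1) +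
    (if c = D.left (D.top c) then 1 else -1)), fun g => ?_⟩
  have h := sum_cross (genState F g)
  rw [sum_cross_eq_sum_arcTurn, genFlow_eq, genState_fst] at h
  have h' : ∀ c, ∑ r, (arcTurn (genRes F g) (fun e => genFlow g e.1) c r .N +
      arcTurn (genRes F g) (fun e => genFlow g e.1) c r .S) =
      4 * (if F.isUpward g c then 1 else 0) + (-2 + (if c = D.left (D.bot c) then -1 else 1) +
        (if c = D.left (D.top c) then 1 else -1)) := by
    intro c
    rw [Finset.sum_congr rfl fun r _ => arcTurn_genState F g c r, Finset.sum_add_distrib,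
      Finset.sum_add_distrib, Finset.sum_ite_eq' , Finset.sum_ite_eq', Finset.sum_ite_eq']
    simp only [Finset.mem_univ, if_true]
    ring
  rw [Finset.sum_congr rfl fun c _ => h' c, Finset.sum_add_distrib, ← Finset.mul_sum] at h
  rw [sum_label, genState_fst]
  unfold FigureEights.barP
  linarith

end GridDiagram

/-! ### The distinguished generator and the Seifert circles -/

namespace GridDiagram

variable {n : ℕ} {D : GridDiagram n}

lemma bot_top_cases (c : Fin n) :
    (D.X c = D.bot c ∧ D.O c = D.top c ∧ D.goesUp c = true) ∨
      (D.X c = D.top c ∧ D.O c = D.bot c ∧ D.goesUp c = false) := by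
  unfold bot top goesUp
  rcases lt_or_gt_of_ne (D.disjoint c) with h | h
  · right
    rw [min_eq_left h.le, max_eq_right h.le]
    simpa using h.le
  · left
    rw [min_eq_right h.le, max_eq_left h.le]
    simpa using h

lemma left_right_cases (r : Fin n) :
    (D.X.symm r = D.right r ∧ D.O.symm r = D.left r ∧ D.goesRight r = true) ∨
      (D.X.symm r = D.left r ∧ D.O.symm r = D.right r ∧ D.goesRight r = false) := by
  unfold left right goesRight
  rcases lt_or_gt_of_ne (D.symm_O_ne_symm_X r) with h | h
  · left
    rw [min_eq_left h.le, max_eq_right h.le]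
    simpa using h
  · right
    rw [min_eq_right h.le, max_eq_left h.le]
    simpa using h.le

lemma genRes_genX (F : D.FigureEights) : genRes F D.genX = D.seifert := by
  funext ⟨⟨c, r⟩, hk⟩
  have hne : ¬ D.X c = r := by
    have := hk.1
    rcases D.bot_top_cases c with ⟨h1, -⟩ | ⟨h1, -⟩ <;> rw [h1]
    · exact this.1.ne
    · exact this.2.ne'
  change (if D.X c = r then _ else decide (r < D.X c ↔ D.X.symm r < c)) =
    !(D.goesUp c != D.goesRight r)
  rw [if_neg hne]
  obtain ⟨⟨k1, k2⟩, k3, k4⟩ := hk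
  simp only at k1 k2 k3 k4
  rcases D.bot_top_cases c with ⟨h1, h2, h3⟩ | ⟨h1, h2, h3⟩ <;>
    rcases D.left_right_cases r with ⟨g1, g2, g3⟩ | ⟨g1, g2, g3⟩ <;>
    rw [h3, g3, h1, g1] <;> simp <;> omega

/-- The flow of the distinguished generator is opposite to the orientation of the link. -/
lemma areaTerm_eq (e : D.Edge) : D.areaTerm e.1 = - genFlow D.genX e.1 * areaForm e.1 := by
  obtain ⟨e, he⟩ := e
  cases e with
  | v c r => simp [areaTerm, areaForm]
  | h c r =>
    change (if D.goesRight r then -(r : ℤ) else r) =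
      -(if D.X.symm r ≤ c then 1 else -1) * -(r : ℤ)
    obtain ⟨h1, h2⟩ := he
    rcases D.left_right_cases r with ⟨g1, g2, g3⟩ | ⟨g1, g2, g3⟩ <;> rw [g3, g1]
    · rw [if_pos rfl, if_neg (not_le.2 h2)]; ring
    · rw [if_neg (by simp), if_pos h1]; ring

/-- The labels of the Khovanov generator of `𝐱` are given by the orientations of the Seifert
circles. -/
lemma sum_label_genX (F : D.FigureEights) :
    (∑ C : D.Circle (genState F D.genX).1, if (genState F D.genX).2 C then (1 : ℤ) else -1) =
      D.rot := by
  classical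
  have hv : (genState F D.genX).1 = D.seifert := by rw [genState_fst, genRes_genX]
  rw [sum_label, rot, sum_circles, ← Finset.sum_neg_distrib, hv]
  refine Finset.sum_congr rfl fun e _ => ?_
  have h1 : D.signedArea (D.circleOf D.seifert e) =
      - orient (genState F D.genX) e * area D.seifert e := by
    unfold signedArea area circleSum
    rw [finsum_eq_sum_of_fintype, Finset.mul_sum]
    refine Finset.sum_congr rfl fun e' _ => ?_
    split_ifs with h
    · have h2 := orient_congr (genState F D.genX) (e := e') (e' := e) (by rw [hv]; exact h)
      have h3 := congrFun (genFlow_eq F D.genX) e'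
      rw [areaTerm_eq, ← h3, h2]
      ring
    · rw [mul_zero]
  have h2 := circleSign_sq D.seifert e
  unfold circleSign at h2
  rw [h1]
  rcases orient_eq_or (genState F D.genX) e with h | h <;> rw [h] <;> unfold circleSign
  · rw [neg_one_mul, Left.sign_neg]
    rw [SignType.coe_neg]
    linear_combination turnAfter D.seifert e * h2
  · rw [neg_neg, one_mul]
    linear_combination -turnAfter D.seifert e * h2

lemma height_seifert : D.height D.seifert = D.nNeg := by
  unfold height nNeg seifert
  refine Finset.sum_congr rfl fun k _ => ?_
  cases D.isPositive k <;> rfl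

lemma writhe_eq : D.writhe = D.nPos - D.nNeg := by
  unfold writhe nPos nNeg
  rw [← Finset.sum_sub_distrib]
  refine Finset.sum_congr rfl fun k _ => ?_
  cases D.isPositive k <;> rfl

end GridDiagram

/-! ### The grading `T` -/

/-- The sign of `b - a`. -/
def orderSign {n : ℕ} (a b : Fin n) : ℤ := if a < b then 1 else if b < a then -1 else 0

lemma orderSign_swap {n : ℕ} (a b : Fin n) : orderSign b a = - orderSign a b := by
  unfold orderSign
  split_ifs <;> first | rfl | omega

namespace GridDiagram

variable {n : ℕ} {D : GridDiagram n}

lemma Generator.T_eq (g : D.Generator) : 4 * g.T = (∑ c, ∑ r, orderSign r (g.row c) *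
    orderSign (g.row.symm r) c) + ∑ c : Fin n, ∑ c' : Fin n, if c = c' then 0 else 1 := by
  have h1 : ∀ c c', (if (g.point c).1 < (g.point c').1 ∧ (g.point c).2 < (g.point c').2 then
      (1 : ℤ) else 0) = if c < c' ∧ g.row c < g.row c' then 1 else 0 := by
    intro c c'
    refine if_congr ?_ rfl rfl
    have h : g.row c = g.row c' ↔ c = c' := g.row.injective.eq_iff
    unfold Generator.point strandX
    simp only
    constructor
    · rintro ⟨h1, h2⟩
      have h3 : g.row c < g.row c' := by rw [Fin.lt_def]; omega
      refine ⟨?_, h3⟩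
      have h4 : c ≠ c' := fun h' => h3.ne (h.2 h')
      split_ifs at h1 <;> omega
    · rintro ⟨h1, h2⟩
      constructor
      · split_ifs <;> omega
      · omega
  have h2 : ∀ c, ∑ r, orderSign r (g.row c) * orderSign (g.row.symm r) c =
      ∑ c', orderSign (g.row c') (g.row c) * orderSign c' c := by
    intro c
    rw [← Equiv.sum_comp g.row]
    simp only [Equiv.symm_apply_apply]
  have h3 : g.T = ∑ c, ∑ c', if c' < c ∧ g.row c' < g.row c then (1 : ℤ) else 0 := by
    unfold Generator.T
    rw [Finset.sum_comm]
    exact Finset.sum_congr rfl fun c _ => Finset.sum_congr rfl fun c' _ => h1 c' c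
  have h4 : g.T = ∑ c, ∑ c', if c < c' ∧ g.row c < g.row c' then (1 : ℤ) else 0 :=
    Finset.sum_congr rfl fun c _ => Finset.sum_congr rfl fun c' _ => h1 c c'
  have h5 : 4 * g.T = 2 * g.T + 2 * g.T := by ring
  rw [h5]
  nth_rewrite 1 [h3]
  rw [h4, Finset.mul_sum, Finset.mul_sum, ← Finset.sum_add_distrib, ← Finset.sum_add_distrib]
  refine Finset.sum_congr rfl fun c _ => ?_
  rw [h2, Finset.mul_sum, Finset.mul_sum, ← Finset.sum_add_distrib, ← Finset.sum_add_distrib]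
  refine Finset.sum_congr rfl fun c' _ => ?_
  have h : g.row c = g.row c' ↔ c = c' := g.row.injective.eq_iff
  unfold orderSign
  split_ifs <;> omega

/-- The sum over the punctures of the signs of the quadrants in which they lie, seen from the
lattice point `(c, r)`. -/
def quadrantSum (D : GridDiagram n) (c r : Fin n) : ℤ :=
  ∑ d, orderSign c d * (orderSign r (D.O d) + orderSign r (D.X d))

lemma sum_quadrantSum_columns (g : D.Generator) : ∑ c, quadrantSum D c (g.row c) =
    ∑ c, ∑ r, orderSign (g.row.symm r) c *
      (orderSign r (D.bot c) + orderSign r (D.top c)) := by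
  unfold quadrantSum
  rw [Finset.sum_comm]
  refine Finset.sum_congr rfl fun d _ => ?_
  rw [← Equiv.sum_comp g.row fun r => orderSign (g.row.symm r) d *
    (orderSign r (D.bot d) + orderSign r (D.top d))]
  refine Finset.sum_congr rfl fun c _ => ?_
  rw [Equiv.symm_apply_apply]
  rcases D.bot_top_cases d with ⟨h1, h2, -⟩ | ⟨h1, h2, -⟩ <;> rw [h1, h2]
  ring

lemma sum_quadrantSum_rows (g : D.Generator) : ∑ c, quadrantSum D c (g.row c) =
    ∑ c, ∑ r, orderSign r (g.row c) *
      (orderSign (D.left r) c + orderSign (D.right r) c) := by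
  unfold quadrantSum
  refine Finset.sum_congr rfl fun c _ => ?_
  have h1 : ∀ r, orderSign r (g.row c) * (orderSign (D.left r) c + orderSign (D.right r) c) =
      orderSign r (g.row c) * orderSign (D.O.symm r) c +
        orderSign r (g.row c) * orderSign (D.X.symm r) c := by
    intro r
    rcases D.left_right_cases r with ⟨h1, h2, -⟩ | ⟨h1, h2, -⟩ <;> rw [h1, h2] <;> ring
  rw [Finset.sum_congr rfl fun r _ => h1 r, Finset.sum_add_distrib,
    ← Equiv.sum_comp D.O fun r => orderSign r (g.row c) * orderSign (D.O.symm r) c,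
    ← Equiv.sum_comp D.X fun r => orderSign r (g.row c) * orderSign (D.X.symm r) c,
    ← Finset.sum_add_distrib]
  refine Finset.sum_congr rfl fun d _ => ?_
  rw [Equiv.symm_apply_apply, Equiv.symm_apply_apply, orderSign_swap c d,
    orderSign_swap (g.row c) (D.O d), orderSign_swap (g.row c) (D.X d)]
  ring

/-- Away from the crossings at least one of the two signs which contribute to `T` does not depend
on the generator. -/
lemma orderSign_mul_orderSign (g : D.Generator) (c r : Fin n) :
    4 * (orderSign r (g.row c) * orderSign (g.row.symm r) c) =
      4 * (if D.IsCrossing c r then orderSign r (g.row c) * orderSign (g.row.symm r) c else 0) +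
      2 * (orderSign (g.row.symm r) c * (orderSign r (D.bot c) + orderSign r (D.top c))) +
      2 * (orderSign r (g.row c) * (orderSign (D.left r) c + orderSign (D.right r) c)) -
      if r = D.bot c ∨ r = D.top c then 0 else
        (orderSign r (D.bot c) + orderSign r (D.top c)) *
          (orderSign (D.left r) c + orderSign (D.right r) c) := by
  have h1 := g.meets_row c
  have h2 := g.meets_column r
  have h3 : g.row c = r ↔ g.row.symm r = c := by
    rw [Equiv.symm_apply_eq, eq_comm]
  have h4 := D.bot_lt_top c
  have h5 := D.left_lt_right r
  have h6 := D.isPuncture_iff c r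
  generalize g.row c = γ at *
  generalize g.row.symm r = ρ at *
  by_cases hp : r = D.bot c ∨ r = D.top c
  · have hk : ¬ D.IsCrossing c r := by
      unfold IsCrossing
      omega
    have key : (orderSign r γ = 0 ∧ orderSign ρ c = 0) ∨
        (orderSign r γ = orderSign r (D.bot c) + orderSign r (D.top c) ∧
          orderSign ρ c = orderSign (D.left r) c + orderSign (D.right r) c) := by
      by_cases hγ : γ = r
      · left
        unfold orderSign
        split_ifs <;> omega
      · right
        unfold orderSign
        constructor <;> split_ifs <;> omega
    rw [if_neg hk, if_pos hp]
    rcases key with ⟨k1, k2⟩ | ⟨k1, k2⟩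
    · rw [k1, k2]; ring
    · rw [← k1, ← k2]; ring
  · have hV : orderSign r (D.bot c) + orderSign r (D.top c) = 2 * orderSign r γ ∨
        (orderSign r (D.bot c) + orderSign r (D.top c) = 0 ∧ D.bot c < r ∧ r < D.top c) := by
      by_cases hin : D.bot c < r ∧ r < D.top c
      · right
        refine ⟨?_, hin⟩
        unfold orderSign
        split_ifs <;> omega
      · left
        unfold orderSign
        split_ifs <;> omega
    have hH : orderSign (D.left r) c + orderSign (D.right r) c = 2 * orderSign ρ c ∨
        (orderSign (D.left r) c + orderSign (D.right r) c = 0 ∧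
          D.left r < c ∧ c < D.right r) := by
      by_cases hin : D.left r < c ∧ c < D.right r
      · right
        refine ⟨?_, hin⟩
        unfold orderSign
        split_ifs <;> omega
      · left
        unfold orderSign
        split_ifs <;> omega
    have hnot : ∀ {d e : Fin n}, d < e → orderSign d e ≠ 0 := by
      intro d e h
      unfold orderSign
      rw [if_pos h]
      exact one_ne_zero
    rw [if_neg hp]
    by_cases hk : D.IsCrossing c r
    · have g1 : orderSign r (D.bot c) + orderSign r (D.top c) = 0 := by
        have := hk.1
        unfold orderSign
        split_ifs <;> omega
      have g2 : orderSign (D.left r) c + orderSign (D.right r) c = 0 := by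
        have := hk.2
        unfold orderSign
        split_ifs <;> omega
      rw [if_pos hk, g1, g2]
      ring
    · rw [if_neg hk]
      rcases hV with hV | ⟨hV, hV'⟩ <;> rcases hH with hH | ⟨hH, hH'⟩
      · rw [hV, hH]; ring
      · rw [hV, hH]; ring
      · rw [hV, hH]; ring
      · exact absurd ⟨hV', hH'⟩ hk

lemma exists_sum_orderSign (D : GridDiagram n) : ∃ K : ℤ, ∀ g : D.Generator,
    16 * g.T = 4 * (∑ c, ∑ r, if D.IsCrossing c r then
      orderSign r (g.row c) * orderSign (g.row.symm r) c else 0) +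
      4 * (∑ c, quadrantSum D c (g.row c)) + K := by
  refine ⟨4 * (∑ c : Fin n, ∑ c' : Fin n, if c = c' then 0 else 1) -
    ∑ c, ∑ r, if r = D.bot c ∨ r = D.top c then 0 else
        (orderSign r (D.bot c) + orderSign r (D.top c)) *
          (orderSign (D.left r) c + orderSign (D.right r) c), fun g => ?_⟩
  have h1 := g.T_eq
  have h2 : 4 * (∑ c, ∑ r, orderSign r (g.row c) * orderSign (g.row.symm r) c) =
      ∑ c, ∑ r, 4 * (orderSign r (g.row c) * orderSign (g.row.symm r) c) := by
    simp only [Finset.mul_sum]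
  rw [Finset.sum_congr rfl fun c _ => Finset.sum_congr rfl fun r _ =>
    orderSign_mul_orderSign g c r] at h2
  simp only [Finset.sum_sub_distrib, Finset.sum_add_distrib, ← Finset.mul_sum] at h2
  rw [← sum_quadrantSum_columns, ← sum_quadrantSum_rows] at h2
  linarith

/-- The height of the resolution of a generator. A crossing is `1`-resolved if the two signs at it
agree, and at a point of the generator the sum of signs is corrected by the strand. -/
lemma exists_height (F : D.FigureEights) : ∃ K : ℤ, ∀ g : D.Generator,
    2 * D.height (genRes F g) = (∑ c, ∑ r, if D.IsCrossing c r then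
      orderSign r (g.row c) * orderSign (g.row.symm r) c else 0) -
      (∑ c, if D.IsCrossing c (g.row c) then 2 * (if F.isUpward g c then 1 else 0) - 1 else 0) +
      K := by
  classical
  refine ⟨∑ k : D.Crossing, 1, fun g => ?_⟩
  have h1 : ∀ G : Fin n → Fin n → ℤ, (∑ c, ∑ r, if D.IsCrossing c r then G c r else 0) =
      ∑ k : D.Crossing, G k.1.1 k.1.2 := by
    intro G
    rw [← Finset.sum_product' (f := fun c r => if D.IsCrossing c r then G c r else 0),
      Finset.univ_product_univ, ← Finset.sum_filter]
    exact Finset.sum_subtype (p := fun k : Fin n × Fin n => D.IsCrossing k.1 k.2) _ (by simp)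
      fun k => G k.1 k.2
  have h2 : (∑ c, if D.IsCrossing c (g.row c) then
      2 * (if F.isUpward g c then (1 : ℤ) else 0) - 1 else 0) =
      ∑ c, ∑ r, if D.IsCrossing c r then
        (if r = g.row c then 2 * (if F.isUpward g c then 1 else 0) - 1 else 0) else 0 := by
    refine Finset.sum_congr rfl fun c _ => ?_
    rw [Finset.sum_eq_single (g.row c)]
    · rw [if_pos rfl]
    · intro r _ hr
      rw [if_neg hr, ite_self]
    · intro h
      exact absurd (Finset.mem_univ _) h
  rw [h2, h1, h1, height, Finset.mul_sum, ← Finset.sum_sub_distrib, ← Finset.sum_add_distrib]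
  refine Finset.sum_congr rfl fun k _ => ?_
  have h3 : g.row k.1.1 = k.1.2 ↔ g.row.symm k.1.2 = k.1.1 := by
    rw [Equiv.symm_apply_eq, eq_comm]
  unfold genRes
  by_cases h : g.row k.1.1 = k.1.2
  · rw [if_pos h, if_pos h.symm, h, h3.1 h]
    unfold orderSign
    cases F.isUpward g k.1.1 <;> simp
  · rw [if_neg h, if_neg (Ne.symm h)]
    have h4 := fun h' => h (h3.2 h')
    unfold orderSign
    simp only [decide_eq_true_eq]
    split_ifs <;> omega

end GridDiagram

/-! ### The grading `Q` -/

lemma windSegment_self (p a : ℤ × ℤ) : windSegment p a a = 0 := by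
  unfold windSegment
  rw [if_neg (by omega), if_neg (by omega)]

lemma windSegment_swap (p a b : ℤ × ℤ) : windSegment p b a = - windSegment p a b := by
  have h : (a.1 - b.1) * (p.2 - b.2) - (a.2 - b.2) * (p.1 - b.1) =
      -((b.1 - a.1) * (p.2 - a.2) - (b.2 - a.2) * (p.1 - a.1)) := by ring
  unfold windSegment
  simp only [h]
  generalize (b.1 - a.1) * (p.2 - a.2) - (b.2 - a.2) * (p.1 - a.1) = s
  split_ifs <;> omega

lemma windSegment_eq_zero {p a b : ℤ × ℤ} (h1 : ¬ (a.2 ≤ p.2 ∧ p.2 < b.2))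
    (h2 : ¬ (b.2 ≤ p.2 ∧ p.2 < a.2)) : windSegment p a b = 0 := by
  unfold windSegment
  rw [if_neg (by tauto), if_neg (by tauto)]

lemma windSegment_vertical (p : ℤ × ℤ) (x y z : ℤ) : windSegment p (x, y) (x, z) =
    if p.1 < x then (if y ≤ p.2 ∧ p.2 < z then 1 else if z ≤ p.2 ∧ p.2 < y then -1 else 0)
      else 0 := by
  by_cases h1 : y ≤ p.2 ∧ p.2 < z
  · have h2 : p.1 < x ↔ 0 < (z - y) * (x - p.1) := by
      rw [mul_pos_iff_of_pos_left (by omega), sub_pos]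
    have h3 : (x - x) * (p.2 - y) - (z - y) * (p.1 - x) = (z - y) * (x - p.1) := by ring
    unfold windSegment
    simp only [h3, h2]
    split_ifs <;> omega
  · by_cases h4 : z ≤ p.2 ∧ p.2 < y
    · have h2 : p.1 < x ↔ 0 < (y - z) * (x - p.1) := by
        rw [mul_pos_iff_of_pos_left (by omega), sub_pos]
      have h3 : (x - x) * (p.2 - y) - (z - y) * (p.1 - x) = -((y - z) * (x - p.1)) := by ring
      unfold windSegment
      simp only [h3, h2]
      split_ifs <;> omega
    · rw [windSegment_eq_zero h1 h4, if_neg h1, if_neg h4, ite_self]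

lemma windSegment_vertical_of_lt {p : ℤ × ℤ} {x : ℤ} (h : p.1 < x) (y z : ℤ) :
    windSegment p (x, y) (x, z) =
      if y ≤ p.2 ∧ p.2 < z then 1 else if z ≤ p.2 ∧ p.2 < y then -1 else 0 := by
  rw [windSegment_vertical, if_pos h]

lemma windSegment_vertical_of_le {p : ℤ × ℤ} {x : ℤ} (h : x ≤ p.1) (y z : ℤ) :
    windSegment p (x, y) (x, z) = 0 := by
  rw [windSegment_vertical, if_neg (not_lt.2 h)]

lemma windPath_append (p a : ℤ × ℤ) : ∀ l l' : List (ℤ × ℤ),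
    windPath p (l ++ a :: l') = windPath p (l ++ [a]) + windPath p (a :: l')
  | [], l' => by simp [windPath]
  | [b], l' => by simp [windPath]
  | b :: b' :: l, l' => by
    have := windPath_append p a (b' :: l) l'
    simp only [List.cons_append, windPath] at this ⊢
    rw [this, add_assoc]

lemma windPath_reverse (p : ℤ × ℤ) : ∀ l : List (ℤ × ℤ),
    windPath p l.reverse = - windPath p l
  | [] => by simp [windPath]
  | [a] => by simp [windPath]
  | a :: b :: l => by
    have := windPath_reverse p (b :: l)
    rw [List.reverse_cons] at this
    rw [List.reverse_cons, List.reverse_cons, List.append_assoc, List.singleton_append,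
      windPath_append, this]
    simp only [windPath, windSegment_swap p a b]
    ring

namespace GridDiagram

variable {n : ℕ} {D : GridDiagram n}

/-- Every tail ends at the last vertex of the figure-eight. -/
lemma exists_tail_eq (F : D.FigureEights) (g : D.Generator) (c : Fin n) :
    ∃ l, F.tail g c = l ++ [(4 * (c : ℤ) - 1, 4 * (F.level c : ℤ) + 3)] := by
  refine ⟨(F.tail g c).dropLast, ?_⟩
  unfold FigureEights.tail FigureEights.position
  cases decide (F.level c < g.row c) <;> cases g.side c <;> rfl

lemma windPath_pathBetween (F : D.FigureEights) (g h : D.Generator) (c : Fin n) (p : ℤ × ℤ) :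
    windPath p (F.pathBetween h g c) = windPath p (F.tail h c) - windPath p (F.tail g c) := by
  obtain ⟨l, hl⟩ := exists_tail_eq F h c
  obtain ⟨l', hl'⟩ := exists_tail_eq F g c
  rw [FigureEights.pathBetween, sub_eq_add_neg, ← windPath_reverse p (F.tail g c), hl, hl',
    List.reverse_append, List.reverse_singleton, List.singleton_append, List.append_assoc,
    List.singleton_append, windPath_append]
  simp only [windPath, windSegment_self, zero_add]

/-- The sum over all punctures of the winding contributions of the tail in column `c`. -/
def tailWinding (F : D.FigureEights) (g : D.Generator) (c : Fin n) : ℤ :=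
  ∑ d : Fin n, (windPath (4 * (d : ℤ), 4 * (D.X d : ℤ)) (F.tail g c) +
    windPath (4 * (d : ℤ), 4 * (D.O d : ℤ)) (F.tail g c))

/-- Horizontal segments do not contribute to the winding numbers, so that `Q` is a sum over the
columns. -/
lemma relQ_eq (F : D.FigureEights) (g h : D.Generator) :
    F.relQ g h = ∑ c, tailWinding F h c - ∑ c, tailWinding F g c := by
  have h1 : ∀ p, F.windingNumber g h p =
      ∑ c, (windPath p (F.tail h c) - windPath p (F.tail g c)) := by
    intro p
    unfold FigureEights.windingNumber
    rw [Finset.sum_eq_zero, zero_add]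
    · exact Finset.sum_congr rfl fun c _ => windPath_pathBetween F g h c p
    · intro r _
      simp only [windPath, add_zero]
      apply windSegment_eq_zero <;> simp [Generator.point]
  unfold FigureEights.relQ tailWinding
  simp only [h1, Finset.sum_sub_distrib, Finset.sum_add_distrib]
  rw [Finset.sum_comm (f := fun (d : Fin n) (c : Fin n) => windPath (4 * (d : ℤ), 4 * (D.X d : ℤ))
      (F.tail h c)),
    Finset.sum_comm (f := fun (d : Fin n) (c : Fin n) => windPath (4 * (d : ℤ), 4 * (D.X d : ℤ))
      (F.tail g c)),
    Finset.sum_comm (f := fun (d : Fin n) (c : Fin n) => windPath (4 * (d : ℤ), 4 * (D.O d : ℤ))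
      (F.tail h c)),
    Finset.sum_comm (f := fun (d : Fin n) (c : Fin n) => windPath (4 * (d : ℤ), 4 * (D.O d : ℤ))
      (F.tail g c))]
  ring

lemma Q_genX (F : D.FigureEights) : F.Q D.genX = 0 := by
  unfold FigureEights.Q
  rw [relQ_eq, sub_self]

/-- The contribution of the tail from the point of `g` in column `c` to the winding number around
a puncture `(d, y)`. -/
lemma windPath_tail (F : D.FigureEights) (g : D.Generator) (c d y : Fin n)
    (hy : d = c → y = D.bot c ∨ y = D.top c) :
    windPath (4 * (d : ℤ), 4 * (y : ℤ)) (F.tail g c) =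
      (if d < c then (if y ≤ F.level c then 1 else 0) - (if y < g.row c then 1 else 0) else 0) +
      if d = c then
        (if F.level c < g.row c then
          (if y = D.bot c then 1 else if g.side c then 0 else -1)
        else if y = D.bot c ∧ (g.side c → g.row c = D.bot c) then 1 else 0)
      else 0 := by
  have hb := F.bot_le c
  have ht := F.lt_top c
  have hr := (g.meets c).1
  -- the diagonal parts lie between two rows, and the horizontal parts do not count
  have hdiag : windSegment (4 * (d : ℤ), 4 * (y : ℤ))
      (4 * (c : ℤ) + 1, 4 * (F.level c : ℤ) + 3) (4 * (c : ℤ) - 1, 4 * (F.level c : ℤ) + 1) = 0 := by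
    apply windSegment_eq_zero <;> simp only <;> omega
  have hdiag' : windSegment (4 * (d : ℤ), 4 * (y : ℤ))
      (4 * (c : ℤ) + 1, 4 * (F.level c : ℤ) + 1) (4 * (c : ℤ) - 1, 4 * (F.level c : ℤ) + 3) = 0 := by
    apply windSegment_eq_zero <;> simp only <;> omega
  have hhor : ∀ x x' z : ℤ, windSegment (4 * (d : ℤ), 4 * (y : ℤ)) (x, z) (x', z) = 0 := by
    intro x x' z
    apply windSegment_eq_zero <;> simp only <;> omega
  unfold FigureEights.tail FigureEights.position FigureEights.curve Generator.point strandX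
  by_cases hlev : F.level c < g.row c <;> cases hs : g.side c
  all_goals
    first
    | rw [decide_eq_true hlev, if_pos hlev]
    | rw [decide_eq_false hlev, if_neg hlev]
    simp only [List.drop, windPath, hdiag, hdiag', hhor, Bool.false_eq_true, if_false, if_true,
      ← sub_eq_add_neg, false_imp_iff, true_imp_iff, and_true]
    rcases lt_trichotomy d c with hd | hd | hd
    · have hl : (4 * (d : ℤ), 4 * (y : ℤ)).1 < 4 * (c : ℤ) - 1 := by simp only; omega
      have hr' : (4 * (d : ℤ), 4 * (y : ℤ)).1 < 4 * (c : ℤ) + 1 := by simp only; omega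
      simp only [windSegment_vertical_of_lt hl, windSegment_vertical_of_lt hr', if_pos hd,
        if_neg hd.ne]
      clear hl hr' hdiag hdiag' hhor
      split_ifs <;> omega
    · have hl : 4 * (c : ℤ) - 1 ≤ (4 * (d : ℤ), 4 * (y : ℤ)).1 := by simp only; omega
      have hr' : (4 * (d : ℤ), 4 * (y : ℤ)).1 < 4 * (c : ℤ) + 1 := by simp only; omega
      simp only [windSegment_vertical_of_le hl, windSegment_vertical_of_lt hr',
        if_neg (hd ▸ lt_irrefl d : ¬ d < c), if_pos hd]
      clear hl hr' hdiag hdiag' hhor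
      split_ifs <;> omega
    · have hl : 4 * (c : ℤ) - 1 ≤ (4 * (d : ℤ), 4 * (y : ℤ)).1 := by simp only; omega
      have hr' : 4 * (c : ℤ) + 1 ≤ (4 * (d : ℤ), 4 * (y : ℤ)).1 := by simp only; omega
      simp only [windSegment_vertical_of_le hl, windSegment_vertical_of_le hr',
        if_neg hd.not_gt, if_neg hd.ne', add_zero]

/-- The contribution of a single column `d` to the sum of quadrants and to the grading `Q`. -/
lemma orderSign_add_windPath (F : D.FigureEights) (g : D.Generator) (c d : Fin n) :
    orderSign c d * (orderSign (g.row c) (D.O d) + orderSign (g.row c) (D.X d)) +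
      4 * (windPath (4 * (d : ℤ), 4 * (D.X d : ℤ)) (F.tail g c) +
        windPath (4 * (d : ℤ), 4 * (D.O d : ℤ)) (F.tail g c)) =
      (if d < c then (if D.X d ≤ F.level c then 4 else 0) +
        (if D.O d ≤ F.level c then 4 else 0) - 4 else 0) +
      (orderSign (g.row c) (D.O d) + orderSign (g.row c) (D.X d)) +
      (if D.O d = g.row c then if d < c then 2 else 0 else 0) +
      (if D.X d = g.row c then if d < c then 2 else 0 else 0) +
      if d = c then
        4 * (if F.level c < g.row c then if g.side c then 1 else 0
          else if g.side c → g.row c = D.bot c then 1 else 0) -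
        (orderSign (g.row c) (D.bot c) + orderSign (g.row c) (D.top c)) else 0 := by
  have h1 := D.bot_lt_top c
  by_cases hd : d = c
  · subst hd
    rw [windPath_tail F g d d (D.X d) fun _ => by
        rcases D.bot_top_cases d with h | h <;> simp [h.1],
      windPath_tail F g d d (D.O d) fun _ => by
        rcases D.bot_top_cases d with h | h <;> simp [h.2.1]]
    have h2 : orderSign d d = 0 := by simp [orderSign]
    rw [h2]
    simp only [lt_irrefl, if_false, if_true, ite_self]
    rcases D.bot_top_cases d with ⟨h3, h4, -⟩ | ⟨h3, h4, -⟩ <;> rw [h3, h4] <;>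
      simp only [h1.ne', false_and, if_false, if_true, true_and] <;> split_ifs <;> ring
  · rw [windPath_tail F g c d (D.X d) fun h => absurd h hd,
      windPath_tail F g c d (D.O d) fun h => absurd h hd]
    simp only [if_neg hd]
    unfold orderSign
    by_cases hlt : d < c
    · rw [if_neg (by omega), if_pos hlt]
      simp only [if_pos hlt]
      split_ifs <;> omega
    · rw [if_pos (by omega)]
      simp only [if_neg hlt, ite_self]
      ring

/-- In each column, what remains of the gradings after the removal of the sum over the crossings
is the sum of a function of the column and a function of the row. -/
lemma exists_column_identity (F : D.FigureEights) : ∃ a b : Fin n → ℤ, ∀ (g : D.Generator) c,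
    quadrantSum D c (g.row c) +
      (if D.IsCrossing c (g.row c) then 2 * (if F.isUpward g c then 1 else 0) - 1 else 0) +
      2 * (if F.isUpward g c then 1 else 0) + 4 * tailWinding F g c = a c + b (g.row c) := by
  refine ⟨fun c => (∑ d, if d < c then (if D.X d ≤ F.level c then 4 else 0) +
        (if D.O d ≤ F.level c then 4 else 0) - 4 else 0) + 5,
    fun r => ∑ d, (orderSign r (D.O d) + orderSign r (D.X d)), fun g c => ?_⟩
  have h1 : quadrantSum D c (g.row c) + 4 * tailWinding F g c =
      ∑ d : Fin n, (orderSign c d * (orderSign (g.row c) (D.O d) + orderSign (g.row c) (D.X d)) +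
      4 * (windPath (4 * (d : ℤ), 4 * (D.X d : ℤ)) (F.tail g c) +
        windPath (4 * (d : ℤ), 4 * (D.O d : ℤ)) (F.tail g c))) := by
    unfold quadrantSum tailWinding
    rw [Finset.mul_sum, ← Finset.sum_add_distrib]
  have h2 : ∀ (f : Fin n → ℤ) (σ : Equiv.Perm (Fin n)) (r : Fin n),
      (∑ d, if σ d = r then f d else 0) = f (σ.symm r) := by
    intro f σ r
    rw [← Equiv.sum_comp σ.symm]
    simp
  rw [Finset.sum_congr rfl fun d _ => orderSign_add_windPath F g c d,
    Finset.sum_add_distrib, Finset.sum_add_distrib, Finset.sum_add_distrib,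
    Finset.sum_add_distrib, h2 (fun d => if d < c then 2 else 0),
    h2 (fun d => if d < c then 2 else 0), Finset.sum_ite_eq' Finset.univ c,
    if_pos (Finset.mem_univ c)] at h1
  suffices h : (if D.IsCrossing c (g.row c) then 2 * (if F.isUpward g c then 1 else 0) - 1 else 0) +
      2 * (if F.isUpward g c then 1 else 0) + ((if D.O.symm (g.row c) < c then 2 else 0) +
      (if D.X.symm (g.row c) < c then 2 else 0) +
      (4 * (if F.level c < g.row c then if g.side c then 1 else 0
          else if g.side c → g.row c = D.bot c then 1 else 0) -
        (orderSign (g.row c) (D.bot c) + orderSign (g.row c) (D.top c)))) = (5 : ℤ) by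
    simp only
    linarith
  have h3 := D.left_lt_right (g.row c)
  have h4 : (if D.O.symm (g.row c) < c then (2 : ℤ) else 0) +
      (if D.X.symm (g.row c) < c then 2 else 0) = (if D.left (g.row c) < c then 2 else 0) +
        (if D.right (g.row c) < c then 2 else 0) := by
    rcases D.left_right_cases (g.row c) with ⟨h1, h2, -⟩ | ⟨h1, h2, -⟩ <;> rw [h1, h2]
    exact add_comm _ _
  rw [h4]
  have h5 := D.bot_lt_top c
  have h6 := g.meets c
  have h7 := D.isPuncture_iff c (g.row c)
  have h8 := F.bot_le c
  have h9 := F.lt_top c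
  unfold Meets strandX at h6
  unfold FigureEights.isUpward orderSign IsCrossing
  clear h1 h2 h4
  generalize g.row c = γ at *
  by_cases hlev : F.level c < γ <;> cases hs : g.side c <;> simp [hlev, hs] at h6 ⊢ <;>
    split_ifs <;> omega

/-- The gradings `T`, `Q` and `P̄` determine the height of the resolution of `g`, up to a constant
which depends only on the diagram and the figure-eights. -/
lemma exists_grading_identity (F : D.FigureEights) : ∃ K : ℤ, ∀ g : D.Generator,
    2 * (g.T - F.Q g) + F.barP g - D.height (genRes F g) = K := by
  obtain ⟨K₁, h1⟩ := exists_sum_orderSign D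
  obtain ⟨K₂, h2⟩ := exists_height F
  obtain ⟨a, b, h3⟩ := exists_column_identity F
  have h4 : ∀ g : D.Generator, 8 * (2 * (g.T - F.Q g) + F.barP g - D.height (genRes F g)) =
      K₁ - 4 * K₂ - 16 * (∑ c, tailWinding F D.genX c) + 4 * (∑ c, a c + ∑ c, b c) := by
    intro g
    have h5 : F.Q g = ∑ c, tailWinding F D.genX c - ∑ c, tailWinding F g c := relQ_eq F g D.genX
    have h6 : ∑ c, (quadrantSum D c (g.row c) +
      (if D.IsCrossing c (g.row c) then 2 * (if F.isUpward g c then 1 else 0) - 1 else 0) +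
      2 * (if F.isUpward g c then 1 else 0) + 4 * tailWinding F g c) =
        ∑ c, a c + ∑ c, b c := by
      rw [← Equiv.sum_comp g.row b, ← Finset.sum_add_distrib]
      exact Finset.sum_congr rfl fun c _ => h3 g c
    simp only [Finset.sum_add_distrib, ← Finset.mul_sum] at h6
    have h7 := h1 g
    have h8 := h2 g
    change _ + 2 * F.barP g + _ = _ at h6
    linarith
  -- the right hand side of `h4` need not be divisible by `8` if there is no generator
  rcases isEmpty_or_nonempty D.Generator with h | ⟨⟨g₀⟩⟩
  · exact ⟨0, fun g => h.elim g⟩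
  · refine ⟨2 * (g₀.T - F.Q g₀) + F.barP g₀ - D.height (genRes F g₀), fun g => ?_⟩
    have := (h4 g).trans (h4 g₀).symm
    omega

/-- The bigradings of a generator and of its enhanced state agree. -/
lemma bidegree_genState (F : D.FigureEights) (g : D.Generator) :
    D.khI (genState F g) = F.P g + F.J g ∧ D.khJ (genState F g) = F.J g := by
  obtain ⟨K, hK⟩ := exists_grading_identity F
  obtain ⟨K', hK'⟩ := exists_sum_label_add_barP F
  have h1 := (hK g).trans (hK D.genX).symm
  have h2 := hK' g
  have h3 := hK' D.genX
  rw [genRes_genX, height_seifert, Q_genX, ← genState_fst] at h1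
  rw [sum_label_genX] at h3
  have h4 := D.writhe_eq
  unfold khI khJ FigureEights.P FigureEights.J
  constructor <;> linarith

end GridDiagram

end

theorem theorem1 (n : ℕ) (hn : 2 ≤ n) (D : GridDiagram n) (F : D.FigureEights) :
    IsBigradedDifferential D.khI D.khJ D.khD ∧
    ∃ δ : (D.Generator →₀ ℤ) →ₗ[ℤ] (D.Generator →₀ ℤ),
      IsBigradedDifferential F.P F.J δ ∧
      (∀ p q : ℤ, Nonempty (BigradedHomology F.P F.J δ p q ≃ₗ[ℤ] D.Kh (p + q) q)) ∧
      BigradedHomotopyEquivalent (fun g => F.P g + F.J g) F.J δ D.khI D.khJ D.khD := by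
  obtain ⟨δ, hδ, hequiv⟩ := GridDiagram.exists_reduction (GridDiagram.genState F)
    (GridDiagram.genState_injective F) (GridDiagram.range_genState F)
  have hI : D.khI ∘ GridDiagram.genState F = fun g => F.P g + F.J g :=
    funext fun g => (GridDiagram.bidegree_genState F g).1
  have hJ : D.khJ ∘ GridDiagram.genState F = F.J :=
    funext fun g => (GridDiagram.bidegree_genState F g).2
  rw [hI, hJ] at hδ hequiv
  refine ⟨D.isBigradedDifferential_khD, δ, ⟨?_, hδ.sq_zero⟩, fun p q => ?_, hequiv⟩
  · rw [hasBidegree_iff]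
    intro s t h
    have := (hasBidegree_iff.1 hδ.bidegree) s t h
    omega
  · obtain ⟨e⟩ := bigradedHomology_add_grading (a := F.P) (b := F.J) δ p q
    obtain ⟨e'⟩ := hequiv.homology (p + q) q
    exact ⟨e.trans e'⟩
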